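/- Let $(\Omega,\mathcal F,\mathbb P_0)$ be a probability space carrying mutually independent elements: a Poisson process $N$ with rate $\mu>0$ and arrival times $0<\sigma_1<\sigma_2<\cdots\to\infty$; i.i.d. nonzero $\mathbb R^d$-valued claims $Y_1,Y_2,\dots$ with law $\beta_0$; a random time $\theta\ge 0$ with $\mathbb P_0\{\theta=0\}=\pi\in[0,1)$ and $\mathbb P_0\{\theta>t\mid\theta>0\}=e^{-\lambda t}$, $t\ge0$, where $\lambda>0$; and a random variable $\Lambda$ with law $\gamma$, where $\gamma((0,\infty))=1$ and $\int |v-\mu|^k\,\gamma(dv)<\infty$ for all $k\in\mathbb N_0$. Put $m^{(k)}=\int (v-\mu)^k\,\gamma(dv)$. Let $X_t=X_0+\sum_{k=1}^{N_t}Y_k$ with $X_0$ constant, let $\mathbb F=(\mathcal F_t)$ be the natural filtration of $X$, and $\mathcal G_t=\mathcal F_t\vee\sigma(\theta,\Lambda)$. Let $\beta_1\ll\beta_0$ be a probability measure, $r=d\beta_1/d\beta_0$, $L_t=e^{-(\Lambda-\mu)t}\prod_{k=1}^{N_t}\frac{\Lambda}{\mu}r(Y_k)$, and let $\mathbb P$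 be a probability measure on $(\Omega,\mathcal F)$ with $$\frac{d\mathbb P}{d\mathbb P_0}\Big|_{\mathcal G_t}=Z_t=\frac{L_t}{L_\theta}1_{\{\theta\le t\}}+1_{\{\theta>t\}},\qquad t\ge 0,$$ where $L_t/L_\theta$ denotes $e^{-(\Lambda-\mu)(t-\theta)}\prod_{k=N_\theta+1}^{N_t}\frac{\Lambda}{\mu}r(Y_k)$. (Thus under $\mathbb P$ the arrival rate and claim law change from $(\mu,\beta_0)$ to $(\Lambda,\beta_1)$ at time $\theta$.) Let $\Pi_t=\mathbb P\{\theta\le t\mid\mathcal F_t\}$, and let $p$ be the point process $p((0,t]\times A)=\sum_{k\ge1}1_{\{\sigma_k\le t\}}1_{\{Y_k\in A\}}$. Then there are $\mathbb F$-adapted processes $\Phi^{(k)}$, $k\in\mathbb N_0$, with càdlàg paths almost surely under both $\mathbb P_0$ and $\mathbb P$, such that for all $k$ and $t$ $$\Phi^{(k)}_t=\frac{\mathbb E\left[(\Lambda-\mu)^k1_{\{\theta\le t\}}\mid\mathcal F_t\right]}{1-\Pi_t}\qquad \mathbb P\text{-a.s.},$$ and every such family satisfies the following. 1. Almost surely,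 under both $\mathbb P_0$ and $\mathbb P$, for every $k\in\mathbb N_0$, $\Phi^{(k)}_0=\frac{\pi}{1-\pi}m^{(k)}$ and, for all $t\ge 0$ (in integral form), $$d\Phi^{(k)}_t=\left(\lambda(m^{(k)}+\Phi^{(k)}_t)-\Phi^{(k+1)}_t\right)dt+\Phi^{(k)}_{t-}\int_{\mathbb R^d}(r(y)-1)\,p(dt\,dy)+\Phi^{(k+1)}_{t-}\frac1\mu\int_{\mathbb R^d}r(y)\,p(dt\,dy).$$ 2. The sequence $\Phi=(\Phi^{(k)})_{k\in\mathbb N_0}$ is a Markovian sufficient statistic for the detection problem, that is: $\Phi$ is $\mathbb F$-adapted; it is a Markov process relative to $\mathbb F$ with state space $\mathbb R^{\mathbb N_0}$, i.e. for $s\le t$ and bounded measurable $g:\mathbb R^{\mathbb N_0}\to\mathbb R$ the conditional expectations of $g(\Phi_t)$ given $\mathcal F_s$ and given $\sigma(\Phi_s)$ agree almost surely, both under $\mathbb P_0$ and under $\mathbb P$; and for every $c>0$ and every $\mathbb F$-stopping time $\tau$ with values in $[0,\infty]$, $$\mathbb P\{\tau<\theta\}+c\,\mathbb E[(\tau-\theta)^+]=1-\pi+c(1-\pi)\,\mathbb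 E_0\left[\int_0^\tau e^{-\lambda t}\left(\Phi^{(0)}_t-\frac{\lambda}{c}\right)dt\right],$$ both sides being allowed to equal $+\infty$. -/

import Mathlib

open MeasureTheory ProbabilityTheory Filter Set
open scoped Topology NNReal ENNReal

noncomputable section

/-- The space of claim sizes. -/
abbrev Mark (d : ℕ) : Type := EuclideanSpace ℝ (Fin d)

/-- A real function of time is càdlàg: right-continuous with (finite) left limits. -/
def IsCadlag (f : ℝ≥0 → ℝ) : Prop :=
  ∀ t, ContinuousWithinAt f (Ici t) t ∧ ∃ l, Tendsto f (𝓝[<] t) (𝓝 l)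

/-- The data of the compound Poisson disorder problem, all living on the same `Ω`: the constants,
the laws, the reference measure `P₀` and the physical measure `P`, the arrival times
`0 < σ 0 < σ 1 < ⋯ → ∞`, the nonzero claims `Y 0, Y 1, …` (claim `Y k` arrives at time `σ k`),
the disorder time `θ` and the post-disorder rate `Λ`.
What is assumed about their distributions is in `DisorderData.IsModel`. -/
structure DisorderData (Ω : Type*) [MeasurableSpace Ω] (d : ℕ) where
  /-- pre-disorder arrival rate -/
  mu : ℝ
  /-- disorder rate -/
  lam : ℝ
  /-- prior probability that the disorder has happened at time zero -/
  prior : ℝ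
  /-- law of the post-disorder rate -/
  γ : Measure ℝ
  /-- pre-disorder claim size law -/
  β₀ : Measure (Mark d)
  /-- post-disorder claim size law -/
  β₁ : Measure (Mark d)
  /-- initial value of the observation process -/
  x₀ : Mark d
  P₀ : Measure Ω
  P : Measure Ω
  σ : ℕ → Ω → ℝ≥0
  Y : ℕ → Ω → Mark d
  θ : Ω → ℝ≥0
  Λ : Ω → ℝ
  measurable_σ : ∀ k, Measurable (σ k)
  measurable_Y : ∀ k, Measurable (Y k)
  measurable_θ : Measurable θ
  measurable_Λ : Measurable Λ
  σ_pos : ∀ k ω, 0 < σ k ω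
  σ_strictMono : ∀ ω, StrictMono fun k => σ k ω
  σ_tendsto : ∀ ω, Tendsto (fun k => σ k ω) atTop atTop
  Y_ne_zero : ∀ k ω, Y k ω ≠ 0

namespace DisorderData

variable {Ω : Type*} [mΩ : MeasurableSpace Ω] {d : ℕ} (D : DisorderData Ω d)

/-- Number of arrivals up to and including time `t`. -/
def N (t : ℝ≥0) (ω : Ω) : ℕ := {k : ℕ | D.σ k ω ≤ t}.ncard

/-- The observation process, a compound Poisson process under `P₀`. -/
def X (t : ℝ≥0) (ω : Ω) : Mark d := D.x₀ + ∑ k ∈ Finset.range (D.N t ω), D.Y k ω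

theorem finite_arrivals (t : ℝ≥0) (ω : Ω) : {k : ℕ | D.σ k ω ≤ t}.Finite := by
  obtain ⟨n, hn⟩ := ((D.σ_tendsto ω).eventually (eventually_gt_atTop t)).exists
  refine (Set.finite_Iio n).subset fun k hk => ?_
  exact (D.σ_strictMono ω).lt_iff_lt.1 (lt_of_le_of_lt hk hn)

theorem arrivals_eq (t : ℝ≥0) (ω : Ω) : {k : ℕ | D.σ k ω ≤ t} = Iio (D.N t ω) := by
  obtain ⟨n, hn⟩ : ∃ n, {k : ℕ | D.σ k ω ≤ t} = Iio n := by
    have hex := ((D.σ_tendsto ω).eventually (eventually_gt_atTop t)).exists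
    classical
    refine ⟨Nat.find hex, ?_⟩
    ext k
    constructor
    · intro hk
      exact (D.σ_strictMono ω).lt_iff_lt.1 (lt_of_le_of_lt hk (Nat.find_spec hex))
    · intro hk
      exact not_lt.1 (Nat.find_min hex hk)
  have : D.N t ω = n := by
    unfold N
    rw [hn, ← Nat.card_coe_set_eq]
    simp
  rw [this, hn]

theorem lt_N_iff (k : ℕ) (t : ℝ≥0) (ω : Ω) : k < D.N t ω ↔ D.σ k ω ≤ t := by
  have := Set.ext_iff.1 (D.arrivals_eq t ω) k
  exact this.symm

theorem measurable_N (t : ℝ≥0) : Measurable (D.N t) := by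
  refine measurable_of_Ioi fun k => ?_
  have : D.N t ⁻¹' Ioi k = D.σ k ⁻¹' Iic t := by
    ext ω
    exact D.lt_N_iff k t ω
  rw [this]
  exact D.measurable_σ k measurableSet_Iic

theorem measurable_X (t : ℝ≥0) : Measurable (D.X t) := by
  have hS : ∀ n, Measurable fun ω => ∑ k ∈ Finset.range n, D.Y k ω := fun n =>
    Finset.measurable_sum (Finset.range n) fun k _ => D.measurable_Y k
  have h : Measurable fun q : ℕ × Ω => ∑ k ∈ Finset.range q.1, D.Y k q.2 :=
    measurable_from_prod_countable_right hS
  have h2 : Measurable fun ω => ∑ k ∈ Finset.range (D.N t ω), D.Y k ω :=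
    h.comp ((D.measurable_N t).prodMk measurable_id)
  exact h2.const_add D.x₀

/-- The observation filtration: the natural filtration of `X`. -/
def F : Filtration ℝ≥0 mΩ :=
  Filtration.natural D.X fun t => (D.measurable_X t).stronglyMeasurable

/-- The genie's filtration: the initial enlargement of `F` by `θ` and `Λ`. -/
abbrev G (t : ℝ≥0) : MeasurableSpace Ω :=
  D.F t ⊔ MeasurableSpace.comap D.θ inferInstance ⊔ MeasurableSpace.comap D.Λ inferInstance

/-- The likelihood ratio `dβ₁/dβ₀` of the claim sizes. -/
def r (y : Mark d) : ℝ := (D.β₁.rnDeriv D.β₀ y).toReal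

/-- `L t = e^{-(Λ - μ) t} ∏_{k ≤ N t} (Λ / μ) r(Y_k)`. -/
def L (t : ℝ≥0) (ω : Ω) : ℝ :=
  Real.exp (-(D.Λ ω - D.mu) * t) *
    ∏ k ∈ Finset.range (D.N t ω), (D.Λ ω / D.mu * D.r (D.Y k ω))

/-- The quotient `L t / L s`, for `s ≤ t`, after cancellation of the common factors, so that it
also has its intended meaning where `L s = 0` (see `L_div_L`). -/
def LQuot (s t : ℝ≥0) (ω : Ω) : ℝ :=
  Real.exp (-(D.Λ ω - D.mu) * (t - s)) *
    ∏ k ∈ Finset.Ico (D.N s ω) (D.N t ω), (D.Λ ω / D.mu * D.r (D.Y k ω))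

theorem L_div_L {s t : ℝ≥0} (hst : s ≤ t) (ω : Ω) (h : D.L s ω ≠ 0) :
    D.L t ω / D.L s ω = D.LQuot s t ω := by
  have hN : D.N s ω ≤ D.N t ω :=
    Set.ncard_le_ncard (fun k (hk : D.σ k ω ≤ s) => hk.trans hst) (D.finite_arrivals t ω)
  rw [div_eq_iff h, LQuot, L, L, ← Finset.prod_range_mul_prod_Ico _ hN,
    show -(D.Λ ω - D.mu) * (t : ℝ) = -(D.Λ ω - D.mu) * (t - s) + -(D.Λ ω - D.mu) * s by ring,
    Real.exp_add]
  ring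

/-- The density process `Z t = (L t / L θ) 1{θ ≤ t} + 1{θ > t}` of `P` with respect to `P₀`. -/
def Z (t : ℝ≥0) (ω : Ω) : ℝ := if D.θ ω ≤ t then D.LQuot (D.θ ω) t ω else 1

/-- The moments `m^(k) = ∫ (v - μ)^k γ(dv)`. -/
def m (k : ℕ) : ℝ := ∫ v, (v - D.mu) ^ k ∂D.γ

/-- The distributional assumptions of the compound Poisson disorder problem. -/
structure IsModel : Prop where
  mu_pos : 0 < D.mu
  lam_pos : 0 < D.lam
  prior_nonneg : 0 ≤ D.prior
  prior_lt_one : D.prior < 1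
  prob_γ : IsProbabilityMeasure D.γ
  prob_β₀ : IsProbabilityMeasure D.β₀
  prob_β₁ : IsProbabilityMeasure D.β₁
  prob_P₀ : IsProbabilityMeasure D.P₀
  prob_P : IsProbabilityMeasure D.P
  γ_pos : D.γ (Iic 0) = 0
  γ_moments : ∀ k : ℕ, Integrable (fun v => (v - D.mu) ^ k) D.γ
  β_ac : D.β₁ ≪ D.β₀
  /-- Under `P₀`, the counting process `N` is a Poisson process with rate `μ`. -/
  N_indep : HasIndepIncrements D.N D.P₀
  N_law : ∀ s t : ℝ≥0, s ≤ t →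
    D.P₀.map (fun ω => D.N t ω - D.N s ω) = poissonMeasure (D.mu.toNNReal * (t - s))
  Y_indep : iIndepFun D.Y D.P₀
  Y_law : ∀ k, D.P₀.map (D.Y k) = D.β₀
  θ_zero : D.P₀ {ω | D.θ ω = 0} = ENNReal.ofReal D.prior
  θ_pos : ∀ t : ℝ≥0,
    D.P₀[{ω | t < D.θ ω} | {ω | 0 < D.θ ω}] = ENNReal.ofReal (Real.exp (-D.lam * t))
  Λ_law : D.P₀.map D.Λ = D.γ
  /-- The arrivals, the claims, `θ` and `Λ` are mutually independent under `P₀`. -/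
  indep : iIndep ![MeasurableSpace.comap (fun ω k => D.σ k ω) inferInstance,
    MeasurableSpace.comap (fun ω k => D.Y k ω) inferInstance,
    MeasurableSpace.comap D.θ inferInstance,
    MeasurableSpace.comap D.Λ inferInstance] D.P₀
  /-- `dP/dP₀ = Z t` on `G t`, for every `t`. -/
  density : ∀ (t : ℝ≥0) (A : Set Ω), MeasurableSet[D.G t] A →
    D.P A = ∫⁻ ω in A, ENNReal.ofReal (D.Z t ω) ∂D.P₀

/-- The a posteriori probability `Π t = P(θ ≤ t | F t)` (a version of it). -/
def posterior (t : ℝ≥0) : Ω → ℝ := D.P[{ω | D.θ ω ≤ t}.indicator (fun _ => (1 : ℝ)) | D.F t]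

/-- `E[(Λ - μ)^k 1{θ ≤ t} | F t] / (1 - Π t)` for a fixed `t` (a version of it). -/
def oddsRatio (k : ℕ) (t : ℝ≥0) (ω : Ω) : ℝ :=
  (D.P[{ω | D.θ ω ≤ t}.indicator (fun ω => (D.Λ ω - D.mu) ^ k) | D.F t]) ω /
    (1 - D.posterior t ω)

/-- `Φ` is the family of odds-ratio processes: `F`-adapted, almost surely càdlàg, and at each time
given, almost surely, by the quotient of conditional expectations. -/
structure IsOddsRatioFamily (Φ : ℕ → ℝ≥0 → Ω → ℝ) : Prop where
  adapted : ∀ k, StronglyAdapted D.F (Φ k)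
  cadlag : ∀ Q ∈ ({D.P₀, D.P} : Set (Measure Ω)), ∀ᵐ ω ∂Q, ∀ k, IsCadlag fun t => Φ k t ω
  eq_oddsRatio : ∀ k t, Φ k t =ᵐ[D.P] D.oddsRatio k t

/-- The point process of arrivals and claims, as a random measure on time × marks. -/
def p (ω : Ω) : Measure (ℝ≥0 × Mark d) := Measure.sum fun k => Measure.dirac (D.σ k ω, D.Y k ω)

open Classical in
theorem p_Ioc_prod (ω : Ω) (t : ℝ≥0) {A : Set (Mark d)} (hA : MeasurableSet A) :
    D.p ω (Ioc 0 t ×ˢ A) =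
      ∑' k, (if D.σ k ω ≤ t then 1 else 0) * (if D.Y k ω ∈ A then 1 else 0) := by
  rw [p, Measure.sum_apply _ (measurableSet_Ioc.prod hA)]
  refine tsum_congr fun k => ?_
  rw [Measure.dirac_apply' _ (measurableSet_Ioc.prod hA)]
  by_cases h1 : D.σ k ω ≤ t <;> by_cases h2 : D.Y k ω ∈ A <;>
    simp [h1, h2, D.σ_pos k ω]

/-- Pathwise integral form of the system of stochastic differential equations
`dΦ^(k)_t = (λ (m^(k) + Φ^(k)_t) - Φ^(k+1)_t) dt + Φ^(k)_{t-} ∫ (r(y) - 1) p(dt dy)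
  + Φ^(k+1)_{t-} (1/μ) ∫ r(y) p(dt dy)`, with `Φ^(k)_0 = (π / (1 - π)) m^(k)`,
for a sequence `φ` of càdlàg paths on the scenario `ω`. -/
structure SolvesJumpEquation (ω : Ω) (φ : ℕ → ℝ≥0 → ℝ) : Prop where
  initial : ∀ k, φ k 0 = D.prior / (1 - D.prior) * D.m k
  drift_integrable : ∀ k (t : ℝ≥0), IntervalIntegrable
    (fun s : ℝ => D.lam * (D.m k + φ k s.toNNReal) - φ (k + 1) s.toNNReal) volume 0 t
  jump_integrable₁ : ∀ k (t : ℝ≥0), IntegrableOn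
    (fun q : ℝ≥0 × Mark d => Function.leftLim (φ k) q.1 * (D.r q.2 - 1))
    (Ioc 0 t ×ˢ univ) (D.p ω)
  jump_integrable₂ : ∀ k (t : ℝ≥0), IntegrableOn
    (fun q : ℝ≥0 × Mark d => Function.leftLim (φ (k + 1)) q.1 * (1 / D.mu) * D.r q.2)
    (Ioc 0 t ×ˢ univ) (D.p ω)
  equation : ∀ k (t : ℝ≥0), φ k t = φ k 0
    + (∫ s in (0 : ℝ)..t, (D.lam * (D.m k + φ k s.toNNReal) - φ (k + 1) s.toNNReal))
    + (∫ q in Ioc 0 t ×ˢ univ, Function.leftLim (φ k) q.1 * (D.r q.2 - 1) ∂(D.p ω))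
    + ∫ q in Ioc 0 t ×ˢ univ,
        Function.leftLim (φ (k + 1)) q.1 * (1 / D.mu) * D.r q.2 ∂(D.p ω)

/-- The penalty `R_τ = P(τ < θ) + c E[(τ - θ)^+]`. -/
def penalty (c : ℝ) (τ : Ω → ℝ≥0∞) : ℝ≥0∞ :=
  D.P {ω | τ ω < (D.θ ω : ℝ≥0∞)} +
    ENNReal.ofReal c * ∫⁻ ω, (τ ω - (D.θ ω : ℝ≥0∞)) ∂D.P

/-- `E₀[∫_0^τ h_t dt] ∈ [-∞, ∞]`, as the expected integral of the positive part of `h` minus that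
of its negative part (it is used only where the latter is finite). -/
def expectedCost (τ : Ω → ℝ≥0∞) (h : ℝ≥0 → Ω → ℝ) : EReal :=
  ((∫⁻ ω, ∫⁻ t in {t : ℝ | 0 ≤ t ∧ ENNReal.ofReal t < τ ω},
      ENNReal.ofReal (h t.toNNReal ω) ∂volume ∂D.P₀ : ℝ≥0∞) : EReal) -
  ((∫⁻ ω, ∫⁻ t in {t : ℝ | 0 ≤ t ∧ ENNReal.ofReal t < τ ω},
      ENNReal.ofReal (-h t.toNNReal ω) ∂volume ∂D.P₀ : ℝ≥0∞) : EReal)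

/-- The sequence `Φ` is a Markovian sufficient statistic for the detection problem: it is a function
of the observations, it is a Markov process with state space `ℝ^ℕ` relative to the observation
filtration (under the reference and under the physical measure), and the penalty of every stopping
time of the observations is an expected running cost of `Φ`. -/
structure IsMarkovianSufficientStatistic (Φ : ℕ → ℝ≥0 → Ω → ℝ) : Prop where
  adapted : ∀ k, StronglyAdapted D.F (Φ k)
  markov : ∀ Q ∈ ({D.P₀, D.P} : Set (Measure Ω)), ∀ s t : ℝ≥0, s ≤ t →
    ∀ g : (ℕ → ℝ) → ℝ, Measurable g → (∃ C, ∀ x, |g x| ≤ C) →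
      Q[fun ω => g (fun k => Φ k t ω) | D.F s] =ᵐ[Q]
        Q[fun ω => g (fun k => Φ k t ω) |
          MeasurableSpace.comap (fun ω k => Φ k s ω) inferInstance]
  penalty_eq : ∀ c : ℝ, 0 < c → ∀ τ : Ω → ℝ≥0∞, IsStoppingTime D.F τ →
    (D.penalty c τ : EReal) = ((1 - D.prior : ℝ) : EReal) +
      ((c * (1 - D.prior) : ℝ) : EReal) *
        D.expectedCost τ (fun t ω => Real.exp (-D.lam * t) * (Φ 0 t ω - D.lam / c))

end DisorderData

end

/-! Under `P₀` the observations are independent of `(Λ, θ)`, so Bayes' rule gives an explicit path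
functional. Integrating the likelihood `lik` of a disorder at `u ≤ t` with rate `v` over the law of
`θ` gives `weight`, the unnormalised conditional density of `Λ` on `{θ ≤ t}`. On `{θ > t}` the
likelihood is 1, which contributes `surv t = (1 - π) e^{-λt}`. Hence the odds ratios are the moments
of `weight` divided by `surv t`; this is `stat`, evaluated at the observed jumps `history t`
(`IsModel.oddsRatio_eq`). On each `F t` the measures `P` and `P₀` have the same null sets, since the
density `surv t * (1 + stat 0)` is positive. Right-continuity then makes every admissible family
indistinguishable from `stat`, under both measures (`IsModel.ae_eq_stat`).

Jump equation. Between arrivals the normalised weight `w` solves, for each `v`, the linear equation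
`w' = λ - (v - μ - λ) w`. At an arrival with claim `y` it is multiplied by `(v/μ) r(y) = r(y) (1 +
(v - μ)/μ)`. Multiplying by `(v - μ)^k` and integrating against `γ` turns these rules into the drift
and the jumps; each involves the next moment, so the system does not close at any finite order.

Markov property. `weight` at `t` is determined by `weight` at `s` and the jumps in `(s, t]`, which
are independent of `F s` under `P₀` (`IsModel.weight_history`, `IsModel.indep_F_future`). It remains
to recover `weight` at `s` from its moments, although `γ` itself may be moment-indeterminate. Almost
surely there is no arrival at time `s`, hence none in some `(u, s]`. There `weight` at `s` is
`e^{-(v-μ)(s-u)}` times `weight` at `u`, plus a term that does not depend on the data. The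
exponential factor gives exponential moments near zero, so moments determine this density
(`ae_eq_of_moments`, `IsModel.weight_ae_eq_of_stat_eq`). Blackwell's theorem makes the resulting
factorisation measurable (`exists_measurable_factor`). The property passes to `P` because the
density of `P` on `F t` is a function of the statistic at time `t`.

Penalty. Before the disorder the two measures agree, so `P{τ < θ}` can be computed under `P₀`, where
`τ` and `θ` are independent. The delay is `∫_0^τ 1{θ ≤ t} dt`, and for each `t` the event `{t < τ}`
lies in `F t`, so the density on `F t` gives the integrand `surv t * stat 0`. Adding the two gives
the running cost. -/

noncomputable section

namespace DisorderData

/-! ### Recovering arrivals and claims from the path of `X`. -/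

section Observations

variable {Ω : Type*} [mΩ : MeasurableSpace Ω] {d : ℕ} (D : DisorderData Ω d)

theorem N_mono (ω : Ω) : Monotone fun t => D.N t ω := fun s t hst =>
  Set.ncard_le_ncard (fun k (hk : D.σ k ω ≤ s) => hk.trans hst) (D.finite_arrivals t ω)

variable {D} in
theorem N_eq_of_forall {t : ℝ≥0} {ω : Ω} {n : ℕ} (h : ∀ k, k < n ↔ D.σ k ω ≤ t) :
    D.N t ω = n := by
  refine eq_of_forall_lt_iff fun k => ?_
  rw [D.lt_N_iff, h]

variable {D} in
theorem N_eq_succ {t : ℝ≥0} {ω : Ω} {n : ℕ} (h₁ : D.σ n ω ≤ t) (h₂ : t < D.σ (n + 1) ω) :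
    D.N t ω = n + 1 := by
  refine N_eq_of_forall fun k => ⟨fun hk => ?_, fun hk => ?_⟩
  · exact ((D.σ_strictMono ω).monotone (Nat.lt_succ_iff.1 hk)).trans h₁
  · exact (D.σ_strictMono ω).lt_iff_lt.1 (hk.trans_lt h₂)

theorem N_zero (ω : Ω) : D.N 0 ω = 0 :=
  N_eq_of_forall fun k => by simpa using (D.σ_pos k ω).ne'

theorem measurable_F_X {s t : ℝ≥0} (h : s ≤ t) : Measurable[D.F t] (D.X s) := by
  have h1 : Measurable[D.F s] (D.X s) :=
    (Filtration.stronglyAdapted_natural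
      (fun t => (D.measurable_X t).stronglyMeasurable) s).measurable
  exact h1.mono (D.F.mono h) le_rfl

/-- The process `X` is piecewise constant, so a countable dense set of times detects every interval
of constancy. The time `t` is adjoined because an interval that starts at `t` has no other point
that is visible at time `t`. -/
theorem exists_sample {S : Set ℝ≥0} (hS : Dense S) {a b t : ℝ≥0} (hat : a ≤ t) (hab : a < b) :
    ∃ q ∈ insert t S, q ≤ t ∧ a ≤ q ∧ q < b := by
  rcases hat.eq_or_lt with rfl | hlt
  · exact ⟨a, by simp, le_rfl, le_rfl, hab⟩
  · obtain ⟨q, hq, h1, h2⟩ := hS.exists_between (lt_min hlt hab)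
    exact ⟨q, by simp [hq], (h2.trans_le (min_le_left _ _)).le, h1.le,
      h2.trans_le (min_le_right _ _)⟩

theorem X_eq_of_N_eq {s t : ℝ≥0} {ω : Ω} (h : D.N s ω = D.N t ω) : D.X s ω = D.X t ω := by
  simp [X, h]

theorem exists_sample_N_eq {S : Set ℝ≥0} (hS : Dense S) {t : ℝ≥0} {ω : Ω} {n : ℕ}
    (hn : n ≤ D.N t ω) : ∃ q ∈ insert t S, q ≤ t ∧ q < D.σ n ω ∧ D.N q ω = n := by
  cases n with
  | zero =>
    obtain ⟨q, hq, hqt, -, h2⟩ := exists_sample hS (zero_le : 0 ≤ t) (D.σ_pos 0 ω)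
    refine ⟨q, hq, hqt, h2, N_eq_of_forall fun k => ?_⟩
    simpa using h2.trans_le ((D.σ_strictMono ω).monotone (zero_le : 0 ≤ k))
  | succ n =>
    obtain ⟨q, hq, hqt, h1, h2⟩ := exists_sample hS ((D.lt_N_iff n t ω).1 hn)
      (D.σ_strictMono ω (Nat.lt_succ_self n))
    exact ⟨q, hq, hqt, h2, N_eq_succ h1 h2⟩

/-- Claims are nonzero, so every arrival changes `X`, and `X` changes only at arrivals. A change
seen after at least `n` arrivals is therefore one more arrival. This expresses `N` through countably
many values of `X` and permits an induction on `n`. -/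
theorem lt_N_iff_exists_sample {S : Set ℝ≥0} (hS : Dense S) (n : ℕ) (t : ℝ≥0) (ω : Ω) :
    n < D.N t ω ↔ ∃ q ∈ insert t S, ∃ q' ∈ insert t S,
      q ≤ t ∧ q' ≤ t ∧ q < q' ∧ n ≤ D.N q ω ∧ D.X q ω ≠ D.X q' ω := by
  constructor
  · intro h
    obtain ⟨q, hq, hqt, hqn, hN⟩ := D.exists_sample_N_eq hS h.le
    obtain ⟨q', hq', hqt', -, hN'⟩ := D.exists_sample_N_eq hS (Nat.succ_le_of_lt h)
    have hσ : D.σ n ω ≤ q' := (D.lt_N_iff n q' ω).1 (by omega)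
    refine ⟨q, hq, q', hq', hqt, hqt', hqn.trans_le hσ, hN.ge, ?_⟩
    simp only [X, hN, hN', Finset.sum_range_succ]
    intro h0
    have := add_left_cancel h0
    exact D.Y_ne_zero n ω (by simpa using this)
  · rintro ⟨q, -, q', -, -, hqt', hlt, hn, hX⟩
    have h1 : D.N q ω ≠ D.N q' ω := fun h => hX (D.X_eq_of_N_eq h)
    exact hn.trans_lt ((lt_of_le_of_ne (D.N_mono ω hlt.le) h1).trans_le (D.N_mono ω hqt'))

theorem measurableSet_F_le_N (n : ℕ) (t : ℝ≥0) : MeasurableSet[D.F t] {ω | n ≤ D.N t ω} := by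
  induction n generalizing t with
  | zero => simp
  | succ n ih =>
    obtain ⟨S, hSc, hS⟩ := TopologicalSpace.exists_countable_dense ℝ≥0
    have : {ω | n + 1 ≤ D.N t ω} = ⋃ q ∈ insert t S, ⋃ q' ∈ insert t S,
        ⋃ (_ : q ≤ t), ⋃ (_ : q' ≤ t), ⋃ (_ : q < q'),
          ({ω | n ≤ D.N q ω} ∩ {ω | D.X q ω = D.X q' ω}ᶜ) := by
      ext ω
      rw [mem_ofPred_eq, Nat.succ_le_iff, D.lt_N_iff_exists_sample hS]
      simp only [mem_iUnion, mem_inter_iff, mem_ofPred_eq, mem_compl_iff, exists_prop, ne_eq]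
    rw [this]
    refine MeasurableSet.biUnion (hSc.insert t) fun q _ =>
      MeasurableSet.biUnion (hSc.insert t) fun q' _ =>
      MeasurableSet.iUnion fun hq => MeasurableSet.iUnion fun hq' =>
      MeasurableSet.iUnion fun _ => ?_
    refine MeasurableSet.inter (D.F.mono hq _ (ih q)) (MeasurableSet.compl ?_)
    exact measurableSet_eq_fun (D.measurable_F_X hq) (D.measurable_F_X hq')

theorem measurable_F_N {s t : ℝ≥0} (h : s ≤ t) : Measurable[D.F t] (D.N s) := by
  refine (measurable_of_Ioi fun k => ?_ : Measurable[D.F s] (D.N s)).mono (D.F.mono h) le_rfl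
  exact D.measurableSet_F_le_N (k + 1) s

theorem measurable_F_σ_trunc (k : ℕ) (t : ℝ≥0) :
    Measurable[D.F t] fun ω => if k < D.N t ω then D.σ k ω else 0 := by
  refine measurable_of_Iic fun s => ?_
  -- The default value 0 satisfies every bound `≤ s`, so all paths without a `k`-th arrival by time
  -- `t` belong to the preimage.
  have : (fun ω => if k < D.N t ω then D.σ k ω else 0) ⁻¹' Iic s =
      {ω | k + 1 ≤ D.N (min s t) ω} ∪ {ω | k + 1 ≤ D.N t ω}ᶜ := by
    ext ω
    simp only [mem_preimage, mem_Iic, mem_union, mem_ofPred_eq, mem_compl_iff, Nat.succ_le_iff,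
      D.lt_N_iff, le_min_iff]
    split_ifs with h <;> simp [h]
  rw [this]
  exact (D.F.mono (min_le_right s t) _ (D.measurableSet_F_le_N _ _)).union
    (D.measurableSet_F_le_N _ _).compl

/-- At any sampled time `q ≤ t` with `N q = k`, the sum of the first `k` claims is `X q - x₀`; such
a time exists as soon as `k ≤ N t`. -/
theorem measurable_F_sum_trunc (k : ℕ) (t : ℝ≥0) :
    Measurable[D.F t] fun ω => if k ≤ D.N t ω then ∑ j ∈ Finset.range k, D.Y j ω else 0 := by
  obtain ⟨S, hSc, hS⟩ := TopologicalSpace.exists_countable_dense ℝ≥0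
  intro A hA
  have : (fun ω => if k ≤ D.N t ω then ∑ j ∈ Finset.range k, D.Y j ω else 0) ⁻¹' A =
      (⋃ q ∈ insert t S, ⋃ (_ : q ≤ t),
        (D.N q ⁻¹' {k} ∩ D.X q ⁻¹' ((fun x => x - D.x₀) ⁻¹' A))) ∪
      ({ω | k ≤ D.N t ω}ᶜ ∩ {_ω | (0 : Mark d) ∈ A}) := by
    ext ω
    simp only [mem_preimage, mem_union, mem_iUnion, mem_inter_iff, mem_singleton_iff,
      mem_compl_iff, mem_ofPred_eq, exists_prop]
    constructor
    · intro h
      by_cases hk : k ≤ D.N t ω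
      · rw [if_pos hk] at h
        obtain ⟨q, hq, hqt, -, hN⟩ := D.exists_sample_N_eq hS hk
        exact Or.inl ⟨q, hq, hqt, hN, by simpa [X, hN] using h⟩
      · rw [if_neg hk] at h
        exact Or.inr ⟨hk, h⟩
    · rintro (⟨q, -, hqt, hN, h⟩ | ⟨hk, h⟩)
      · rw [if_pos (hN ▸ D.N_mono ω hqt)]
        simpa [X, hN] using h
      · rwa [if_neg hk]
  rw [this]
  refine MeasurableSet.union ?_ ?_
  · refine MeasurableSet.biUnion (hSc.insert t) fun q _ => MeasurableSet.iUnion fun hq => ?_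
    exact MeasurableSet.inter (D.measurable_F_N hq (measurableSet_singleton k))
      (D.measurable_F_X hq ((measurable_id.sub_const _) hA))
  · exact (D.measurableSet_F_le_N k t).compl.inter (MeasurableSet.const _)

theorem measurable_F_Y_trunc (k : ℕ) (t : ℝ≥0) :
    Measurable[D.F t] fun ω => if k < D.N t ω then D.Y k ω else 0 := by
  have h := (D.measurable_F_sum_trunc (k + 1) t).sub (D.measurable_F_sum_trunc k t)
  have h2 : Measurable[D.F t] fun ω => if k < D.N t ω then
      (if k + 1 ≤ D.N t ω then ∑ j ∈ Finset.range (k + 1), D.Y j ω else 0) -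
        (if k ≤ D.N t ω then ∑ j ∈ Finset.range k, D.Y j ω else 0) else 0 :=
    Measurable.ite (D.measurableSet_F_le_N (k + 1) t) h measurable_const
  convert h2 using 2 with ω
  split_ifs with h1 h2 h3 <;> first | omega | simp [Finset.sum_range_succ]

theorem measurable_r : Measurable D.r := (Measure.measurable_rnDeriv _ _).ennreal_toReal

theorem measurable_comap_N (t : ℝ≥0) :
    Measurable[MeasurableSpace.comap (fun ω k => D.σ k ω) inferInstance] (D.N t) := by
  refine measurable_of_Ioi fun k => ?_
  have : D.N t ⁻¹' Ioi k = (fun ω k => D.σ k ω) ⁻¹' {f | f k ≤ t} := by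
    ext ω
    exact D.lt_N_iff k t ω
  rw [this]
  exact ⟨_, measurableSet_le (measurable_pi_apply k) measurable_const, rfl⟩

theorem measurable_sum_range {α E : Type*} {_ : MeasurableSpace α} [AddCommMonoid E]
    [MeasurableSpace E] [MeasurableAdd₂ E] {N : α → ℕ} {Y : ℕ → α → E} (hN : Measurable N)
    (hY : ∀ k, Measurable (Y k)) : Measurable fun a => ∑ k ∈ Finset.range (N a), Y k a := by
  have h : Measurable fun q : ℕ × α => ∑ k ∈ Finset.range q.1, Y k q.2 :=
    measurable_from_prod_countable_right fun n =>
      Finset.measurable_sum (Finset.range n) fun k _ => hY k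
  exact h.comp (hN.prodMk measurable_id)

theorem measurable_comap_Y (k : ℕ) :
    Measurable[MeasurableSpace.comap (fun ω k => D.Y k ω) inferInstance] (D.Y k) :=
  (measurable_pi_apply k).comp (comap_measurable fun ω k => D.Y k ω)

theorem F_le_comap (t : ℝ≥0) : D.F t ≤
    MeasurableSpace.comap (fun ω k => D.σ k ω) inferInstance ⊔
      MeasurableSpace.comap (fun ω k => D.Y k ω) inferInstance := by
  change (⨆ j ≤ t, MeasurableSpace.comap (D.X j) _) ≤ _
  refine iSup₂_le fun s _ => ?_
  rw [← measurable_iff_comap_le]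
  have hN := (D.measurable_comap_N s).mono (le_sup_left (a := MeasurableSpace.comap
    (fun ω k => D.σ k ω) inferInstance) (b := MeasurableSpace.comap (fun ω k => D.Y k ω)
    inferInstance)) le_rfl
  have hY := fun k => (D.measurable_comap_Y k).mono (le_sup_right (a := MeasurableSpace.comap
    (fun ω k => D.σ k ω) inferInstance) (b := MeasurableSpace.comap (fun ω k => D.Y k ω)
    inferInstance)) le_rfl
  exact Measurable.const_add (measurable_sum_range hN hY) D.x₀

end Observations

/-! ### Likelihoods, weights and the explicit odds-ratio statistics. -/

section Statistics

variable {Ω : Type*} [mΩ : MeasurableSpace Ω] {d : ℕ} (D : DisorderData Ω d)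

/-- Finitely many arrival times and likelihood ratios of claims: the number of arrivals, and
sequences of times and ratios, of which only the first terms are relevant. -/
abbrev JumpData : Type := ℕ × (ℕ → ℝ≥0) × (ℕ → ℝ)

/-- The law of the disorder time under the reference measure. -/
def θlaw : Measure ℝ≥0 := D.P₀.map D.θ

/-- The likelihood ratio at time `t` of a disorder at time `u` with post-disorder rate `v`, given
the jump data. -/
def lik (e : JumpData) (u t : ℝ≥0) (v : ℝ) : ℝ :=
  Real.exp (-(v - D.mu) * ((t : ℝ) - u)) *
    ∏ k ∈ Finset.range e.1, if u < e.2.1 k then v / D.mu * e.2.2 k else 1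

/-- The unnormalised density with respect to `γ` of the conditional law of the post-disorder rate
on the event that the disorder happened by time `t`. -/
def weight (e : JumpData) (t : ℝ≥0) (v : ℝ) : ℝ := ∫ u in Iic t, D.lik e u t v ∂D.θlaw

/-- The odds-ratio statistics as functions of the jump data. -/
def stat (e : JumpData) (t : ℝ≥0) (k : ℕ) : ℝ :=
  Real.exp (D.lam * t) / (1 - D.prior) * ∫ v, (v - D.mu) ^ k * D.weight e t v ∂D.γ

/-- The observed jump data at time `t`. -/
def history (t : ℝ≥0) (ω : Ω) : JumpData :=
  (D.N t ω, fun k => if k < D.N t ω then D.σ k ω else 0,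
    fun k => if k < D.N t ω then D.r (D.Y k ω) else 0)

/-- The jump data of the observations between `s` and `t`. -/
def future (s t : ℝ≥0) (ω : Ω) : JumpData :=
  (D.N t ω - D.N s ω, fun k => D.σ (D.N s ω + k) ω, fun k => D.r (D.Y (D.N s ω + k) ω))

theorem r_nonneg (y : Mark d) : 0 ≤ D.r y := ENNReal.toReal_nonneg

theorem history_σ {t : ℝ≥0} {ω : Ω} {k : ℕ} (hk : k < D.N t ω) :
    (D.history t ω).2.1 k = D.σ k ω := if_pos hk

theorem history_r {t : ℝ≥0} {ω : Ω} {k : ℕ} (hk : k < D.N t ω) :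
    (D.history t ω).2.2 k = D.r (D.Y k ω) := if_pos hk

theorem measurable_jumpData {α : Type*} {_ : MeasurableSpace α} {n : α → ℕ} {τ : ℕ → α → ℝ≥0}
    {a : ℕ → α → ℝ} (hn : Measurable n) (hτ : ∀ k, Measurable (τ k)) (ha : ∀ k, Measurable (a k)) :
    Measurable fun x => ((n x, fun k => τ k x, fun k => a k x) : JumpData) :=
  hn.prodMk ((measurable_pi_iff.2 hτ).prodMk (measurable_pi_iff.2 ha))

theorem measurable_ite_comp {α E : Type*} {_ : MeasurableSpace α} [MeasurableSpace E] [Zero E]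
    {p : α → Prop} [DecidablePred p] {f : E → ℝ} {y : α → E} (hp : MeasurableSet {a | p a})
    (hf : Measurable f) (hy : Measurable fun a => if p a then y a else 0) :
    Measurable fun a => if p a then f (y a) else 0 := by
  have h : Measurable fun a => if p a then f (if p a then y a else 0) else 0 :=
    Measurable.ite hp (hf.comp hy) measurable_const
  convert! h using 2 with a
  split_ifs <;> rfl

theorem measurable_F_history (t : ℝ≥0) : Measurable[D.F t] (D.history t) :=
  measurable_jumpData (D.measurable_F_N le_rfl) (fun k => D.measurable_F_σ_trunc k t) fun k =>
    measurable_ite_comp (D.measurableSet_F_le_N (k + 1) t) D.measurable_r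
      (D.measurable_F_Y_trunc k t)

theorem measurable_history (t : ℝ≥0) : Measurable (D.history t) :=
  (D.measurable_F_history t).mono (D.F.le t) le_rfl

theorem measurable_lik : Measurable fun q : JumpData × ℝ≥0 × ℝ≥0 × ℝ =>
    D.lik q.1 q.2.1 q.2.2.1 q.2.2.2 := by
  have h : Measurable fun q : ℕ × ((ℕ → ℝ≥0) × (ℕ → ℝ)) × ℝ≥0 × ℝ≥0 × ℝ =>
      D.lik (q.1, q.2.1) q.2.2.1 q.2.2.2.1 q.2.2.2.2 := by
    refine measurable_from_prod_countable_right fun n => ?_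
    unfold lik
    refine Measurable.mul (by fun_prop) ?_
    refine Finset.measurable_fun_prod (Finset.range n) fun k _ => ?_
    refine Measurable.ite (measurableSet_lt ?_ ?_) (by fun_prop) measurable_const <;> fun_prop
  exact h.comp (f := fun q : JumpData × ℝ≥0 × ℝ≥0 × ℝ => (q.1.1, q.1.2, q.2)) (by fun_prop)

theorem Measurable.lik {α : Type*} [MeasurableSpace α] {e : α → JumpData} {u t : α → ℝ≥0}
    {v : α → ℝ} (he : Measurable e) (hu : Measurable u) (ht : Measurable t) (hv : Measurable v) :
    Measurable fun a => D.lik (e a) (u a) (t a) (v a) :=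
  D.measurable_lik.comp (he.prodMk (hu.prodMk (ht.prodMk hv)))

section Model

variable {D}

theorem IsModel.one_sub_prior_pos (hD : D.IsModel) : 0 < 1 - D.prior := by
  linarith [hD.prior_lt_one]

theorem IsModel.isProbabilityMeasure_θlaw (hD : D.IsModel) : IsProbabilityMeasure D.θlaw :=
  have := hD.prob_P₀
  Measure.isProbabilityMeasure_map D.measurable_θ.aemeasurable

theorem IsModel.ae_γ_pos (hD : D.IsModel) : ∀ᵐ v ∂D.γ, 0 < v := by
  rw [ae_iff]
  simpa [Iic] using hD.γ_pos

theorem IsModel.integrable_one_add_abs_pow (hD : D.IsModel) (n : ℕ) :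
    Integrable (fun v => (1 + |v - D.mu|) ^ n) D.γ := by
  simp_rw [add_comm (1 : ℝ), add_pow]
  refine integrable_finsetSum _ fun j _ => ?_
  simp only [one_pow, mul_one, ← abs_pow]
  exact (hD.γ_moments j).abs.mul_const _

theorem measurable_weight [SFinite D.θlaw] :
    Measurable fun q : JumpData × ℝ≥0 × ℝ => D.weight q.1 q.2.1 q.2.2 := by
  have h : Measurable fun q : (JumpData × ℝ≥0 × ℝ) × ℝ≥0 =>
      if q.2 ≤ q.1.2.1 then D.lik q.1.1 q.2 q.1.2.1 q.1.2.2 else 0 :=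
    Measurable.ite (measurableSet_le (by fun_prop) (by fun_prop))
      (Measurable.lik D (by fun_prop) (by fun_prop) (by fun_prop) (by fun_prop)) measurable_const
  convert! (h.stronglyMeasurable.integral_prod_right' (ν := D.θlaw)).measurable using 2 with q
  rw [weight, ← integral_indicator measurableSet_Iic]
  rfl

theorem measurable_stat [SFinite D.θlaw] [SFinite D.γ] :
    Measurable fun q : JumpData × ℝ≥0 => D.stat q.1 q.2 := by
  refine measurable_pi_lambda _ fun k => Measurable.mul (by fun_prop) ?_
  have h : Measurable fun q : (JumpData × ℝ≥0) × ℝ =>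
      (q.2 - D.mu) ^ k * D.weight q.1.1 q.1.2 q.2 :=
    Measurable.mul (by fun_prop) (measurable_weight.comp
      (f := fun q : (JumpData × ℝ≥0) × ℝ => (q.1.1, q.1.2, q.2)) (by fun_prop))
  exact (h.stronglyMeasurable.integral_prod_right' (ν := D.γ)).measurable

/-- The part of the bound on `lik` that depends only on the claims. -/
def markBound (D : DisorderData Ω d) (e : JumpData) : ℝ :=
  ∏ k ∈ Finset.range e.1, (1 + (1 + 1 / D.mu) * |e.2.2 k|)

theorem IsModel.markBound_nonneg (hD : D.IsModel) (e : JumpData) : 0 ≤ D.markBound e :=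
  have := hD.mu_pos
  Finset.prod_nonneg fun k _ => by positivity

/-- The claims and the rate separate: since `|v| ≤ |v - μ| + μ`, each factor of the product is at
most `(1 + (1 + 1/μ) |a_k|) (1 + |v - μ|)`. What remains in `v` is an exponential times a polynomial
in `|v - μ|`. -/
theorem IsModel.abs_lik_le (hD : D.IsModel) (e : JumpData) (u t : ℝ≥0) (v : ℝ) :
    |D.lik e u t v| ≤ Real.exp (-(v - D.mu) * ((t : ℝ) - u)) *
      (D.markBound e * (1 + |v - D.mu|) ^ e.1) := by
  have hmu := hD.mu_pos
  rw [lik, abs_mul, Real.abs_exp, markBound]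
  gcongr
  have hc : (1 + |v - D.mu|) ^ e.1 = ∏ _k ∈ Finset.range e.1, (1 + |v - D.mu|) := by simp
  rw [Finset.abs_prod, hc, ← Finset.prod_mul_distrib]
  · refine Finset.prod_le_prod (fun _ _ => abs_nonneg _) fun k _ => ?_
    have h1 : |v / D.mu| ≤ (1 + 1 / D.mu) * (1 + |v - D.mu|) := by
      rw [abs_div, abs_of_pos hmu, div_le_iff₀ hmu]
      have : |v| ≤ |v - D.mu| + D.mu := by
        calc |v| = |(v - D.mu) + D.mu| := by ring_nf
          _ ≤ _ := (abs_add_le _ _).trans (by rw [abs_of_pos hmu])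
      have h2 : (1 + 1 / D.mu) * (1 + |v - D.mu|) * D.mu =
          (D.mu + 1) * (1 + |v - D.mu|) := by field_simp
      rw [h2]
      nlinarith [abs_nonneg (v - D.mu)]
    split_ifs
    · rw [abs_mul]
      nlinarith [mul_le_mul_of_nonneg_right h1 (abs_nonneg (e.2.2 k)), abs_nonneg (v - D.mu)]
    · rw [abs_one]
      have : 0 ≤ (1 + 1 / D.mu) * |e.2.2 k| := by positivity
      nlinarith [abs_nonneg (v - D.mu)]

/-- For `v > 0` the exponent `-(v - μ)(t - u)` is at most `μ s`, uniformly in `v`. The likelihood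
then grows only polynomially in `v`, and the moments of `γ` dominate it. -/
theorem IsModel.abs_lik_le_of_pos (hD : D.IsModel) (e : JumpData) {u s t : ℝ≥0} (hut : u ≤ t)
    (hts : t ≤ s) {v : ℝ} (hv : 0 < v) :
    |D.lik e u t v| ≤ Real.exp (D.mu * s) * D.markBound e * (1 + |v - D.mu|) ^ e.1 := by
  rw [mul_assoc]
  refine (hD.abs_lik_le e u t v).trans ?_
  have h0 := hD.markBound_nonneg e
  refine mul_le_mul_of_nonneg_right (Real.exp_le_exp.2 ?_) (by positivity)
  have h1 : (u : ℝ) ≤ t := hut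
  have h2 : (t : ℝ) ≤ s := hts
  have h3 : (0 : ℝ) ≤ u := u.2
  nlinarith [hD.mu_pos]

theorem IsModel.integrableOn_lik (hD : D.IsModel) (e : JumpData) (t : ℝ≥0) (v : ℝ) :
    IntegrableOn (fun u => D.lik e u t v) (Iic t) D.θlaw := by
  have := hD.isProbabilityMeasure_θlaw
  refine Measure.integrableOn_of_bounded (M := Real.exp (|v - D.mu| * t) *
      (D.markBound e * (1 + |v - D.mu|) ^ e.1)) (measure_ne_top _ _) ?_ ?_
  · exact (Measurable.lik D (by fun_prop) (by fun_prop) (by fun_prop)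
      (by fun_prop)).aestronglyMeasurable
  · filter_upwards [ae_restrict_mem measurableSet_Iic] with u hu
    have h0 := hD.markBound_nonneg e
    refine (hD.abs_lik_le e u t v).trans ?_
    refine mul_le_mul_of_nonneg_right (Real.exp_le_exp.2 ?_) (by positivity)
    have h1 : (u : ℝ) ≤ t := hu
    have h3 : (0 : ℝ) ≤ u := u.2
    nlinarith [neg_abs_le (v - D.mu), le_abs_self (v - D.mu), abs_nonneg (v - D.mu)]

theorem IsModel.abs_weight_le (hD : D.IsModel) (e : JumpData) {t s : ℝ≥0} (hts : t ≤ s) {v : ℝ}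
    (hv : 0 < v) :
    |D.weight e t v| ≤ Real.exp (D.mu * s) * D.markBound e * (1 + |v - D.mu|) ^ e.1 := by
  have := hD.isProbabilityMeasure_θlaw
  have := hD.markBound_nonneg e
  refine (norm_setIntegral_le_of_norm_le_const (f := fun u => D.lik e u t v) (measure_lt_top _ _)
    (C := Real.exp (D.mu * s) * D.markBound e * (1 + |v - D.mu|) ^ e.1)
    fun u hu => hD.abs_lik_le_of_pos e (mem_Iic.1 hu) hts hv).trans ?_
  exact mul_le_of_le_one_right (by positivity) measureReal_le_one

theorem IsModel.integrable_of_abs_le (hD : D.IsModel) {f : ℝ → ℝ} (hf : Measurable f) {C : ℝ}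
    {n : ℕ} (h : ∀ v, 0 < v → |f v| ≤ C * (1 + |v - D.mu|) ^ n) (k : ℕ) :
    Integrable (fun v => (v - D.mu) ^ k * f v) D.γ := by
  refine ((hD.integrable_one_add_abs_pow (k + n)).const_mul C).mono'
    (by fun_prop) ?_
  filter_upwards [hD.ae_γ_pos] with v hv
  rw [Real.norm_eq_abs, abs_mul, abs_pow]
  calc |v - D.mu| ^ k * |f v| ≤ (1 + |v - D.mu|) ^ k * (C * (1 + |v - D.mu|) ^ n) := by
        gcongr
        · linarith
        · exact h v hv
    _ = _ := by ring

theorem IsModel.measurable_weight_right (hD : D.IsModel) (e : JumpData) (t : ℝ≥0) :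
    Measurable (D.weight e t) :=
  have := hD.isProbabilityMeasure_θlaw
  measurable_weight.comp (f := fun v => (e, t, v)) (by fun_prop)

theorem IsModel.integrable_weight (hD : D.IsModel) (e : JumpData) (t : ℝ≥0) (k : ℕ) :
    Integrable (fun v => (v - D.mu) ^ k * D.weight e t v) D.γ :=
  hD.integrable_of_abs_le (hD.measurable_weight_right e t)
    (fun _ hv => hD.abs_weight_le e le_rfl hv) k

theorem IsModel.lik_nonneg (hD : D.IsModel) {e : JumpData} (he : ∀ k < e.1, 0 ≤ e.2.2 k)
    (u t : ℝ≥0) {v : ℝ} (hv : 0 < v) : 0 ≤ D.lik e u t v := by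
  refine mul_nonneg (Real.exp_pos _).le (Finset.prod_nonneg fun k hk => ?_)
  split_ifs
  · exact mul_nonneg (div_nonneg hv.le hD.mu_pos.le) (he k (Finset.mem_range.1 hk))
  · exact zero_le_one

theorem history_nonneg (t : ℝ≥0) (ω : Ω) (k : ℕ) : 0 ≤ (D.history t ω).2.2 k := by
  simp only [history]
  split_ifs
  exacts [D.r_nonneg _, le_rfl]

theorem IsModel.stat_zero_nonneg (hD : D.IsModel) {e : JumpData} (he : ∀ k < e.1, 0 ≤ e.2.2 k)
    (t : ℝ≥0) : 0 ≤ D.stat e t 0 := by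
  refine mul_nonneg (div_nonneg (Real.exp_pos _).le hD.one_sub_prior_pos.le) ?_
  refine integral_nonneg_of_ae ?_
  filter_upwards [hD.ae_γ_pos] with v hv
  simpa [weight] using integral_nonneg fun u => hD.lik_nonneg he u t hv

end Model

theorem lik_history {u t : ℝ≥0} (hut : u ≤ t) (ω : Ω) :
    D.lik (D.history t ω) u t (D.Λ ω) = D.LQuot u t ω := by
  rw [lik, LQuot]
  congr 1
  have hN : D.N u ω ≤ D.N t ω := D.N_mono ω hut
  rw [show (D.history t ω).1 = D.N t ω from rfl, ← Finset.prod_range_mul_prod_Ico _ hN,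
    Finset.prod_eq_one, one_mul]
  · refine Finset.prod_congr rfl fun k hk => ?_
    rw [Finset.mem_Ico] at hk
    rw [D.history_σ hk.2, D.history_r hk.2,
      if_pos (not_le.1 fun h => hk.1.not_gt ((D.lt_N_iff k u ω).2 h))]
  · intro k hk
    rw [Finset.mem_range] at hk
    rw [D.history_σ (hk.trans_le hN), if_neg (not_lt.2 ((D.lt_N_iff k u ω).1 hk))]

/-- Cocycle property: once the disorder has happened before `s`, every jump after `s` contributes
its full factor, whatever `u` was. -/
theorem lik_history_eq_mul {u s t : ℝ≥0} (hus : u ≤ s) (hst : s ≤ t) (ω : Ω) (v : ℝ) :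
    D.lik (D.history t ω) u t v = D.lik (D.future s t ω) s t v * D.lik (D.history s ω) u s v := by
  have hN : D.N s ω ≤ D.N t ω := D.N_mono ω hst
  obtain ⟨n, hn⟩ := Nat.exists_eq_add_of_le hN
  have h1 : (D.future s t ω).1 = n := by simp [future, hn]
  rw [lik, lik, lik, h1, show (D.history t ω).1 = _ from hn, show (D.history s ω).1 = D.N s ω from
    rfl, Finset.prod_range_add, mul_mul_mul_comm, ← Real.exp_add,
    mul_comm (∏ k ∈ Finset.range n, _)]
  congr 1
  · ring_nf
  congr 1
  · refine Finset.prod_congr rfl fun k hk => ?_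
    rw [Finset.mem_range] at hk
    rw [D.history_σ hk, D.history_r hk, D.history_σ (hk.trans_le hN), D.history_r (hk.trans_le hN)]
  · refine Finset.prod_congr rfl fun k hk => ?_
    rw [Finset.mem_range] at hk
    have h2 : s < D.σ (D.N s ω + k) ω := not_le.1 fun h => by
      have := (D.lt_N_iff _ s ω).2 h
      omega
    have h3 : D.N s ω + k < D.N t ω := by omega
    rw [D.history_σ h3, D.history_r h3, if_pos (hus.trans_lt h2)]
    exact (if_pos h2).symm

theorem lik_history_eq_future {u s t : ℝ≥0} (hsu : s < u) (hut : u ≤ t) (ω : Ω) (v : ℝ) :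
    D.lik (D.history t ω) u t v = D.lik (D.future s t ω) u t v := by
  have hN : D.N s ω ≤ D.N t ω := D.N_mono ω (hsu.le.trans hut)
  obtain ⟨n, hn⟩ := Nat.exists_eq_add_of_le hN
  have h1 : (D.future s t ω).1 = n := by simp [future, hn]
  rw [lik, lik, h1, show (D.history t ω).1 = _ from hn, Finset.prod_range_add]
  congr 1
  rw [Finset.prod_eq_one, one_mul]
  · refine Finset.prod_congr rfl fun k hk => ?_
    rw [Finset.mem_range] at hk
    have h3 : D.N s ω + k < D.N t ω := by omega
    rw [D.history_σ h3, D.history_r h3]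
    rfl
  · intro k hk
    rw [Finset.mem_range] at hk
    rw [D.history_σ (hk.trans_le hN),
      if_neg (not_lt.2 (((D.lt_N_iff k s ω).1 hk).trans hsu.le))]

variable {D} in
-- The disorder time is split at `s`. A disorder by time `s` multiplies the old weight by the
-- likelihood of the later jumps; a disorder in `(s, t]` leaves factors 1 at the earlier jumps, so
-- its contribution involves the later jumps only.
theorem IsModel.weight_history (hD : D.IsModel) {s t : ℝ≥0} (hst : s ≤ t) (ω : Ω) (v : ℝ) :
    D.weight (D.history t ω) t v =
      D.lik (D.future s t ω) s t v * D.weight (D.history s ω) s v +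
        ∫ u in Ioc s t, D.lik (D.future s t ω) u t v ∂D.θlaw := by
  have hi := hD.integrableOn_lik (D.history t ω) t v
  rw [weight, ← Iic_union_Ioc_eq_Iic hst, setIntegral_union (Iic_disjoint_Ioc le_rfl)
    measurableSet_Ioc (hi.mono_set (Iic_subset_Iic.2 hst)) (hi.mono_set Ioc_subset_Iic_self),
    weight, ← integral_const_mul]
  congr 1
  · exact setIntegral_congr_fun measurableSet_Iic fun u hu => D.lik_history_eq_mul hu hst ω v
  · exact setIntegral_congr_fun measurableSet_Ioc fun u hu =>
      D.lik_history_eq_future hu.1 hu.2 ω v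

end Statistics

/-! ### Changes of measure on a sub-σ-algebra, and conditioning with an independent element. -/

section Density

variable {Ω : Type*} [mΩ : MeasurableSpace Ω] {d : ℕ} (D : DisorderData Ω d)

section General

variable {α β E : Type*} {m m0 : MeasurableSpace α}

/-- The measures `μ` and `z ν` are compared only on `m`, where their trims coincide;
`m`-measurability of `f` is what allows both integrals to be taken against the trims. -/
theorem integral_eq_of_density (hm : m ≤ m0) {μ ν : Measure α} {z : α → ℝ} (hz : Measurable z)
    (hz0 : 0 ≤ᵐ[ν] z)
    (h : ∀ A, MeasurableSet[m] A → μ A = ∫⁻ a in A, ENNReal.ofReal (z a) ∂ν) {f : α → ℝ}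
    (hf : StronglyMeasurable[m] f) :
    (Integrable f μ ↔ Integrable (fun a => z a * f a) ν) ∧ ∫ a, f a ∂μ = ∫ a, z a * f a ∂ν := by
  set η := ν.withDensity fun a => ENNReal.ofReal (z a) with hη
  have htrim : μ.trim hm = η.trim hm := by
    refine @Measure.ext _ m _ _ fun A hA => ?_
    rw [trim_measurableSet_eq hm hA, trim_measurableSet_eq hm hA, h A hA, hη,
      withDensity_apply _ (hm A hA)]
  have hz1 : Measurable fun a => ENNReal.ofReal (z a) := hz.ennreal_ofReal
  have hlt : ∀ᵐ a ∂ν, ENNReal.ofReal (z a) < ∞ := ae_of_all _ fun _ => ENNReal.ofReal_lt_top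
  have heq : (fun a => (ENNReal.ofReal (z a)).toReal • f a) =ᵐ[ν] fun a => z a * f a := by
    filter_upwards [hz0] with a ha
    rw [ENNReal.toReal_ofReal ha, smul_eq_mul]
  constructor
  · rw [← integrable_congr heq, ← integrable_withDensity_iff_integrable_smul' hz1 hlt]
    exact ⟨fun hi => integrable_of_integrable_trim hm (htrim ▸ hi.trim hm hf),
      fun hi => integrable_of_integrable_trim hm (htrim ▸ hi.trim hm hf)⟩
  · rw [integral_trim hm hf, htrim, ← integral_trim hm hf, hη,
      integral_withDensity_eq_integral_toReal_smul hz1 hlt, integral_congr_ae heq]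

/-- Conditional expectation of a function of a known and an independent random element. -/
theorem condExp_comp_of_indep [MeasurableSpace β] [MeasurableSpace E] (hm : m ≤ m0)
    {μ : Measure α} [IsProbabilityMeasure μ] {e : α → E} (he : Measurable[m] e) {X : α → β}
    (hX : Measurable X) (hind : Indep m (MeasurableSpace.comap X inferInstance) μ)
    {f : E → β → ℝ} (hf : Measurable (Function.uncurry f))
    (hint : Integrable (fun a => f (e a) (X a)) μ) :
    μ[fun a => f (e a) (X a) | m] =ᵐ[μ] fun a => ∫ x, f (e a) x ∂(μ.map X) := by
  have := Measure.isProbabilityMeasure_map hX.aemeasurable (μ := μ)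
  have hgm : StronglyMeasurable fun y => ∫ x, f y x ∂(μ.map X) :=
    hf.stronglyMeasurable.integral_prod_right
  have key : ∀ A, MeasurableSet[m] A →
      Integrable (A.indicator fun a => ∫ x, f (e a) x ∂(μ.map X)) μ ∧
      ∫ a in A, (∫ x, f (e a) x ∂(μ.map X)) ∂μ = ∫ a in A, f (e a) (X a) ∂μ := by
    intro A hA
    -- The indicator of the test event is adjoined to the known element. The pair is still
    -- `m`-measurable, hence independent of `X`, and the identity on `A` becomes Fubini for a
    -- product law.
    set b : α → ℝ := A.indicator fun _ => 1 with hb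
    have hbm : Measurable[m] b := measurable_const.indicator hA
    have heb : Measurable[m] fun a => (e a, b a) := he.prodMk hbm
    have heb0 : Measurable[m0] fun a => (e a, b a) := heb.mono hm le_rfl
    have hif : IndepFun (fun a => (e a, b a)) X μ := by
      rw [IndepFun_iff_Indep]
      exact indep_of_indep_of_le_left hind heb.comap_le
    have hmap := hif.map_prod_eq_prod_map_map heb0.aemeasurable hX.aemeasurable
    set g : (E × ℝ) × β → ℝ := fun q => q.1.2 * f q.1.1 q.2 with hg
    have hgm' : Measurable g := Measurable.mul (by fun_prop)
      (hf.comp (f := fun q : (E × ℝ) × β => (q.1.1, q.2)) (by fun_prop))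
    have hcomp : (fun a => g ((e a, b a), X a)) = A.indicator fun a => f (e a) (X a) := by
      ext a
      by_cases ha : a ∈ A <;> simp [hg, hb, ha]
    have hgi : Integrable g (μ.map fun a => ((e a, b a), X a)) := by
      rw [integrable_map_measure hgm'.aestronglyMeasurable (heb0.prodMk hX).aemeasurable]
      change Integrable (fun a => g ((e a, b a), X a)) μ
      rw [hcomp]
      exact hint.indicator (hm A hA)
    have hgi' := hgi
    rw [hmap] at hgi'
    have hout := hgi'.integral_prod_left
    have hind2 : (A.indicator fun a => ∫ x, f (e a) x ∂(μ.map X)) =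
        (fun y : E × ℝ => ∫ x, g (y, x) ∂(μ.map X)) ∘ fun a => (e a, b a) := by
      ext a
      by_cases ha : a ∈ A <;> simp [hg, hb, ha]
    constructor
    · rw [hind2]
      exact (integrable_map_measure hout.aestronglyMeasurable heb0.aemeasurable).1 hout
    · rw [← integral_indicator (hm A hA), ← integral_indicator (hm A hA), ← hcomp, hind2,
        ← integral_map (heb0.prodMk hX).aemeasurable hgm'.aestronglyMeasurable, hmap,
        integral_prod _ hgi', integral_map heb0.aemeasurable hout.aestronglyMeasurable]
      rfl
  symm
  refine ae_eq_condExp_of_forall_setIntegral_eq hm hint (fun A hA _ => ?_)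
    (fun A hA _ => (key A hA).2) ?_
  · exact (integrable_indicator_iff (hm A hA)).1 (key A hA).1
  · exact (hgm.comp_measurable he).aestronglyMeasurable

end General

end Density

/-! ### Bayes' formula and the density of `P` on the observations. -/

section PhysicalMeasure

variable {Ω : Type*} [mΩ : MeasurableSpace Ω] {d : ℕ} (D : DisorderData Ω d)

/-- The prior probability that the disorder happens after time `t`. -/
def surv (t : ℝ≥0) : ℝ := (1 - D.prior) * Real.exp (-D.lam * t)

/-- The density of `P` with respect to `P₀` on the observations up to time `t`. -/
def obsDensity (t : ℝ≥0) (ω : Ω) : ℝ := D.surv t * (1 + D.stat (D.history t ω) t 0)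

variable {D}

theorem IsModel.surv_pos (hD : D.IsModel) (t : ℝ≥0) : 0 < D.surv t :=
  mul_pos hD.one_sub_prior_pos (Real.exp_pos _)

theorem IsModel.measure_lt_θ (hD : D.IsModel) (t : ℝ≥0) :
    D.P₀ {ω | t < D.θ ω} = ENNReal.ofReal (D.surv t) := by
  have := hD.prob_P₀
  have hms : ∀ s : ℝ≥0, MeasurableSet {ω | s < D.θ ω} := fun s =>
    measurableSet_lt measurable_const D.measurable_θ
  have h0 : D.P₀ {ω | 0 < D.θ ω} = ENNReal.ofReal (1 - D.prior) := by
    have h1 : {ω | 0 < D.θ ω} = {ω | D.θ ω = 0}ᶜ := by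
      ext ω
      simp [pos_iff_ne_zero]
    have h2 : MeasurableSet {ω | D.θ ω = 0} := D.measurable_θ (measurableSet_singleton 0)
    rw [h1, prob_compl_eq_one_sub h2, hD.θ_zero,
      ENNReal.ofReal_sub _ hD.prior_nonneg, ENNReal.ofReal_one]
  have h2 := hD.θ_pos t
  have h3 : {ω | 0 < D.θ ω} ∩ {ω | t < D.θ ω} = {ω | t < D.θ ω} :=
    inter_eq_right.2 fun ω (h : t < D.θ ω) => (zero_le.trans_lt h : 0 < D.θ ω)
  have hne : ENNReal.ofReal (1 - D.prior) ≠ 0 := by simp [hD.prior_lt_one]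
  rw [cond_apply (hms 0), h3, h0] at h2
  rw [surv, ENNReal.ofReal_mul hD.one_sub_prior_pos.le, ← h2, ← mul_assoc,
    ENNReal.mul_inv_cancel hne ENNReal.ofReal_ne_top, one_mul]

theorem IsModel.exp_div_mul_surv (hD : D.IsModel) (t : ℝ≥0) :
    D.surv t * (Real.exp (D.lam * t) / (1 - D.prior)) = 1 := by
  have := hD.one_sub_prior_pos
  rw [surv, neg_mul, Real.exp_neg]
  field_simp

theorem IsModel.surv_mul_stat (hD : D.IsModel) (e : JumpData) (t : ℝ≥0) (k : ℕ) :
    D.surv t * D.stat e t k = ∫ v, (v - D.mu) ^ k * D.weight e t v ∂D.γ := by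
  rw [stat, ← mul_assoc, hD.exp_div_mul_surv, one_mul]

theorem IsModel.indep_observations (hD : D.IsModel) :
    Indep (MeasurableSpace.comap (fun ω k => D.σ k ω) inferInstance ⊔
      MeasurableSpace.comap (fun ω k => D.Y k ω) inferInstance)
      (MeasurableSpace.comap (fun ω => (D.Λ ω, D.θ ω)) inferInstance) D.P₀ := by
  have hle : ∀ i, (![MeasurableSpace.comap (fun ω k => D.σ k ω) inferInstance,
      MeasurableSpace.comap (fun ω k => D.Y k ω) inferInstance,
      MeasurableSpace.comap D.θ inferInstance,
      MeasurableSpace.comap D.Λ inferInstance] : Fin 4 → MeasurableSpace Ω) i ≤ mΩ := by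
    intro i
    fin_cases i
    · exact (measurable_pi_iff.2 D.measurable_σ).comap_le
    · exact (measurable_pi_iff.2 D.measurable_Y).comap_le
    · exact D.measurable_θ.comap_le
    · exact D.measurable_Λ.comap_le
  have h := indep_iSup_of_disjoint hle hD.indep (S := {0, 1}) (T := {2, 3}) (by
    rw [Set.disjoint_left]; decide)
  simp only [iSup_insert, iSup_singleton] at h
  refine indep_of_indep_of_le_right h ?_
  rw [sup_comm]
  exact (MeasurableSpace.comap_prodMk D.Λ D.θ).le

theorem IsModel.indep_F (hD : D.IsModel) (t : ℝ≥0) :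
    Indep (D.F t) (MeasurableSpace.comap (fun ω => (D.Λ ω, D.θ ω)) inferInstance) D.P₀ :=
  indep_of_indep_of_le_left hD.indep_observations (D.F_le_comap t)

theorem IsModel.map_Λ_θ (hD : D.IsModel) :
    D.P₀.map (fun ω => (D.Λ ω, D.θ ω)) = D.γ.prod D.θlaw := by
  have := hD.prob_P₀
  have h : IndepFun D.Λ D.θ D.P₀ := by
    rw [IndepFun_iff_Indep]
    exact hD.indep.indep (i := 3) (j := 2) (by decide)
  rw [h.map_prod_eq_prod_map_map D.measurable_Λ.aemeasurable D.measurable_θ.aemeasurable,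
    hD.Λ_law, θlaw]

theorem IsModel.ae_Λ_pos (hD : D.IsModel) : ∀ᵐ ω ∂D.P₀, 0 < D.Λ ω := by
  have h := hD.ae_γ_pos
  rw [← hD.Λ_law] at h
  exact ae_of_ae_map D.measurable_Λ.aemeasurable h

variable (D) in
theorem Z_eq (t : ℝ≥0) (ω : Ω) :
    D.Z t ω = if D.θ ω ≤ t then D.lik (D.history t ω) (D.θ ω) t (D.Λ ω) else 1 := by
  rw [Z]
  split_ifs with h
  · rw [D.lik_history h]
  · rfl

variable (D) in
theorem measurable_Z (t : ℝ≥0) : Measurable (D.Z t) := by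
  have h : Measurable fun ω => if D.θ ω ≤ t then
      D.lik (D.history t ω) (D.θ ω) t (D.Λ ω) else 1 :=
    Measurable.ite (measurableSet_le D.measurable_θ measurable_const)
      (Measurable.lik D (D.measurable_history t) D.measurable_θ measurable_const D.measurable_Λ)
      measurable_const
  convert! h using 2 with ω
  exact D.Z_eq t ω

theorem IsModel.Z_nonneg (hD : D.IsModel) (t : ℝ≥0) : 0 ≤ᵐ[D.P₀] D.Z t := by
  filter_upwards [hD.ae_Λ_pos] with ω hω
  rw [Z_eq]
  split_ifs
  · exact hD.lik_nonneg (fun k _ => history_nonneg t ω k) _ _ hω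
  · exact zero_le_one

variable (D) in
theorem G_le (t : ℝ≥0) : D.G t ≤ mΩ :=
  sup_le (sup_le (D.F.le t) D.measurable_θ.comap_le) D.measurable_Λ.comap_le

variable (D) in
theorem F_le_G (t : ℝ≥0) : D.F t ≤ D.G t := le_sup_left.trans le_sup_left

variable (D) in
theorem measurable_G_θ (t : ℝ≥0) : Measurable[D.G t] D.θ :=
  (comap_measurable D.θ).mono (le_sup_right.trans le_sup_left) le_rfl

variable (D) in
theorem measurable_G_Λ (t : ℝ≥0) : Measurable[D.G t] D.Λ :=
  (comap_measurable D.Λ).mono le_sup_right le_rfl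

variable (D) in
theorem Z_zero (ω : Ω) : D.Z 0 ω = 1 := by
  rw [Z]
  split_ifs with h
  · have h0 : D.θ ω = 0 := le_antisymm h zero_le
    simp [LQuot, h0]
  · rfl

/-- Since `Z 0 = 1`, the measures `P` and `P₀` agree on `G 0`, which contains `σ(Λ)`. Thus `Λ` keeps
the law `γ` and all its moments under `P`. -/
theorem IsModel.map_P_Λ (hD : D.IsModel) : D.P.map D.Λ = D.γ := by
  rw [← hD.Λ_law]
  ext B hB
  rw [Measure.map_apply D.measurable_Λ hB, Measure.map_apply D.measurable_Λ hB,
    hD.density 0 _ (D.measurable_G_Λ 0 hB)]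
  simp [Z_zero]

theorem IsModel.integrable_P_pow (hD : D.IsModel) (k : ℕ) :
    Integrable (fun ω => (D.Λ ω - D.mu) ^ k) D.P := by
  have h := hD.γ_moments k
  rw [← hD.map_P_Λ] at h
  exact (integrable_map_measure h.aestronglyMeasurable D.measurable_Λ.aemeasurable).1 h

/-- The joint moments with `Z` under the reference measure. -/
theorem IsModel.condExp_Z_mul (hD : D.IsModel) (t : ℝ≥0) (k : ℕ) :
    Integrable (fun ω => D.Z t ω *
      {ω | D.θ ω ≤ t}.indicator (fun ω => (D.Λ ω - D.mu) ^ k) ω) D.P₀ ∧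
    D.P₀[fun ω => D.Z t ω * {ω | D.θ ω ≤ t}.indicator (fun ω => (D.Λ ω - D.mu) ^ k) ω | D.F t]
      =ᵐ[D.P₀] fun ω => D.surv t * D.stat (D.history t ω) t k := by
  have := hD.prob_P₀
  have := hD.prob_P
  have := hD.prob_γ
  have := hD.isProbabilityMeasure_θlaw
  have hms : MeasurableSet[D.G t] {ω | D.θ ω ≤ t} := D.measurable_G_θ t measurableSet_Iic
  -- Integrability is transported back from `P`, where it only involves the moments of `Λ`; no
  -- estimate of the likelihood averaged over the observations is needed.
  have hint : Integrable (fun ω => D.Z t ω *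
      {ω | D.θ ω ≤ t}.indicator (fun ω => (D.Λ ω - D.mu) ^ k) ω) D.P₀ := by
    refine (integral_eq_of_density (D.G_le t) (D.measurable_Z t) (hD.Z_nonneg t) (hD.density t)
      ?_).1.1 ((hD.integrable_P_pow k).indicator (D.G_le t _ hms))
    have h1 : Measurable[D.G t] fun ω => (D.Λ ω - D.mu) ^ k :=
      ((D.measurable_G_Λ t).sub_const D.mu).pow_const k
    exact (h1.indicator hms).stronglyMeasurable
  refine ⟨hint, ?_⟩
  set f : JumpData → ℝ × ℝ≥0 → ℝ := fun e q =>
    if q.2 ≤ t then (q.1 - D.mu) ^ k * D.lik e q.2 t q.1 else 0 with hf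
  have hfm : Measurable (Function.uncurry f) := by
    refine Measurable.ite (measurableSet_le (by fun_prop) (by fun_prop))
      (Measurable.mul (by fun_prop) ?_) measurable_const
    exact Measurable.lik D (by fun_prop) (by fun_prop) (by fun_prop) (by fun_prop)
  have heq : (fun ω => D.Z t ω *
      {ω | D.θ ω ≤ t}.indicator (fun ω => (D.Λ ω - D.mu) ^ k) ω) =
      fun ω => f (D.history t ω) (D.Λ ω, D.θ ω) := by
    ext ω
    rw [Z_eq]
    by_cases h : D.θ ω ≤ t
    · rw [indicator_of_mem (by exact h), if_pos h, hf]
      simp only [if_pos h, mul_comm]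
    · rw [indicator_of_notMem (by exact h), hf]
      simp only [if_neg h, mul_zero]
  rw [heq] at hint ⊢
  refine (condExp_comp_of_indep (D.F.le t) (D.measurable_F_history t)
    (D.measurable_Λ.prodMk D.measurable_θ) (hD.indep_F t) hfm hint).trans (ae_of_all _ fun ω => ?_)
  simp only
  set e := D.history t ω
  -- With the jump data frozen, the polynomial bound on the likelihood justifies Fubini.
  have hfe : Integrable (f e) (D.γ.prod D.θlaw) := by
    have hb : Integrable (fun q : ℝ × ℝ≥0 => Real.exp (D.mu * t) * D.markBound e *
        (1 + |q.1 - D.mu|) ^ (k + e.1)) (D.γ.prod D.θlaw) :=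
      ((hD.integrable_one_add_abs_pow (k + e.1)).const_mul _).comp_fst _
    refine hb.mono' (hfm.comp measurable_prodMk_left).aestronglyMeasurable ?_
    have hpos : ∀ᵐ q ∂(D.γ.prod D.θlaw), 0 < q.1 :=
      Measure.quasiMeasurePreserving_fst.ae hD.ae_γ_pos
    filter_upwards [hpos] with q hq
    have hnn := hD.markBound_nonneg e
    simp only [hf]
    split_ifs with h
    · rw [Real.norm_eq_abs, abs_mul, abs_pow, pow_add, mul_left_comm]
      have h1 := hD.abs_lik_le_of_pos e h le_rfl hq
      have h2 : |q.1 - D.mu| ^ k ≤ (1 + |q.1 - D.mu|) ^ k :=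
        pow_le_pow_left₀ (abs_nonneg _) (by linarith) k
      calc _ ≤ (1 + |q.1 - D.mu|) ^ k *
            (Real.exp (D.mu * t) * D.markBound e * (1 + |q.1 - D.mu|) ^ e.1) := by gcongr
        _ = _ := by ring
    · rw [norm_zero]
      positivity
  rw [hD.map_Λ_θ, integral_prod _ hfe, hD.surv_mul_stat]
  refine integral_congr_ae (ae_of_all _ fun v => ?_)
  simp only [weight]
  rw [← integral_indicator measurableSet_Iic, ← integral_const_mul]
  refine integral_congr_ae (ae_of_all _ fun u => ?_)
  by_cases h : u ≤ t
  · simp [hf, h]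
  · simp [hf, h]

theorem IsModel.integrable_surv_mul_stat (hD : D.IsModel) (t : ℝ≥0) (k : ℕ) :
    Integrable (fun ω => D.surv t * D.stat (D.history t ω) t k) D.P₀ :=
  integrable_condExp.congr (hD.condExp_Z_mul t k).2

theorem IsModel.measurable_stat_left (hD : D.IsModel) (t : ℝ≥0) :
    Measurable fun e => D.stat e t := by
  have := hD.prob_γ
  have := hD.isProbabilityMeasure_θlaw
  exact measurable_stat.comp (f := fun e => (e, t)) (by fun_prop)

theorem IsModel.measurable_F_stat (hD : D.IsModel) (t : ℝ≥0) (k : ℕ) :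
    Measurable[D.F t] fun ω => D.stat (D.history t ω) t k :=
  (measurable_pi_iff.1 (hD.measurable_stat_left t) k).comp (D.measurable_F_history t)

theorem IsModel.measurable_F_obsDensity (hD : D.IsModel) (t : ℝ≥0) :
    Measurable[D.F t] (D.obsDensity t) :=
  ((hD.measurable_F_stat t 0).const_add 1).const_mul (D.surv t)

theorem IsModel.stat_history_nonneg (hD : D.IsModel) (t : ℝ≥0) (ω : Ω) :
    0 ≤ D.stat (D.history t ω) t 0 :=
  hD.stat_zero_nonneg (fun k _ => history_nonneg t ω k) t

theorem IsModel.obsDensity_pos (hD : D.IsModel) (t : ℝ≥0) (ω : Ω) : 0 < D.obsDensity t ω :=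
  mul_pos (hD.surv_pos t) (by linarith [hD.stat_history_nonneg t ω])

theorem IsModel.integrable_obsDensity (hD : D.IsModel) (t : ℝ≥0) :
    Integrable (D.obsDensity t) D.P₀ := by
  have := hD.prob_P₀
  unfold obsDensity
  simp_rw [mul_add]
  exact (integrable_const _).add (hD.integrable_surv_mul_stat t 0)

theorem IsModel.setIntegral_Z_mul (hD : D.IsModel) (t : ℝ≥0) (k : ℕ) {A : Set Ω}
    (hA : MeasurableSet[D.F t] A) :
    ∫ ω in A, {ω | D.θ ω ≤ t}.indicator (fun ω => (D.Λ ω - D.mu) ^ k) ω ∂D.P =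
      ∫ ω in A, D.surv t * D.stat (D.history t ω) t k ∂D.P₀ := by
  have := hD.prob_P₀
  have hms : MeasurableSet[D.G t] {ω | D.θ ω ≤ t} := D.measurable_G_θ t measurableSet_Iic
  have h1 : Measurable[D.G t] fun ω => (D.Λ ω - D.mu) ^ k :=
    ((D.measurable_G_Λ t).sub_const D.mu).pow_const k
  have hsm := ((h1.indicator hms).indicator (D.F_le_G t _ hA)).stronglyMeasurable
  rw [← integral_indicator (D.F.le t _ hA),
    (integral_eq_of_density (D.G_le t) (D.measurable_Z t) (hD.Z_nonneg t) (hD.density t) hsm).2,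
    ← setIntegral_congr_ae (D.F.le t _ hA) ((hD.condExp_Z_mul t k).2.mono fun ω h _ => h),
    setIntegral_condExp (D.F.le t) (hD.condExp_Z_mul t k).1 hA,
    ← integral_indicator (D.F.le t _ hA)]
  refine integral_congr_ae (ae_of_all _ fun ω => ?_)
  by_cases h : ω ∈ A <;> simp [h]

/-- On `{t < θ}` the density `Z t` equals 1. -/
theorem IsModel.measure_inter_lt_θ (hD : D.IsModel) {t : ℝ≥0} {A : Set Ω}
    (hA : MeasurableSet[D.F t] A) :
    D.P (A ∩ {ω | t < D.θ ω}) = D.P₀ (A ∩ {ω | t < D.θ ω}) := by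
  have hms : MeasurableSet[D.G t] {ω | t < D.θ ω} := D.measurable_G_θ t measurableSet_Ioi
  have hA' : MeasurableSet[D.G t] (A ∩ {ω | t < D.θ ω}) :=
    MeasurableSet.inter (D.F_le_G t _ hA) hms
  rw [hD.density t _ hA', ← setLIntegral_one]
  refine setLIntegral_congr_fun (D.G_le t _ hA') fun ω hω => ?_
  simp [Z, not_le.2 (show t < D.θ ω from hω.2)]

theorem IsModel.P₀_inter_lt_θ (hD : D.IsModel) {t : ℝ≥0} {A : Set Ω}
    (hA : MeasurableSet[D.F t] A) :
    D.P₀ (A ∩ {ω | t < D.θ ω}) = D.P₀ A * ENNReal.ofReal (D.surv t) := by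
  rw [← hD.measure_lt_θ t]
  refine (Indep_iff _ _ _).1 (hD.indep_F t) A _ hA ?_
  exact ⟨{q | t < q.2}, measurableSet_lt measurable_const measurable_snd, rfl⟩

/-- The event is split at `{t < θ}`. There `P` agrees with `P₀`, and independence gives the factor
`surv t`; on `{θ ≤ t}` the conditional expectation of `Z t` given `F t` is `surv t * stat 0`. -/
theorem IsModel.obs_density (hD : D.IsModel) (t : ℝ≥0) (A : Set Ω) (hA : MeasurableSet[D.F t] A) :
    D.P A = ∫⁻ ω in A, ENNReal.ofReal (D.obsDensity t ω) ∂D.P₀ := by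
  have := hD.prob_P₀
  have := hD.prob_P
  have hms : MeasurableSet {ω | t < D.θ ω} := measurableSet_lt measurable_const D.measurable_θ
  rw [← ofReal_integral_eq_lintegral_ofReal (hD.integrable_obsDensity t).integrableOn
    (ae_of_all _ fun ω => (hD.obsDensity_pos t ω).le)]
  have h1 := hD.setIntegral_Z_mul t 0 hA
  simp only [pow_zero] at h1
  have h2 : ∫ ω in A, D.obsDensity t ω ∂D.P₀ =
      D.P₀.real A * D.surv t + ∫ ω in A, D.surv t * D.stat (D.history t ω) t 0 ∂D.P₀ := by
    unfold obsDensity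
    simp_rw [mul_add]
    rw [integral_add (integrable_const _) (hD.integrable_surv_mul_stat t 0).integrableOn]
    simp
  have hle : MeasurableSet {ω | D.θ ω ≤ t} := D.measurable_θ measurableSet_Iic
  have h3 : ∫ ω in A, {ω | D.θ ω ≤ t}.indicator (fun _ => (1 : ℝ)) ω ∂D.P =
      D.P.real (A ∩ {ω | D.θ ω ≤ t}) := by
    rw [setIntegral_indicator hle]
    simp
  have h4 : D.P.real (A ∩ {ω | t < D.θ ω}) = D.P₀.real A * D.surv t := by
    rw [measureReal_def, hD.measure_inter_lt_θ hA, hD.P₀_inter_lt_θ hA, ENNReal.toReal_mul,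
      ENNReal.toReal_ofReal (hD.surv_pos t).le, measureReal_def]
  rw [h2, ← h1, h3, ← h4, ← ofReal_measureReal]
  congr 1
  have h5 : A \ {ω | t < D.θ ω} = A ∩ {ω | D.θ ω ≤ t} := by
    ext ω
    simp
  rw [← measureReal_inter_add_sdiff (s := A) hms, h5]

/-- The density on `F t` is strictly positive. The equivalence is local in time: it concerns events
of a single `F t`. -/
theorem IsModel.ae_P_iff (hD : D.IsModel) {t : ℝ≥0} {p : Ω → Prop}
    (hp : MeasurableSet[D.F t] {ω | p ω}) : (∀ᵐ ω ∂D.P, p ω) ↔ ∀ᵐ ω ∂D.P₀, p ω := by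
  have hms : MeasurableSet[D.F t] {ω | ¬ p ω} := hp.compl
  rw [ae_iff, ae_iff, hD.obs_density t _ hms, lintegral_eq_zero_iff
    ((hD.measurable_F_obsDensity t).mono (D.F.le t) le_rfl).ennreal_ofReal]
  have : ∀ ω, ENNReal.ofReal (D.obsDensity t ω) ≠ 0 := fun ω => by
    simpa using hD.obsDensity_pos t ω
  constructor
  · intro h
    rw [← Measure.restrict_eq_zero]
    refine Measure.measure_univ_eq_zero.1 ?_
    refine measure_mono_null ?_ (ae_iff.1 h)
    intro ω _
    exact this ω
  · intro h
    rw [Measure.restrict_eq_zero.2 h, ae_zero]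
    exact Filter.eventually_bot

theorem IsModel.integral_P_eq (hD : D.IsModel) {t : ℝ≥0} {f : Ω → ℝ}
    (hf : Measurable[D.F t] f) :
    (Integrable f D.P ↔ Integrable (fun ω => D.obsDensity t ω * f ω) D.P₀) ∧
      ∫ ω, f ω ∂D.P = ∫ ω, D.obsDensity t ω * f ω ∂D.P₀ :=
  integral_eq_of_density (D.F.le t) ((hD.measurable_F_obsDensity t).mono (D.F.le t) le_rfl)
    (ae_of_all _ fun ω => (hD.obsDensity_pos t ω).le) (hD.obs_density t) hf.stronglyMeasurable

/-- Bayes' formula: the `P₀`-conditional moment `surv t * stat k` is divided by the observation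
density `surv t * (1 + stat 0)`, and `surv t` cancels. -/
theorem IsModel.condExp_P_pow (hD : D.IsModel) (t : ℝ≥0) (k : ℕ) :
    D.P[{ω | D.θ ω ≤ t}.indicator (fun ω => (D.Λ ω - D.mu) ^ k) | D.F t] =ᵐ[D.P]
      fun ω => D.stat (D.history t ω) t k / (1 + D.stat (D.history t ω) t 0) := by
  have := hD.prob_P
  have hms : MeasurableSet {ω | D.θ ω ≤ t} := D.measurable_θ measurableSet_Iic
  have hq : Measurable[D.F t] fun ω =>
      D.stat (D.history t ω) t k / (1 + D.stat (D.history t ω) t 0) :=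
    (hD.measurable_F_stat t k).div ((hD.measurable_F_stat t 0).const_add 1)
  have heq : (fun ω => D.obsDensity t ω *
      (D.stat (D.history t ω) t k / (1 + D.stat (D.history t ω) t 0))) =
      fun ω => D.surv t * D.stat (D.history t ω) t k := by
    ext ω
    have : 1 + D.stat (D.history t ω) t 0 ≠ 0 := by linarith [hD.stat_history_nonneg t ω]
    rw [obsDensity]
    field_simp
  have hqi := (hD.integral_P_eq hq).1.2 (heq ▸ hD.integrable_surv_mul_stat t k)
  symm
  refine ae_eq_condExp_of_forall_setIntegral_eq (D.F.le t)
    ((hD.integrable_P_pow k).indicator hms) (fun _ _ _ => hqi.integrableOn) (fun A hA _ => ?_)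
    hq.stronglyMeasurable.aestronglyMeasurable
  rw [hD.setIntegral_Z_mul t k hA, ← integral_indicator (D.F.le t _ hA),
    (hD.integral_P_eq (hq.indicator hA)).2, ← integral_indicator (D.F.le t _ hA), ← heq]
  refine integral_congr_ae (ae_of_all _ fun ω => ?_)
  by_cases h : ω ∈ A <;> simp [h]

theorem IsModel.oddsRatio_eq (hD : D.IsModel) (t : ℝ≥0) (k : ℕ) :
    D.oddsRatio k t =ᵐ[D.P] fun ω => D.stat (D.history t ω) t k := by
  filter_upwards [hD.condExp_P_pow t k, hD.condExp_P_pow t 0] with ω h1 h2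
  simp only [pow_zero] at h2
  rw [oddsRatio, posterior, h1, h2]
  have : 1 + D.stat (D.history t ω) t 0 ≠ 0 := by linarith [hD.stat_history_nonneg t ω]
  field_simp
  ring

end PhysicalMeasure

/-! ### The linear differential equations between arrivals. -/

section BetweenArrivals

variable {Ω : Type*} [mΩ : MeasurableSpace Ω] {d : ℕ} (D : DisorderData Ω d)

variable {D}

theorem IsModel.measure_θ_Ioc (hD : D.IsModel) {a b : ℝ≥0} (hab : a ≤ b) :
    D.θlaw (Ioc a b) = ENNReal.ofReal (D.surv a - D.surv b) := by
  have := hD.isProbabilityMeasure_θlaw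
  have h : ∀ t, D.θlaw (Ioi t) = ENNReal.ofReal (D.surv t) := fun t => by
    rw [θlaw, Measure.map_apply D.measurable_θ measurableSet_Ioi]
    exact hD.measure_lt_θ t
  rw [← Ioi_sdiff_Ioi, measure_sdiff (Ioi_subset_Ioi hab) measurableSet_Ioi.nullMeasurableSet
    (measure_ne_top _ _), h, h, ENNReal.ofReal_sub _ (hD.surv_pos b).le]

theorem IsModel.lintegral_exp (hD : D.IsModel) {a b : ℝ≥0} (hab : a ≤ b) :
    ∫⁻ x in Ioc (a : ℝ) b, ENNReal.ofReal ((1 - D.prior) * D.lam * Real.exp (-D.lam * x)) =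
      ENNReal.ofReal (D.surv a - D.surv b) := by
  have h1 := hD.one_sub_prior_pos
  have h2 := hD.lam_pos
  have hc : Continuous fun x : ℝ => (1 - D.prior) * D.lam * Real.exp (-D.lam * x) := by fun_prop
  rw [← ofReal_integral_eq_lintegral_ofReal, ← intervalIntegral.integral_of_le
    (show (a : ℝ) ≤ b by exact_mod_cast hab)]
  · congr 1
    have hd : ∀ x ∈ uIcc (a : ℝ) b, HasDerivAt (fun x : ℝ => -(1 - D.prior) * Real.exp (-D.lam * x))
        ((1 - D.prior) * D.lam * Real.exp (-D.lam * x)) x := fun x _ => by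
      have h := ((hasDerivAt_id x).const_mul (-D.lam)).exp.const_mul (-(1 - D.prior))
      refine h.congr_deriv ?_
      simp only [id, mul_one]
      ring
    rw [intervalIntegral.integral_eq_sub_of_hasDerivAt hd (hc.intervalIntegrable _ _), surv, surv]
    ring
  · exact hc.integrableOn_Ioc
  · exact ae_of_all _ fun x => by positivity

theorem IsModel.map_coe_θlaw_restrict (hD : D.IsModel) :
    (D.θlaw.map ((↑) : ℝ≥0 → ℝ)).restrict (Ioi 0) = (volume.restrict (Ioi 0)).withDensity
      fun x : ℝ => ENNReal.ofReal ((1 - D.prior) * D.lam * Real.exp (-D.lam * x)) := by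
  have := hD.isProbabilityMeasure_θlaw
  have := Measure.isProbabilityMeasure_map (μ := D.θlaw)
    (NNReal.continuous_coe.measurable.aemeasurable)
  refine Measure.ext_of_Ioc _ _ fun a b hab => ?_
  rw [Measure.restrict_apply measurableSet_Ioc, withDensity_apply _ measurableSet_Ioc,
    Measure.restrict_restrict measurableSet_Ioc, Ioc_inter_Ioi]
  -- Only the part of `(a, b]` inside `(0, ∞)` counts: it is empty for `b ≤ 0`, and otherwise `a` is
  -- replaced by `max a 0`. The possible atom of `θ` at zero is thereby excluded.
  rcases le_or_gt b 0 with hb | hb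
  · simp [Ioc_eq_empty (not_lt.2 (hb.trans (le_max_right a 0)))]
  · have ha : (0 : ℝ) ≤ a ⊔ 0 := le_max_right _ _
    have hab' : a ⊔ 0 ≤ b := max_le hab.le hb.le
    lift b to ℝ≥0 using hb.le
    generalize a ⊔ 0 = a' at *
    lift a' to ℝ≥0 using ha
    rw [hD.lintegral_exp (by exact_mod_cast hab'),
      Measure.map_apply NNReal.continuous_coe.measurable measurableSet_Ioc,
      ← hD.measure_θ_Ioc (by exact_mod_cast hab')]
    congr 1

theorem IsModel.setIntegral_θlaw (hD : D.IsModel) {s t : ℝ≥0} (hst : s ≤ t) (f : ℝ≥0 → ℝ) :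
    ∫ u in Ioc s t, f u ∂D.θlaw =
      ∫ x in (s : ℝ)..t, (1 - D.prior) * D.lam * Real.exp (-D.lam * x) * f x.toNNReal := by
  have h1 := hD.one_sub_prior_pos
  have h2 := hD.lam_pos
  have hemb : MeasurableEmbedding ((↑) : ℝ≥0 → ℝ) :=
    NNReal.isClosedEmbedding_coe.measurableEmbedding
  have hpre : ((↑) : ℝ≥0 → ℝ) ⁻¹' Ioc (s : ℝ) t = Ioc s t := by
    ext x
    simp
  have hsub : Ioc (s : ℝ) t ⊆ Ioi 0 := fun x hx => (NNReal.coe_nonneg s).trans_lt hx.1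
  have h3 := hemb.setIntegral_map (μ := D.θlaw) (fun x : ℝ => f x.toNNReal) (Ioc (s : ℝ) t)
  rw [hpre] at h3
  simp only [Real.toNNReal_coe] at h3
  rw [← h3, intervalIntegral.integral_of_le (by exact_mod_cast hst),
    ← Measure.restrict_restrict_of_subset hsub, hD.map_coe_θlaw_restrict,
    setIntegral_withDensity_eq_setIntegral_toReal_smul (by fun_prop) (by simp) _ measurableSet_Ioc,
    Measure.restrict_restrict_of_subset hsub]
  refine setIntegral_congr_fun measurableSet_Ioc fun x _ => ?_
  simp only [smul_eq_mul]
  rw [ENNReal.toReal_ofReal (by positivity)]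

/-- The survival function is continuous, so the only possible atom of the law of `θ` is at zero.
Hence a disorder exactly at an arrival time can be neglected. -/
theorem IsModel.θlaw_singleton (hD : D.IsModel) {x : ℝ≥0} (hx : 0 < x) : D.θlaw {x} = 0 := by
  have hle : ∀ s < x, D.θlaw {x} ≤ ENNReal.ofReal (D.surv s - D.surv x) := fun s hs => by
    rw [← hD.measure_θ_Ioc hs.le]
    exact measure_mono (by simpa using hs)
  have hcont : Continuous fun s : ℝ≥0 => ENNReal.ofReal (D.surv s - D.surv x) := by
    unfold surv
    exact ENNReal.continuous_ofReal.comp (by fun_prop)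
  have hne : (𝓝[<] x).NeBot := nhdsLT_neBot_of_exists_lt ⟨0, hx⟩
  have hlim : Tendsto (fun s : ℝ≥0 => ENNReal.ofReal (D.surv s - D.surv x)) (𝓝[<] x) (𝓝 0) := by
    have := (hcont.tendsto x).mono_left (nhdsWithin_le_nhds (s := Iio x))
    simpa using this
  exact le_antisymm (ge_of_tendsto hlim (eventually_mem_nhdsWithin.mono hle)) zero_le

/-- The product of jump factors does not involve the current time, which enters through the
exponential alone. -/
theorem lik_of_le {e : JumpData} {s t u : ℝ≥0} (v : ℝ) :
    D.lik e u t v = Real.exp (-(v - D.mu) * ((t : ℝ) - s)) * D.lik e u s v := by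
  rw [lik, lik, ← mul_assoc, ← Real.exp_add]
  ring_nf

theorem lik_of_forall_le {e : JumpData} {t u : ℝ≥0} (h : ∀ k < e.1, e.2.1 k ≤ u) (v : ℝ) :
    D.lik e u t v = Real.exp (-(v - D.mu) * ((t : ℝ) - u)) := by
  rw [lik, Finset.prod_eq_one, mul_one]
  intro k hk
  rw [if_neg (not_lt.2 (h k (Finset.mem_range.1 hk)))]

/-- The weight, discounted by the prior survival probability. -/
def oddsWeight (D : DisorderData Ω d) (e : JumpData) (t : ℝ≥0) (v : ℝ) : ℝ :=
  Real.exp (D.lam * t) / (1 - D.prior) * D.weight e t v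

theorem stat_eq_oddsWeight (e : JumpData) (t : ℝ≥0) (k : ℕ) :
    D.stat e t k = ∫ v, (v - D.mu) ^ k * D.oddsWeight e t v ∂D.γ := by
  rw [stat, ← integral_const_mul]
  refine integral_congr_ae (ae_of_all _ fun v => ?_)
  simp only [oddsWeight]
  ring

/-- Variation of constants. A disorder in `(s, t]` meets no jump, so its likelihood is a pure
exponential; the prefactor `e^{λt}/(1 - π)` turns the density `(1 - π) λ e^{-λx}` of `θ` into `λ
e^{λ(t-x)}`. -/
theorem IsModel.oddsWeight_eq (hD : D.IsModel) {e : JumpData} {s t : ℝ≥0}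
    (h : ∀ k < e.1, e.2.1 k ≤ s) (hst : s ≤ t) (v : ℝ) :
    D.oddsWeight e t v = Real.exp (-(v - D.mu - D.lam) * ((t : ℝ) - s)) * D.oddsWeight e s v +
      D.lam * ∫ x in (s : ℝ)..t, Real.exp (-(v - D.mu - D.lam) * (t - x)) := by
  have hp := hD.one_sub_prior_pos
  have hi := hD.integrableOn_lik e t v
  have hw : D.weight e t v = Real.exp (-(v - D.mu) * ((t : ℝ) - s)) * D.weight e s v +
      ∫ u in Ioc s t, Real.exp (-(v - D.mu) * ((t : ℝ) - u)) ∂D.θlaw := by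
    rw [weight, ← Iic_union_Ioc_eq_Iic hst, setIntegral_union (Iic_disjoint_Ioc le_rfl)
      measurableSet_Ioc (hi.mono_set (Iic_subset_Iic.2 hst)) (hi.mono_set Ioc_subset_Iic_self),
      weight, ← integral_const_mul]
    congr 1
    · exact setIntegral_congr_fun measurableSet_Iic fun u _ => lik_of_le v
    · exact setIntegral_congr_fun measurableSet_Ioc fun u hu =>
        lik_of_forall_le (fun k hk => (h k hk).trans hu.1.le) v
  rw [hD.setIntegral_θlaw hst] at hw
  rw [oddsWeight, hw, mul_add, oddsWeight]
  congr 1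
  · rw [← mul_assoc, ← mul_assoc, mul_div_assoc', mul_comm (Real.exp (D.lam * t) / _),
      mul_div_assoc', ← Real.exp_add, ← Real.exp_add]
    ring_nf
  · rw [← intervalIntegral.integral_const_mul, ← intervalIntegral.integral_const_mul]
    refine intervalIntegral.integral_congr fun x hx => ?_
    rw [uIcc_of_le (by exact_mod_cast hst)] at hx
    have hx0 : 0 ≤ x := (NNReal.coe_nonneg s).trans hx.1
    simp only [Real.coe_toNNReal x hx0]
    rw [show -(v - D.mu - D.lam) * ((t : ℝ) - x) =
      D.lam * t + -D.lam * x + -(v - D.mu) * (t - x) by ring, Real.exp_add, Real.exp_add]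
    field_simp

theorem IsModel.oddsWeight_ode (hD : D.IsModel) {e : JumpData} {s t : ℝ≥0}
    (h : ∀ k < e.1, e.2.1 k ≤ s) (hst : s ≤ t) (v : ℝ) :
    D.oddsWeight e t v = D.oddsWeight e s v +
      ∫ x in (s : ℝ)..t, (D.lam - (v - D.mu - D.lam) * D.oddsWeight e x.toNNReal v) := by
  set c := v - D.mu - D.lam with hc
  -- The formula is extended to all real times, where it has a two-sided derivative. The factor
  -- `e^{-cz}` is taken out of the integral so that the upper limit is the only dependence on `z`
  -- left there.
  set y : ℝ → ℝ := fun z => Real.exp (-c * (z - s)) * D.oddsWeight e s v +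
    D.lam * (Real.exp (-c * z) * ∫ x in (s : ℝ)..z, Real.exp (c * x)) with hy
  have hyeq : ∀ z : ℝ≥0, s ≤ z → D.oddsWeight e z v = y z := fun z hz => by
    have h5 : ∫ x in (s : ℝ)..z, Real.exp (-c * (z - x)) =
        Real.exp (-c * z) * ∫ x in (s : ℝ)..z, Real.exp (c * x) := by
      rw [← intervalIntegral.integral_const_mul]
      refine intervalIntegral.integral_congr fun x _ => ?_
      rw [← Real.exp_add]
      ring_nf
    rw [hD.oddsWeight_eq h hz v, h5]
  have hd : ∀ z, HasDerivAt y (D.lam - c * y z) z := fun z => by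
    have h1 : HasDerivAt (fun z => Real.exp (-c * (z - s))) (-c * Real.exp (-c * (z - s))) z := by
      have := (((hasDerivAt_id z).sub_const (s : ℝ)).const_mul (-c)).exp
      simpa [mul_comm] using this
    have h2 : HasDerivAt (fun z => Real.exp (-c * z)) (-c * Real.exp (-c * z)) z := by
      have := ((hasDerivAt_id z).const_mul (-c)).exp
      simpa [mul_comm] using this
    have hcont : Continuous fun x : ℝ => Real.exp (c * x) := by fun_prop
    have h3 : HasDerivAt (fun z => ∫ x in (s : ℝ)..z, Real.exp (c * x)) (Real.exp (c * z)) z :=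
      intervalIntegral.integral_hasDerivAt_right (hcont.intervalIntegrable _ _)
        (hcont.stronglyMeasurableAtFilter _ _) hcont.continuousAt
    refine ((h1.mul_const _).add ((h2.mul h3).const_mul D.lam)).congr_deriv ?_
    have h4 : Real.exp (-c * z) * Real.exp (c * z) = 1 := by
      rw [← Real.exp_add]
      simp
    rw [h4, hy]
    ring
  have hycont : Continuous y := continuous_iff_continuousAt.2 fun z => (hd z).continuousAt
  have hint : IntervalIntegrable (fun z => D.lam - c * y z) volume s t :=
    (Continuous.intervalIntegrable (by fun_prop) _ _)
  have := intervalIntegral.integral_eq_sub_of_hasDerivAt (fun z _ => hd z) hint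
  rw [hyeq t hst, hyeq s le_rfl, ← sub_eq_iff_eq_add', ← this]
  refine intervalIntegral.integral_congr fun x hx => ?_
  rw [uIcc_of_le (by exact_mod_cast hst)] at hx
  have hx0 : 0 ≤ x := (NNReal.coe_nonneg s).trans hx.1
  rw [hyeq _ (NNReal.le_toNNReal_of_coe_le hx.1), Real.coe_toNNReal x hx0]

theorem IsModel.measurable_oddsWeight (hD : D.IsModel) (e : JumpData) :
    Measurable fun q : ℝ × ℝ => D.oddsWeight e q.1.toNNReal q.2 := by
  have := hD.isProbabilityMeasure_θlaw
  exact Measurable.mul (by fun_prop)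
    (measurable_weight.comp (f := fun q : ℝ × ℝ => (e, q.1.toNNReal, q.2)) (by fun_prop))

/-- A bound for `oddsWeight` on bounded time intervals. -/
def oddsBound (D : DisorderData Ω d) (e : JumpData) (T : ℝ≥0) : ℝ :=
  Real.exp (D.lam * T) / (1 - D.prior) * (Real.exp (D.mu * T) * D.markBound e)

theorem IsModel.oddsBound_nonneg (hD : D.IsModel) (e : JumpData) (T : ℝ≥0) :
    0 ≤ D.oddsBound e T := by
  have := hD.one_sub_prior_pos
  have := hD.markBound_nonneg e
  unfold oddsBound
  positivity

theorem IsModel.abs_oddsWeight_le (hD : D.IsModel) (e : JumpData) {t T : ℝ≥0} (htT : t ≤ T)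
    {v : ℝ} (hv : 0 < v) : |D.oddsWeight e t v| ≤ D.oddsBound e T * (1 + |v - D.mu|) ^ e.1 := by
  have := hD.one_sub_prior_pos
  have := hD.lam_pos
  have := hD.markBound_nonneg e
  have h : (t : ℝ) ≤ T := htT
  rw [oddsWeight, abs_mul, oddsBound, mul_assoc, abs_of_nonneg (by positivity)]
  gcongr
  exact hD.abs_weight_le e htT hv

theorem IsModel.integrable_oddsWeight (hD : D.IsModel) (e : JumpData) (t : ℝ≥0) (k : ℕ) :
    Integrable (fun v => (v - D.mu) ^ k * D.oddsWeight e t v) D.γ := by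
  refine ((hD.integrable_weight e t k).const_mul
    (Real.exp (D.lam * t) / (1 - D.prior))).congr (ae_of_all _ fun v => ?_)
  simp only [oddsWeight]
  ring

/-- In the equation for the weight, the coefficient `v - μ` raises the power `(v - μ)^k` by one;
this is where the next statistic enters the drift. -/
theorem IsModel.integral_drift (hD : D.IsModel) (e : JumpData) (t : ℝ≥0) (k : ℕ) :
    ∫ v, (v - D.mu) ^ k * (D.lam - (v - D.mu - D.lam) * D.oddsWeight e t v) ∂D.γ =
      D.lam * (D.m k + D.stat e t k) - D.stat e t (k + 1) := by
  have h1 := (hD.γ_moments k).const_mul D.lam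
  have h2 := (hD.integrable_oddsWeight e t k).const_mul D.lam
  have h3 := hD.integrable_oddsWeight e t (k + 1)
  rw [stat_eq_oddsWeight, stat_eq_oddsWeight, m, mul_add, ← integral_const_mul,
    ← integral_const_mul, ← integral_add h1 h2, ← integral_sub (by exact h1.add h2) h3]
  refine integral_congr_ae (ae_of_all _ fun v => ?_)
  simp only
  ring

theorem IsModel.integrable_drift_prod (hD : D.IsModel) (e : JumpData) (s t : ℝ≥0) (k : ℕ) :
    Integrable (fun q : ℝ × ℝ => (q.2 - D.mu) ^ k *
      (D.lam - (q.2 - D.mu - D.lam) * D.oddsWeight e q.1.toNNReal q.2))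
      ((volume.restrict (Ioc (s : ℝ) t)).prod D.γ) := by
  have := hD.prob_γ
  have hl := hD.lam_pos
  set M := D.oddsBound e t with hM
  have hM0 : 0 ≤ M := hD.oddsBound_nonneg e t
  have hb : Integrable (fun q : ℝ × ℝ => (D.lam + (1 + D.lam) * M) *
      (1 + |q.2 - D.mu|) ^ (k + (1 + e.1))) ((volume.restrict (Ioc (s : ℝ) t)).prod D.γ) :=
    ((hD.integrable_one_add_abs_pow (k + (1 + e.1))).const_mul _).comp_snd _
  refine hb.mono' ?_ ?_
  · refine (Measurable.mul (by fun_prop) (Measurable.const_sub (Measurable.mul (by fun_prop)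
      (hD.measurable_oddsWeight e)) _)).aestronglyMeasurable
  · have hpos : ∀ᵐ q ∂((volume.restrict (Ioc (s : ℝ) t)).prod D.γ), 0 < q.2 :=
      Measure.quasiMeasurePreserving_snd.ae hD.ae_γ_pos
    have hmem : ∀ᵐ q ∂((volume.restrict (Ioc (s : ℝ) t)).prod D.γ), q.1 ∈ Ioc (s : ℝ) t :=
      Measure.quasiMeasurePreserving_fst.ae (ae_restrict_mem measurableSet_Ioc)
    filter_upwards [hpos, hmem] with q hq hq1
    have hy := hD.abs_oddsWeight_le e (Real.toNNReal_le_iff_le_coe.2 hq1.2) hq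
    rw [← hM] at hy
    set a := |q.2 - D.mu| with ha
    have ha0 : 0 ≤ a := abs_nonneg _
    rw [Real.norm_eq_abs, abs_mul, abs_pow, pow_add, mul_left_comm]
    have h1 : a ^ k ≤ (1 + a) ^ k := pow_le_pow_left₀ ha0 (by linarith) k
    have h2 : |D.lam - (q.2 - D.mu - D.lam) * D.oddsWeight e q.1.toNNReal q.2| ≤
        (D.lam + (1 + D.lam) * M) * (1 + a) ^ (1 + e.1) := by
      have h3 : |q.2 - D.mu - D.lam| ≤ (1 + D.lam) * (1 + a) := by
        refine (abs_sub _ _).trans ?_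
        rw [abs_of_pos hl]
        nlinarith
      have h4 : 1 ≤ (1 + a) ^ (1 + e.1) := one_le_pow₀ (by linarith)
      calc _ ≤ |D.lam| + |q.2 - D.mu - D.lam| * |D.oddsWeight e q.1.toNNReal q.2| := by
            rw [← abs_mul]
            exact abs_sub _ _
        _ ≤ D.lam * (1 + a) ^ (1 + e.1) + ((1 + D.lam) * (1 + a)) * (M * (1 + a) ^ e.1) := by
            rw [abs_of_pos hl]
            gcongr
            nlinarith
        _ = _ := by rw [pow_add]; ring
    calc _ ≤ (1 + a) ^ k * ((D.lam + (1 + D.lam) * M) * (1 + a) ^ (1 + e.1)) := by gcongr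
      _ = _ := by ring

/-- The drift of the odds-ratio statistics. -/
def drift (D : DisorderData Ω d) (e : JumpData) (k : ℕ) (x : ℝ) : ℝ :=
  D.lam * (D.m k + D.stat e x.toNNReal k) - D.stat e x.toNNReal (k + 1)

theorem IsModel.intervalIntegrable_drift (hD : D.IsModel) (e : JumpData) {s t : ℝ≥0}
    (hst : s ≤ t) (k : ℕ) : IntervalIntegrable (D.drift e k) volume s t := by
  have := hD.prob_γ
  rw [intervalIntegrable_iff_integrableOn_Ioc_of_le (by exact_mod_cast hst)]
  refine (hD.integrable_drift_prod e s t k).integral_prod_left.congr (ae_of_all _ fun x => ?_)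
  exact hD.integral_drift e x.toNNReal k

/-- Between arrivals, the statistics solve a linear system of differential equations. -/
theorem IsModel.stat_ode (hD : D.IsModel) {e : JumpData} {s t : ℝ≥0}
    (h : ∀ k < e.1, e.2.1 k ≤ s) (hst : s ≤ t) (k : ℕ) :
    D.stat e t k = D.stat e s k + ∫ x in (s : ℝ)..t, D.drift e k x := by
  have := hD.prob_γ
  have hst' : (s : ℝ) ≤ t := by exact_mod_cast hst
  have hprod := hD.integrable_drift_prod e s t k
  have hinner := hprod.swap.integral_prod_left
  rw [stat_eq_oddsWeight, stat_eq_oddsWeight, intervalIntegral.integral_of_le hst']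
  -- The equation is known for each rate `v` separately; Fubini exchanges the average over `γ` with
  -- the time integral.
  have hswap : ∫ x in Ioc (s : ℝ) t, D.drift e k x = ∫ v, (∫ x in Ioc (s : ℝ) t,
      (v - D.mu) ^ k * (D.lam - (v - D.mu - D.lam) * D.oddsWeight e x.toNNReal v)) ∂D.γ := by
    rw [← integral_integral_swap (by exact hprod)]
    exact integral_congr_ae (ae_of_all _ fun x => (hD.integral_drift e x.toNNReal k).symm)
  rw [hswap, ← integral_add (hD.integrable_oddsWeight e s k) (by exact hinner)]
  refine integral_congr_ae (ae_of_all _ fun v => ?_)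
  simp only
  rw [hD.oddsWeight_ode h hst v, integral_const_mul, mul_add, intervalIntegral.integral_of_le hst']

theorem IsModel.continuousOn_stat (hD : D.IsModel) {e : JumpData} {s : ℝ≥0}
    (h : ∀ k < e.1, e.2.1 k ≤ s) (k : ℕ) : ContinuousOn (fun t => D.stat e t k) (Ici s) := by
  intro t (ht : s ≤ t)
  have hst : s ≤ t + 1 := ht.trans (by simp)
  have hst' : (s : ℝ) ≤ (t + 1 : ℝ≥0) := by exact_mod_cast hst
  have h1 := hD.intervalIntegrable_drift e hst k
  rw [intervalIntegrable_iff_integrableOn_Icc_of_le hst', ← uIcc_of_le hst'] at h1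
  have h2 := intervalIntegral.continuousOn_primitive_interval h1
  rw [uIcc_of_le hst'] at h2
  have h3 : ContinuousOn (fun z : ℝ≥0 => D.stat e s k + ∫ x in (s : ℝ)..z, D.drift e k x)
      (Icc s (t + 1)) := by
    refine continuousOn_const.add (h2.comp NNReal.continuous_coe.continuousOn fun z hz => ?_)
    exact ⟨by exact_mod_cast hz.1, by exact_mod_cast hz.2⟩
  have h4 : ContinuousOn (fun t => D.stat e t k) (Icc s (t + 1)) :=
    h3.congr fun z hz => hD.stat_ode h hz.1 k
  have h5 : t < t + 1 := lt_add_one t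
  refine (h4 t ⟨ht, h5.le⟩).mono_of_mem_nhdsWithin ?_
  rw [← Ici_inter_Iic]
  exact inter_mem self_mem_nhdsWithin (mem_nhdsWithin_of_mem_nhds (Iic_mem_nhds h5))

end BetweenArrivals

/-! ### Behaviour at arrivals and the integral equation. -/

section JumpEquation

variable {Ω : Type*} [mΩ : MeasurableSpace Ω] {d : ℕ} (D : DisorderData Ω d)

/-- The first `n` arrivals, with the likelihood ratios of the claims. -/
def jumps (n : ℕ) (ω : Ω) : JumpData := (n, fun k => D.σ k ω, fun k => D.r (D.Y k ω))

variable {D}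

theorem stat_congr {e e' : JumpData} {t : ℝ≥0}
    (h : ∀ᵐ v ∂D.γ, D.weight e t v = D.weight e' t v) : D.stat e t = D.stat e' t := by
  ext k
  rw [stat, stat]
  congr 1
  refine integral_congr_ae ?_
  filter_upwards [h] with v hv
  rw [hv]

theorem stat_history_eq {t : ℝ≥0} {ω : Ω} {n : ℕ} (h : D.N t ω = n) :
    D.stat (D.history t ω) t = D.stat (D.jumps n ω) t := by
  refine stat_congr (ae_of_all _ fun v => ?_)
  rw [weight, weight]
  refine setIntegral_congr_fun measurableSet_Iic fun u _ => ?_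
  simp only [lik]
  congr 1
  refine Finset.prod_congr (congrArg Finset.range h) fun k hk => ?_
  have hk' : k < D.N t ω := h ▸ Finset.mem_range.1 hk
  rw [D.history_σ hk', D.history_r hk']
  rfl

variable (D) in
theorem exists_arrival_ge (t : ℝ≥0) (ω : Ω) : ∃ n, (∀ k < n, D.σ k ω < t) ∧ t ≤ D.σ n ω := by
  have h : ∃ n, t ≤ D.σ n ω := ((D.σ_tendsto ω).eventually_ge_atTop t).exists
  classical
  exact ⟨Nat.find h, fun k hk => not_le.1 (Nat.find_min h hk), Nat.find_spec h⟩

theorem N_eq_of_mem {n : ℕ} {t : ℝ≥0} {ω : Ω} (h1 : ∀ k < n, D.σ k ω ≤ t) (h2 : t < D.σ n ω) :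
    D.N t ω = n :=
  N_eq_of_forall fun k => ⟨h1 k, fun h => (D.σ_strictMono ω).lt_iff_lt.1 (h.trans_lt h2)⟩

theorem exists_le_lt_of_forall {n : ℕ} {t : ℝ≥0} {ω : Ω} (ht : 0 < t)
    (h : ∀ k < n, D.σ k ω < t) : ∃ s < t, ∀ k < n, D.σ k ω ≤ s := by
  cases n with
  | zero => exact ⟨0, ht, by simp⟩
  | succ n =>
    exact ⟨D.σ n ω, h n (Nat.lt_succ_self n), fun k hk =>
      (D.σ_strictMono ω).monotone (Nat.lt_succ_iff.1 hk)⟩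

theorem nhdsLT_neBot {t : ℝ≥0} (ht : 0 < t) : (𝓝[<] t).NeBot :=
  nhdsLT_neBot_of_exists_lt ⟨0, ht⟩

/-- Here `n` counts the arrivals strictly before `t`. Just to the left of `t` the history consists
of exactly these jumps, and the statistic of fixed jump data is continuous after its last jump. -/
theorem IsModel.tendsto_stat_left (hD : D.IsModel) {n : ℕ} {t : ℝ≥0} {ω : Ω} (ht : 0 < t)
    (h1 : ∀ k < n, D.σ k ω < t) (h2 : t ≤ D.σ n ω) (k : ℕ) :
    Tendsto (fun t => D.stat (D.history t ω) t k) (𝓝[<] t) (𝓝 (D.stat (D.jumps n ω) t k)) := by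
  obtain ⟨s, hst, hs⟩ := exists_le_lt_of_forall ht h1
  have hc : ContinuousOn (fun t => D.stat (D.jumps n ω) t k) (Ici s) :=
    hD.continuousOn_stat (e := D.jumps n ω) hs k
  have h3 : Tendsto (fun t => D.stat (D.jumps n ω) t k) (𝓝[<] t)
      (𝓝 (D.stat (D.jumps n ω) t k)) := by
    refine (hc t hst.le).mono_left ?_
    rw [← nhdsWithin_Ioo_eq_nhdsLT hst]
    exact nhdsWithin_mono _ (Ioo_subset_Ioi_self.trans Ioi_subset_Ici_self)
  refine h3.congr' ?_
  filter_upwards [Ioo_mem_nhdsLT hst] with x hx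
  rw [stat_history_eq (N_eq_of_mem (fun k hk => (hs k hk).trans hx.1.le) (hx.2.trans_le h2))]

theorem IsModel.isCadlag_stat (hD : D.IsModel) (ω : Ω) (k : ℕ) :
    IsCadlag fun t => D.stat (D.history t ω) t k := by
  intro t
  constructor
  · have h1 : ∀ j < D.N t ω, D.σ j ω ≤ t := fun j hj => (D.lt_N_iff j t ω).1 hj
    have h2 : t < D.σ (D.N t ω) ω := not_le.1 fun h => lt_irrefl _ ((D.lt_N_iff _ t ω).2 h)
    have hc := hD.continuousOn_stat (e := D.jumps (D.N t ω) ω) h1 k t self_mem_Ici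
    refine hc.congr_of_eventuallyEq ?_ (congrFun (stat_history_eq rfl) k)
    filter_upwards [self_mem_nhdsWithin, mem_nhdsWithin_of_mem_nhds (Iio_mem_nhds h2)]
      with x hx1 hx2
    rw [stat_history_eq (N_eq_of_mem (fun j hj => (h1 j hj).trans hx1) hx2)]
  · rcases eq_zero_or_pos t with rfl | ht
    -- Nothing lies to the left of time zero, so any number serves as the left limit there.
    · have : 𝓝[<] (0 : ℝ≥0) = ⊥ := by
        rw [show Iio (0 : ℝ≥0) = ∅ from Iio_eq_empty_iff.2 isMin_bot]
        exact nhdsWithin_empty _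
      exact ⟨0, by rw [this]; exact tendsto_bot⟩
    · obtain ⟨n, h1, h2⟩ := D.exists_arrival_ge t ω
      exact ⟨_, hD.tendsto_stat_left ht h1 h2 k⟩

theorem IsModel.leftLim_stat (hD : D.IsModel) (n : ℕ) (ω : Ω) (k : ℕ) :
    Function.leftLim (fun t => D.stat (D.history t ω) t k) (D.σ n ω) =
      D.stat (D.jumps n ω) (D.σ n ω) k := by
  have := nhdsLT_neBot (D.σ_pos n ω)
  exact leftLim_eq_of_tendsto (h := this) (hD.tendsto_stat_left (D.σ_pos n ω)
    (fun j hj => D.σ_strictMono ω hj) le_rfl k)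

/-- For a disorder strictly before the arrival, the new jump multiplies the likelihood by `(v/μ)
r(Y)`. A disorder at the arrival time itself, which would leave the factor 1, has probability zero.
-/
theorem IsModel.weight_jump (hD : D.IsModel) (n : ℕ) (ω : Ω) (v : ℝ) :
    D.weight (D.jumps (n + 1) ω) (D.σ n ω) v =
      v / D.mu * D.r (D.Y n ω) * D.weight (D.jumps n ω) (D.σ n ω) v := by
  rw [weight, weight, ← integral_const_mul]
  refine setIntegral_congr_ae measurableSet_Iic ?_
  have h0 : ∀ᵐ u ∂D.θlaw, u ≠ D.σ n ω := by
    rw [ae_iff]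
    simpa using hD.θlaw_singleton (D.σ_pos n ω)
  filter_upwards [h0] with u hu hle
  have hlt : u < D.σ n ω := lt_of_le_of_ne hle hu
  have hsucc : D.lik (D.jumps (n + 1) ω) u (D.σ n ω) v = D.lik (D.jumps n ω) u (D.σ n ω) v *
      if u < D.σ n ω then v / D.mu * D.r (D.Y n ω) else 1 := by
    rw [lik, lik, show (D.jumps (n + 1) ω).1 = n + 1 from rfl, Finset.prod_range_succ, ← mul_assoc]
    rfl
  rw [hsucc, if_pos hlt, mul_comm]

/-- Writing `v/μ = 1 + (v - μ)/μ` in the factor `(v/μ) r(Y)` produces the current and the next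
moment. -/
theorem IsModel.stat_jump (hD : D.IsModel) (n : ℕ) (ω : Ω) (k : ℕ) :
    D.stat (D.jumps (n + 1) ω) (D.σ n ω) k = D.stat (D.jumps n ω) (D.σ n ω) k +
      D.stat (D.jumps n ω) (D.σ n ω) k * (D.r (D.Y n ω) - 1) +
      D.stat (D.jumps n ω) (D.σ n ω) (k + 1) * (1 / D.mu) * D.r (D.Y n ω) := by
  have hmu := hD.mu_pos.ne'
  have h1 := hD.integrable_weight (D.jumps n ω) (D.σ n ω) k
  have h2 := hD.integrable_weight (D.jumps n ω) (D.σ n ω) (k + 1)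
  have h3 : ∫ v, (v - D.mu) ^ k * D.weight (D.jumps (n + 1) ω) (D.σ n ω) v ∂D.γ =
      D.r (D.Y n ω) * (∫ v, (v - D.mu) ^ k * D.weight (D.jumps n ω) (D.σ n ω) v ∂D.γ) +
      1 / D.mu * D.r (D.Y n ω) *
        ∫ v, (v - D.mu) ^ (k + 1) * D.weight (D.jumps n ω) (D.σ n ω) v ∂D.γ := by
    rw [← integral_const_mul, ← integral_const_mul,
      ← integral_add (h1.const_mul _) (h2.const_mul _)]
    refine integral_congr_ae (ae_of_all _ fun v => ?_)
    simp only
    rw [hD.weight_jump]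
    field_simp
    ring
  rw [stat, h3, stat, stat]
  ring

theorem IsModel.stat_history_zero (hD : D.IsModel) (ω : Ω) (k : ℕ) :
    D.stat (D.history 0 ω) 0 k = D.prior / (1 - D.prior) * D.m k := by
  rw [stat_history_eq (D.N_zero ω), stat, m]
  have h : ∀ v, D.weight (D.jumps 0 ω) 0 v = D.prior := fun v => by
    rw [weight, show Iic (0 : ℝ≥0) = {0} from Iic_bot]
    have h0 : D.θlaw.real {0} = D.prior := by
      rw [measureReal_def, θlaw, Measure.map_apply D.measurable_θ (measurableSet_singleton 0)]
      change (D.P₀ {ω | D.θ ω = 0}).toReal = _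
      rw [hD.θ_zero, ENNReal.toReal_ofReal hD.prior_nonneg]
    rw [integral_singleton, h0]
    simp [lik, jumps]
  simp_rw [h, integral_mul_const]
  simp
  ring

/-- The jump of the `k`-th statistic at the `n`-th arrival. -/
def jumpSize (D : DisorderData Ω d) (ω : Ω) (k n : ℕ) : ℝ :=
  D.stat (D.jumps n ω) (D.σ n ω) k * (D.r (D.Y n ω) - 1) +
    D.stat (D.jumps n ω) (D.σ n ω) (k + 1) * (1 / D.mu) * D.r (D.Y n ω)

/-- The drift of the odds-ratio processes along a scenario. -/
def pathDrift (D : DisorderData Ω d) (ω : Ω) (k : ℕ) (x : ℝ) : ℝ :=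
  D.lam * (D.m k + D.stat (D.history x.toNNReal ω) x.toNNReal k) -
    D.stat (D.history x.toNNReal ω) x.toNNReal (k + 1)

/-- The right endpoint may be an arrival, where the two drifts can differ; a single time does not
affect the integrals. -/
theorem pathDrift_ae_eq {n : ℕ} {s t : ℝ≥0} {ω : Ω} (h1 : ∀ k < n, D.σ k ω ≤ s)
    (h2 : t ≤ D.σ n ω) (k : ℕ) :
    ∀ᵐ x : ℝ, x ∈ Ioc (s : ℝ) t → D.drift (D.jumps n ω) k x = D.pathDrift ω k x := by
  have h0 : ∀ᵐ x : ℝ, x ≠ t := by simp [ae_iff]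
  filter_upwards [h0] with x hx hmem
  have hlt : x < t := lt_of_le_of_ne hmem.2 hx
  have hx0 : 0 ≤ x := s.2.trans hmem.1.le
  lift x to ℝ≥0 using hx0
  rw [drift, pathDrift, Real.toNNReal_coe, stat_history_eq (N_eq_of_mem
    (fun j hj => (h1 j hj).trans (by exact_mod_cast hmem.1.le))
    ((show x < t by exact_mod_cast hlt).trans_le h2))]

theorem IsModel.stat_integral_step (hD : D.IsModel) {n : ℕ} {s t : ℝ≥0} {ω : Ω}
    (h1 : ∀ k < n, D.σ k ω ≤ s) (hst : s ≤ t) (h2 : t ≤ D.σ n ω) (k : ℕ) :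
    IntervalIntegrable (D.pathDrift ω k) volume s t ∧
    D.stat (D.jumps n ω) t k = D.stat (D.jumps n ω) s k +
      ∫ x in (s : ℝ)..t, D.pathDrift ω k x := by
  have hst' : (s : ℝ) ≤ t := by exact_mod_cast hst
  have hae := pathDrift_ae_eq h1 h2 k
  constructor
  · refine (hD.intervalIntegrable_drift (D.jumps n ω) hst k).congr_ae ?_
    rw [uIoc_of_le hst']
    exact (ae_restrict_iff' measurableSet_Ioc).2 hae
  · rw [hD.stat_ode (e := D.jumps n ω) h1 hst k]
    congr 1
    refine intervalIntegral.integral_congr_ae ?_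
    rwa [uIoc_of_le hst']

/-- The endpoint `t = σ n` is allowed while only `n` jumps are counted. The statement then describes
the left limit at the next arrival, and this value is what the induction hands to the jump rule. -/
theorem IsModel.stat_integral_equation (hD : D.IsModel) (ω : Ω) (k n : ℕ) {t : ℝ≥0}
    (h1 : ∀ j < n, D.σ j ω ≤ t) (h2 : t ≤ D.σ n ω) :
    IntervalIntegrable (D.pathDrift ω k) volume 0 t ∧
    D.stat (D.jumps n ω) t k = D.stat (D.history 0 ω) 0 k +
      (∫ x in (0 : ℝ)..t, D.pathDrift ω k x) + ∑ j ∈ Finset.range n, D.jumpSize ω k j := by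
  induction n generalizing t with
  | zero =>
    have h := hD.stat_integral_step (s := 0) (n := 0) (by simp) zero_le h2 k
    rw [NNReal.coe_zero] at h
    refine ⟨h.1, ?_⟩
    rw [h.2, stat_history_eq (D.N_zero ω)]
    simp
  | succ n ih =>
    have hn : D.σ n ω ≤ t := h1 n (Nat.lt_succ_self n)
    have hprev := ih (t := D.σ n ω) (fun j hj => (D.σ_strictMono ω hj).le) le_rfl
    have hstep := hD.stat_integral_step (n := n + 1) (s := D.σ n ω)
      (fun j hj => (D.σ_strictMono ω).monotone (Nat.lt_succ_iff.1 hj)) hn h2 k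
    refine ⟨hprev.1.trans hstep.1, ?_⟩
    rw [hstep.2, hD.stat_jump, Finset.sum_range_succ,
      ← intervalIntegral.integral_add_adjacent_intervals hprev.1 hstep.1, jumpSize]
    linarith [hprev.2]

variable (D) in
theorem p_restrict (ω : Ω) (t : ℝ≥0) : (D.p ω).restrict (Ioc 0 t ×ˢ univ) =
    ∑ j ∈ Finset.range (D.N t ω), Measure.dirac (D.σ j ω, D.Y j ω) := by
  have hS : MeasurableSet (Ioc 0 t ×ˢ (univ : Set (Mark d))) :=
    measurableSet_Ioc.prod MeasurableSet.univ
  ext A hA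
  rw [Measure.restrict_apply hA, p, Measure.sum_apply _ (hA.inter hS), Measure.finsetSum_apply,
    tsum_eq_sum (s := Finset.range (D.N t ω))]
  · refine Finset.sum_congr rfl fun j hj => ?_
    have hj' : D.σ j ω ≤ t := (D.lt_N_iff j t ω).1 (Finset.mem_range.1 hj)
    rw [Measure.dirac_apply' _ (hA.inter hS), Measure.dirac_apply' _ hA]
    by_cases h : (D.σ j ω, D.Y j ω) ∈ A <;> simp [h, hj', D.σ_pos j ω]
  · intro j hj
    have hj' : ¬ D.σ j ω ≤ t := fun h => hj (Finset.mem_range.2 ((D.lt_N_iff j t ω).2 h))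
    rw [Measure.dirac_apply' _ (hA.inter hS)]
    simp [hj']

variable (D) in
-- On a bounded time interval `p` is a finite sum of Dirac measures.
theorem integrableOn_p (ω : Ω) (t : ℝ≥0) (f : ℝ≥0 × Mark d → ℝ) :
    IntegrableOn f (Ioc 0 t ×ˢ univ) (D.p ω) := by
  rw [IntegrableOn, p_restrict, integrable_finsetSum_measure]
  exact fun _ _ => integrable_dirac (by simp)

variable (D) in
theorem setIntegral_p (ω : Ω) (t : ℝ≥0) (f : ℝ≥0 × Mark d → ℝ) :
    ∫ q in Ioc 0 t ×ˢ univ, f q ∂(D.p ω) =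
      ∑ j ∈ Finset.range (D.N t ω), f (D.σ j ω, D.Y j ω) := by
  rw [p_restrict, integral_finsetSum_measure fun _ _ => integrable_dirac (by simp)]
  simp

theorem IsModel.solvesJumpEquation (hD : D.IsModel) (ω : Ω) :
    D.SolvesJumpEquation ω fun k t => D.stat (D.history t ω) t k where
  initial k := hD.stat_history_zero ω k
  drift_integrable k t := (hD.stat_integral_equation ω k (D.N t ω)
    (fun j hj => (D.lt_N_iff j t ω).1 hj)
    (not_lt.1 fun h => lt_irrefl _ ((D.lt_N_iff _ t ω).2 h.le))).1
  jump_integrable₁ k t := D.integrableOn_p ω t _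
  jump_integrable₂ k t := D.integrableOn_p ω t _
  equation k t := by
    rw [setIntegral_p, setIntegral_p, add_assoc _ (∑ j ∈ _, _), ← Finset.sum_add_distrib,
      stat_history_eq rfl, (hD.stat_integral_equation ω k (D.N t ω)
      (fun j hj => (D.lt_N_iff j t ω).1 hj)
      (not_lt.1 fun h => lt_irrefl _ ((D.lt_N_iff _ t ω).2 h.le))).2]
    simp only [hD.leftLim_stat, jumpSize]
    rfl

end JumpEquation

/-! ### Independence of the jumps after `s` from the observations up to `s`. -/

section IndependenceOfFuture

variable {Ω : Type*} [mΩ : MeasurableSpace Ω] {d : ℕ} (D : DisorderData Ω d)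

theorem isPiSystem_image2_inter {α : Type*} (a b : MeasurableSpace α) :
    IsPiSystem (image2 (· ∩ ·) {s | MeasurableSet[a] s} {s | MeasurableSet[b] s}) := by
  rintro _ ⟨s, hs, t, ht, rfl⟩ _ ⟨s', hs', t', ht', rfl⟩ _
  exact ⟨s ∩ s', MeasurableSet.inter hs hs', t ∩ t', MeasurableSet.inter ht ht',
    inter_inter_inter_comm s s' t t'⟩

theorem generateFrom_image2_inter {α : Type*} (a b : MeasurableSpace α) : a ⊔ b =
    MeasurableSpace.generateFrom
      (image2 (· ∩ ·) {s | MeasurableSet[a] s} {s | MeasurableSet[b] s}) := by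
  refine le_antisymm (sup_le (fun s hs => ?_) fun t ht => ?_) ?_
  · exact MeasurableSpace.measurableSet_generateFrom ⟨s, hs, univ, MeasurableSet.univ, by simp⟩
  · exact MeasurableSpace.measurableSet_generateFrom ⟨univ, MeasurableSet.univ, t, ht, by simp⟩
  · refine MeasurableSpace.generateFrom_le ?_
    rintro _ ⟨s, hs, t, ht, rfl⟩
    exact MeasurableSet.inter ((le_sup_left : a ≤ a ⊔ b) s hs) ((le_sup_right : b ≤ a ⊔ b) t ht)

/-- Intersections of one event from each σ-algebra form a generating π-system. The probability of
such an intersection is factored across `a` and `b`, then inside each, and regrouped. -/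
theorem indep_sup_sup {α : Type*} {m0 : MeasurableSpace α} {μ : Measure α}
    [IsProbabilityMeasure μ] {a₁ a₂ b₁ b₂ : MeasurableSpace α} (ha₁ : a₁ ≤ m0) (ha₂ : a₂ ≤ m0)
    (hb₁ : b₁ ≤ m0) (hb₂ : b₂ ≤ m0) (ha : Indep a₁ a₂ μ) (hb : Indep b₁ b₂ μ)
    (hab : Indep (a₁ ⊔ a₂) (b₁ ⊔ b₂) μ) : Indep (a₁ ⊔ b₁) (a₂ ⊔ b₂) μ := by
  refine IndepSets.indep (sup_le ha₁ hb₁) (sup_le ha₂ hb₂) (isPiSystem_image2_inter a₁ b₁)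
    (isPiSystem_image2_inter a₂ b₂) (generateFrom_image2_inter a₁ b₁)
    (generateFrom_image2_inter a₂ b₂) ?_
  rw [IndepSets_iff]
  rintro _ _ ⟨s, hs, t, ht, rfl⟩ ⟨s', hs', t', ht', rfl⟩
  have hl₁ : a₁ ≤ a₁ ⊔ a₂ := le_sup_left
  have hl₂ : a₂ ≤ a₁ ⊔ a₂ := le_sup_right
  have hr₁ : b₁ ≤ b₁ ⊔ b₂ := le_sup_left
  have hr₂ : b₂ ≤ b₁ ⊔ b₂ := le_sup_right
  rw [Indep_iff] at ha hb hab
  simp only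
  rw [inter_inter_inter_comm, hab _ _ (MeasurableSet.inter (hl₁ _ hs) (hl₂ _ hs'))
    (MeasurableSet.inter (hr₁ _ ht) (hr₂ _ ht')), ha _ _ hs hs', hb _ _ ht ht',
    hab _ _ (hl₁ _ hs) (hr₁ _ ht), hab _ _ (hl₂ _ hs') (hr₂ _ ht')]
  ring

theorem exists_monotone_finset_subset_range {α : Type*} [LinearOrder α] (K : Finset α)
    (hK : K.Nonempty) : ∃ t : ℕ → α, Monotone t ∧ (K : Set α) ⊆ range t := by
  have hpos : 0 < K.card := hK.card_pos
  -- The increasing enumeration of the finite set is continued by its last value.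
  refine ⟨fun k => K.orderEmbOfFin rfl ⟨min k (K.card - 1), by omega⟩, fun i j hij => ?_, ?_⟩
  · refine (K.orderEmbOfFin rfl).monotone ?_
    simp only [Fin.mk_le_mk]
    omega
  · intro x hx
    rw [← Finset.range_orderEmbOfFin K rfl] at hx
    obtain ⟨i, rfl⟩ := hx
    refine ⟨i, ?_⟩
    refine congrArg _ (Fin.ext ?_)
    simp only
    omega

theorem measurable_of_eval {α ι : Type*} {π : ι → Type*} {_ : MeasurableSpace α}
    [∀ i, MeasurableSpace (π i)] {f : α → ∀ i, π i} (h : ∀ i, Measurable fun a => f a i) :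
    Measurable f := measurable_pi_iff.2 h

/-- The sets whose trace on `T` lies in `M` form a σ-algebra, so generators suffice. -/
theorem measurableSet_inter_of_iSup_comap {α β ι : Type*} {M : MeasurableSpace α}
    [MeasurableSpace β] {T : Set α} (hT : MeasurableSet[M] T) {X : ι → α → β} {p : ι → Prop}
    (h : ∀ i, p i → ∀ B, MeasurableSet B → MeasurableSet[M] (X i ⁻¹' B ∩ T)) {E : Set α}
    (hE : MeasurableSet[⨆ i, ⨆ (_ : p i), MeasurableSpace.comap (X i) inferInstance] E) :
    MeasurableSet[M] (E ∩ T) := by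
  let C : MeasurableSpace α :=
    { MeasurableSet' := fun E => MeasurableSet[M] (E ∩ T)
      measurableSet_empty := by simp
      measurableSet_compl := fun E hE => by
        have : Eᶜ ∩ T = T \ (E ∩ T) := by
          rw [sdiff_inter_self_eq_sdiff, sdiff_eq, inter_comm]
        rw [this]
        exact MeasurableSet.diff hT hE
      measurableSet_iUnion := fun f hf => by
        rw [iUnion_inter]
        exact MeasurableSet.iUnion hf }
  have hle : (⨆ i, ⨆ (_ : p i), MeasurableSpace.comap (X i) inferInstance) ≤ C := by
    refine iSup₂_le fun i hi => ?_
    rintro _ ⟨B, hB, rfl⟩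
    exact h i hi B hB
  exact hle E hE

variable {D}

/-- It suffices to treat finitely many times. They are placed on one monotone grid; values up to `s`
are sums of increments before the grid index of `s`, and later increments are sums from that index
on. -/
theorem IsModel.indepFun_past_future (hD : D.IsModel) (s : ℝ≥0) :
    IndepFun (fun ω (u : Iic s) => D.N u ω) (fun ω (u : Ici s) => D.N u ω - D.N s ω) D.P₀ := by
  have := hD.prob_P₀
  refine IndepFun.process_indepFun_process (X := fun (u : Iic s) ω => D.N u ω)
    (Y := fun (u : Ici s) ω => D.N u ω - D.N s ω) (fun u => D.measurable_N u)
    (fun u => (D.measurable_N u).sub (D.measurable_N s)) fun I J => ?_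
  -- Time zero belongs to the grid because `N 0 = 0` makes `N u` itself a sum of increments.
  set K : Finset ℝ≥0 := insert 0 (insert s (I.image Subtype.val ∪ J.image Subtype.val)) with hK
  obtain ⟨t, ht, hKt⟩ := exists_monotone_finset_subset_range K ⟨0, by simp [hK]⟩
  have ht0 : t 0 = 0 := by
    obtain ⟨i, hi⟩ := hKt (show (0 : ℝ≥0) ∈ (K : Set ℝ≥0) by simp [hK])
    exact le_antisymm (hi ▸ ht (Nat.zero_le i)) zero_le
  obtain ⟨m, hm⟩ := hKt (show s ∈ (K : Set ℝ≥0) by simp [hK])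
  set X : ℕ → Ω → ℕ := fun i ω => D.N (t (i + 1)) ω - D.N (t i) ω with hX
  have hXm : ∀ i, Measurable (X i) := fun i => (D.measurable_N _).sub (D.measurable_N _)
  have hind := indep_iSup_of_disjoint (fun i => (hXm i).comap_le) (hD.N_indep.nat ht)
    (S := Iio m) (T := Ici m) (Iio_disjoint_Ici le_rfl)
  have hXS : ∀ (S : Set ℕ) (i : ℕ), i ∈ S →
      Measurable[⨆ j ∈ S, MeasurableSpace.comap (X j) inferInstance] (X i) := fun S i hi =>
    (comap_measurable (X i)).mono (le_iSup₂_of_le i hi le_rfl) le_rfl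
  have hsum : ∀ i j, i ≤ j → ∀ ω, ∑ k ∈ Finset.Ico i j, X k ω = D.N (t j) ω - D.N (t i) ω := by
    intro i j hij ω
    -- Subtraction of natural numbers is truncated; the sum telescopes because `N` is nondecreasing
    -- along the grid.
    have hmono : Monotone fun k => D.N (t k) ω := (D.N_mono ω).comp ht
    induction j, hij using Nat.le_induction with
    | base => simp
    | succ j hij ih =>
      rw [Finset.sum_Ico_succ_top hij, ih, hX]
      have h1 : D.N (t i) ω ≤ D.N (t j) ω := hmono hij
      have h2 : D.N (t j) ω ≤ D.N (t (j + 1)) ω := hmono (Nat.le_succ j)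
      simp only
      omega
  have hsumm : ∀ (S : Set ℕ) (i j : ℕ), Ico i j ⊆ S →
      Measurable[⨆ j ∈ S, MeasurableSpace.comap (X j) inferInstance]
        fun ω => ∑ k ∈ Finset.Ico i j, X k ω := fun S i j hS =>
    Finset.measurable_fun_sum _ fun k hk => hXS S k (hS (by simpa using hk))
  rw [IndepFun_iff_Indep]
  refine indep_of_indep_of_le_left (indep_of_indep_of_le_right hind ?_) ?_
  · rw [← measurable_iff_comap_le]
    refine measurable_of_eval fun u => ?_
    obtain ⟨i, hi⟩ := hKt (show (u : ℝ≥0) ∈ (K : Set ℝ≥0) by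
      have : ((u : Ici s) : ℝ≥0) ∈ J.image Subtype.val := Finset.mem_image_of_mem _ u.2
      simp only [hK, Finset.coe_insert, Finset.coe_union, mem_insert_iff, mem_union,
        Finset.mem_coe, this, or_true])
    have hsu : s ≤ u := u.1.2
    -- The grid may repeat values, so the index found for `u ≥ s` can lie below `m`; in that case `u
    -- = s` and `m` serves instead.
    have h1 : t (max m i) = u := by
      rcases le_total m i with h | h
      · rw [max_eq_right h, hi]
      · rw [max_eq_left h, hm]
        exact le_antisymm hsu (by rw [← hi, ← hm]; exact ht h)
    have h2 := hsumm (Ici m) m (max m i) fun k hk => hk.1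
    simp only [hsum m (max m i) (le_max_left _ _), h1, hm] at h2
    exact h2
  · rw [← measurable_iff_comap_le]
    refine measurable_of_eval fun u => ?_
    obtain ⟨i, hi⟩ := hKt (show (u : ℝ≥0) ∈ (K : Set ℝ≥0) by
      have : ((u : Iic s) : ℝ≥0) ∈ I.image Subtype.val := Finset.mem_image_of_mem _ u.2
      simp only [hK, Finset.coe_insert, Finset.coe_union, mem_insert_iff, mem_union,
        Finset.mem_coe, this, true_or, or_true])
    have hsu : u ≤ s := u.1.2
    have h1 : t (min m i) = u := by
      rcases le_total m i with h | h
      · rw [min_eq_left h, hm]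
        exact le_antisymm (by rw [← hi, ← hm]; exact ht h) hsu
      · rw [min_eq_right h, hi]
    have h2 := hsumm (Iio m) 0 (min m i) fun k hk => hk.2.trans_le (min_le_left _ _)
    simp only [hsum 0 (min m i) (Nat.zero_le _), h1, ht0, D.N_zero, Nat.sub_zero] at h2
    exact h2

/-- The jump data between `s` and `t`, if there are `n` arrivals up to time `s`. -/
def futureAt (D : DisorderData Ω d) (s t : ℝ≥0) (n : ℕ) (ω : Ω) : JumpData :=
  (D.N t ω - D.N s ω, fun k => D.σ (D.N s ω + k) ω, fun k => D.r (D.Y (n + k) ω))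

/-- The arrivals up to time `s`. -/
abbrev arrivalsPast (D : DisorderData Ω d) (s : ℝ≥0) : MeasurableSpace Ω :=
  MeasurableSpace.comap (fun ω (u : Iic s) => D.N u ω) inferInstance

/-- The arrivals after time `s`. -/
abbrev arrivalsFuture (D : DisorderData Ω d) (s : ℝ≥0) : MeasurableSpace Ω :=
  MeasurableSpace.comap (fun ω (u : Ici s) => D.N u ω - D.N s ω) inferInstance

/-- The claims with indices in `S`. -/
abbrev claims (D : DisorderData Ω d) (S : Set ℕ) : MeasurableSpace Ω :=
  ⨆ k ∈ S, MeasurableSpace.comap (D.Y k) inferInstance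

theorem measurable_arrivalsPast {u s : ℝ≥0} (h : u ≤ s) :
    Measurable[D.arrivalsPast s] (D.N u) :=
  (measurable_pi_apply (⟨u, h⟩ : Iic s)).comp (comap_measurable fun ω (u : Iic s) => D.N u ω)

theorem measurable_arrivalsFuture {u s : ℝ≥0} (h : s ≤ u) :
    Measurable[D.arrivalsFuture s] fun ω => D.N u ω - D.N s ω :=
  (measurable_pi_apply (⟨u, h⟩ : Ici s)).comp (comap_measurable
    (fun ω (u : Ici s) => D.N u ω - D.N s ω))

theorem measurable_claims {S : Set ℕ} {k : ℕ} (hk : k ∈ S) : Measurable[D.claims S] (D.Y k) :=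
  (comap_measurable (D.Y k)).mono (le_iSup₂_of_le k hk le_rfl) le_rfl

theorem arrivalsPast_le_comap (s : ℝ≥0) : D.arrivalsPast s ≤
    MeasurableSpace.comap (fun ω k => D.σ k ω) inferInstance := by
  rw [arrivalsPast, ← measurable_iff_comap_le]
  exact measurable_of_eval fun u => D.measurable_comap_N u

theorem arrivalsFuture_le_comap (s : ℝ≥0) : D.arrivalsFuture s ≤
    MeasurableSpace.comap (fun ω k => D.σ k ω) inferInstance := by
  rw [arrivalsFuture, ← measurable_iff_comap_le]
  exact measurable_of_eval fun u => (D.measurable_comap_N u).sub (D.measurable_comap_N s)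

theorem claims_le_comap (S : Set ℕ) : D.claims S ≤
    MeasurableSpace.comap (fun ω k => D.Y k ω) inferInstance :=
  iSup₂_le fun k _ => by
    rw [← measurable_iff_comap_le]
    exact D.measurable_comap_Y k

variable (D) in
theorem comap_σ_le : MeasurableSpace.comap (fun ω k => D.σ k ω) inferInstance ≤ mΩ :=
  (measurable_pi_iff.2 D.measurable_σ).comap_le

variable (D) in
theorem comap_Y_le : MeasurableSpace.comap (fun ω k => D.Y k ω) inferInstance ≤ mΩ :=
  (measurable_pi_iff.2 D.measurable_Y).comap_le

theorem IsModel.indep_σ_Y (hD : D.IsModel) :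
    Indep (MeasurableSpace.comap (fun ω k => D.σ k ω) inferInstance)
      (MeasurableSpace.comap (fun ω k => D.Y k ω) inferInstance) D.P₀ :=
  hD.indep.indep (i := 0) (j := 1) (by decide)

theorem IsModel.indep_past_future (hD : D.IsModel) (s : ℝ≥0) (n : ℕ) :
    Indep (D.arrivalsPast s ⊔ D.claims (Iio n)) (D.arrivalsFuture s ⊔ D.claims (Ici n)) D.P₀ := by
  have := hD.prob_P₀
  refine indep_sup_sup ((arrivalsPast_le_comap s).trans D.comap_σ_le)
    ((arrivalsFuture_le_comap s).trans D.comap_σ_le) ((claims_le_comap _).trans D.comap_Y_le)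
    ((claims_le_comap _).trans D.comap_Y_le) ?_ ?_ ?_
  · have := hD.indepFun_past_future s
    rwa [IndepFun_iff_Indep] at this
  · exact indep_iSup_of_disjoint (fun k => (D.measurable_Y k).comap_le) hD.Y_indep
      (Iio_disjoint_Ici le_rfl)
  · refine indep_of_indep_of_le_left (indep_of_indep_of_le_right hD.indep_σ_Y ?_) ?_
    · exact sup_le (claims_le_comap _) (claims_le_comap _)
    · exact sup_le (arrivalsPast_le_comap s) (arrivalsFuture_le_comap s)

/-- On `{N s = n}` the path of `X` up to `s` uses only the first `n` claims. This replaces the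
random split of the claim sequence at `N s` by a deterministic one. -/
theorem measurableSet_F_inter (s : ℝ≥0) (n : ℕ) {E : Set Ω} (hE : MeasurableSet[D.F s] E) :
    MeasurableSet[D.arrivalsPast s ⊔ D.claims (Iio n)] (E ∩ {ω | D.N s ω = n}) := by
  have hT : MeasurableSet[D.arrivalsPast s ⊔ D.claims (Iio n)] {ω | D.N s ω = n} :=
    (le_sup_left : _ ≤ D.arrivalsPast s ⊔ D.claims (Iio n)) _
      (measurable_arrivalsPast le_rfl (measurableSet_singleton n))
  refine measurableSet_inter_of_iSup_comap hT (X := D.X) (p := fun u => u ≤ s)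
    (fun u hu B hB => ?_) hE
  have hY : ∀ k, Measurable[D.arrivalsPast s ⊔ D.claims (Iio n)]
      fun ω => if k < n then D.Y k ω else 0 := fun k => by
    by_cases hk : k < n
    · simp only [hk, if_true]
      exact (measurable_claims (show k ∈ Iio n from hk)).mono le_sup_right le_rfl
    · simp only [hk, if_false]
      exact measurable_const
  have hX := Measurable.const_add (measurable_sum_range ((measurable_arrivalsPast hu).mono
    (le_sup_left : _ ≤ D.arrivalsPast s ⊔ D.claims (Iio n)) le_rfl) hY) D.x₀
  have : D.X u ⁻¹' B ∩ {ω | D.N s ω = n} = (fun ω => D.x₀ + ∑ k ∈ Finset.range (D.N u ω),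
      if k < n then D.Y k ω else 0) ⁻¹' B ∩ {ω | D.N s ω = n} := by
    ext ω
    simp only [mem_inter_iff, mem_preimage, and_congr_left_iff]
    intro (hω : D.N s ω = n)
    rw [X, Finset.sum_congr rfl fun k hk => ?_]
    have : D.N u ω ≤ D.N s ω := D.N_mono ω hu
    rw [if_pos ((Finset.mem_range.1 hk).trans_le (this.trans hω.le))]
  rw [this]
  exact MeasurableSet.inter (hX hB) hT

/-- For `u ≥ s`, the `k`-th arrival after `s` has occurred by time `u` exactly when the increment of
`N` over `(s, u]` exceeds `k`; indices start at zero. -/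
theorem measurable_σ_future (s : ℝ≥0) (k : ℕ) :
    Measurable[D.arrivalsFuture s] fun ω => D.σ (D.N s ω + k) ω := by
  refine measurable_of_Iic fun u => ?_
  rcases le_or_gt s u with hu | hu
  · have : (fun ω => D.σ (D.N s ω + k) ω) ⁻¹' Iic u =
        (fun ω => D.N u ω - D.N s ω) ⁻¹' Ioi k := by
      ext ω
      simp only [mem_preimage, mem_Iic, mem_Ioi]
      rw [← D.lt_N_iff]
      omega
    rw [this]
    exact measurable_arrivalsFuture hu measurableSet_Ioi
  · have : (fun ω => D.σ (D.N s ω + k) ω) ⁻¹' Iic u = ∅ := by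
      ext ω
      simp only [mem_preimage, mem_Iic, mem_empty_iff_false, iff_false]
      rw [← D.lt_N_iff]
      have : D.N u ω ≤ D.N s ω := D.N_mono ω hu.le
      omega
    rw [this]
    exact @MeasurableSet.empty Ω (D.arrivalsFuture s)

theorem measurable_futureAt {s t : ℝ≥0} (hst : s ≤ t) (n : ℕ) :
    Measurable[D.arrivalsFuture s ⊔ D.claims (Ici n)] (D.futureAt s t n) :=
  measurable_jumpData ((measurable_arrivalsFuture hst).mono le_sup_left le_rfl)
    (fun k => (measurable_σ_future s k).mono le_sup_left le_rfl)
    fun k => D.measurable_r.comp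
      ((measurable_claims (show n + k ∈ Ici n from Nat.le_add_right n k)).mono le_sup_right le_rfl)

/-- The claims are i.i.d. and independent of the arrivals, so shifting the claim sequence by `n`
does not change the joint law. -/
theorem IsModel.map_futureAt (hD : D.IsModel) {s t : ℝ≥0} (hst : s ≤ t) (n : ℕ) :
    D.P₀.map (D.futureAt s t n) = D.P₀.map (D.futureAt s t 0) := by
  have := hD.prob_P₀
  set A : Ω → ℕ × (ℕ → ℝ≥0) := fun ω => (D.N t ω - D.N s ω, fun k => D.σ (D.N s ω + k) ω) with hA
  have hAm : Measurable[D.arrivalsFuture s] A :=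
    (measurable_arrivalsFuture hst).prodMk (measurable_of_eval fun k => measurable_σ_future s k)
  have hAσ : Measurable[MeasurableSpace.comap (fun ω k => D.σ k ω) inferInstance] A :=
    hAm.mono (arrivalsFuture_le_comap s) le_rfl
  have hAm' : Measurable A := hAσ.mono D.comap_σ_le le_rfl
  have hYm : ∀ n, Measurable fun ω k => D.Y (n + k) ω := fun n =>
    measurable_of_eval fun k => D.measurable_Y (n + k)
  have hYlaw : ∀ n, D.P₀.map (fun ω k => D.Y (n + k) ω) = Measure.infinitePi fun _ => D.β₀ := by
    intro n
    have h := hD.Y_indep.precomp (g := fun k => n + k) (add_right_injective n)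
    have h2 := (iIndepFun_iff_map_fun_eq_infinitePi_map (fun k => D.measurable_Y (n + k))).1 h
    rw [h2]
    simp only [hD.Y_law]
  have hpair : ∀ n, D.P₀.map (fun ω => (A ω, fun k => D.Y (n + k) ω)) =
      (D.P₀.map A).prod (Measure.infinitePi fun _ => D.β₀) := fun n => by
    have hI : IndepFun A (fun ω k => D.Y (n + k) ω) D.P₀ := by
      rw [IndepFun_iff_Indep]
      refine indep_of_indep_of_le_left (indep_of_indep_of_le_right hD.indep_σ_Y ?_) hAσ.comap_le
      rw [← measurable_iff_comap_le]
      exact measurable_of_eval fun k => D.measurable_comap_Y (n + k)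
    rw [hI.map_prod_eq_prod_map_map hAm'.aemeasurable (hYm n).aemeasurable, hYlaw]
  have hg : Measurable fun q : (ℕ × (ℕ → ℝ≥0)) × (ℕ → Mark d) =>
      ((q.1.1, fun k => q.1.2 k, fun k => D.r (q.2 k)) : JumpData) :=
    measurable_jumpData (by fun_prop) (by fun_prop) fun k => D.measurable_r.comp (by fun_prop)
  have hmap : ∀ n, D.P₀.map (D.futureAt s t n) =
      ((D.P₀.map A).prod (Measure.infinitePi fun _ => D.β₀)).map fun q =>
        ((q.1.1, fun k => q.1.2 k, fun k => D.r (q.2 k)) : JumpData) := fun n => by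
    rw [← hpair n, Measure.map_map hg (hAm'.prodMk (hYm n))]
    rfl
  rw [hmap n, hmap 0]

theorem measurable_futureAt' {s t : ℝ≥0} (hst : s ≤ t) (n : ℕ) :
    Measurable (D.futureAt s t n) :=
  (measurable_futureAt hst n).mono (sup_le ((arrivalsFuture_le_comap s).trans D.comap_σ_le)
    ((claims_le_comap _).trans D.comap_Y_le)) le_rfl

theorem measurable_future {s t : ℝ≥0} (hst : s ≤ t) : Measurable (D.future s t) := by
  have h : Measurable fun q : ℕ × Ω => D.futureAt s t q.1 q.2 :=
    measurable_from_prod_countable_right fun n => measurable_futureAt' hst n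
  exact (h.comp (f := fun ω => (D.N s ω, ω)) ((D.measurable_N s).prodMk measurable_id) :
    Measurable fun ω => D.futureAt s t (D.N s ω) ω)

/-- The observations up to time `s` are independent of the jump data after `s`. -/
theorem IsModel.indep_F_future (hD : D.IsModel) {s t : ℝ≥0} (hst : s ≤ t) :
    Indep (D.F s) (MeasurableSpace.comap (D.future s t) inferInstance) D.P₀ := by
  have := hD.prob_P₀
  -- Decomposition over `N s = n`. On each piece the future uses the claims from index `n` on and is
  -- independent of the past; its law is the same for all `n`, so the sum factors.
  have key : ∀ E, MeasurableSet[D.F s] E → ∀ C, MeasurableSet C →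
      D.P₀ (E ∩ D.future s t ⁻¹' C) = D.P₀ E * D.P₀ (D.futureAt s t 0 ⁻¹' C) := by
    intro E hE C hC
    have hT : ∀ n, MeasurableSet {ω | D.N s ω = n} := fun n =>
      D.measurable_N s (measurableSet_singleton n)
    have hE' : MeasurableSet E := D.F.le s _ hE
    have hdecomp : ∀ B, MeasurableSet B → D.P₀ B = ∑' n, D.P₀ (B ∩ {ω | D.N s ω = n}) := by
      intro B hB
      rw [← measure_iUnion _ fun n => hB.inter (hT n), ← inter_iUnion]
      · congr 1
        ext ω
        simp
      · intro i j hij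
        refine Set.disjoint_left.2 fun ω hi hj => hij ?_
        exact hi.2.symm.trans hj.2
    rw [hdecomp _ (hE'.inter (measurable_future hst hC)), hdecomp E hE', ← ENNReal.tsum_mul_right]
    refine tsum_congr fun n => ?_
    have h1 : E ∩ D.future s t ⁻¹' C ∩ {ω | D.N s ω = n} =
        (E ∩ {ω | D.N s ω = n}) ∩ D.futureAt s t n ⁻¹' C := by
      ext ω
      simp only [mem_inter_iff, mem_preimage]
      constructor
      · rintro ⟨⟨h1, h2⟩, (h3 : D.N s ω = n)⟩
        refine ⟨⟨h1, h3⟩, ?_⟩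
        rwa [futureAt, ← h3]
      · rintro ⟨⟨h1, (h3 : D.N s ω = n)⟩, h2⟩
        refine ⟨⟨h1, ?_⟩, h3⟩
        rwa [futureAt, ← h3] at h2
    rw [h1, (Indep_iff _ _ _).1 (hD.indep_past_future s n) _ _ (measurableSet_F_inter s n hE)
      (measurable_futureAt hst n hC), ← Measure.map_apply (measurable_futureAt' hst n) hC,
      hD.map_futureAt hst, Measure.map_apply (measurable_futureAt' hst 0) hC]
  rw [Indep_iff]
  rintro E _ hE ⟨C, hC, rfl⟩
  have huniv := key univ MeasurableSet.univ C hC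
  rw [univ_inter, measure_univ, one_mul] at huniv
  rw [key E hE C hC, huniv]

end IndependenceOfFuture

/-! ### Moment determinacy under exponential moments. -/

section Moments

variable {Ω : Type*} [mΩ : MeasurableSpace Ω] {d : ℕ} (D : DisorderData Ω d)

/-- Exponential moments make both functions analytic on a vertical strip around the imaginary axis.
Their Taylor coefficients at zero are the moments, and the identity theorem applies on the connected
strip. -/
theorem complexMGF_eqOn_of_moments {α β : Type*} {_ : MeasurableSpace α} {_ : MeasurableSpace β}
    {μ : Measure α} {ν : Measure β} {X : α → ℝ} {Y : β → ℝ} {δ : ℝ} (hδ : 0 < δ)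
    (hμ : ∀ x ∈ Ioo (-δ) δ, Integrable (fun a => Real.exp (x * X a)) μ)
    (hν : ∀ x ∈ Ioo (-δ) δ, Integrable (fun a => Real.exp (x * Y a)) ν)
    (h : ∀ k : ℕ, ∫ a, X a ^ k ∂μ = ∫ a, Y a ^ k ∂ν) :
    EqOn (complexMGF X μ) (complexMGF Y ν) (Complex.re ⁻¹' Ioo (-δ) δ) := by
  have h1 : Ioo (-δ) δ ⊆ interior (integrableExpSet X μ) := interior_maximal hμ isOpen_Ioo
  have h2 : Ioo (-δ) δ ⊆ interior (integrableExpSet Y ν) := interior_maximal hν isOpen_Ioo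
  have h0 : (0 : ℝ) ∈ Ioo (-δ) δ := ⟨by linarith, hδ⟩
  have ha1 : AnalyticOnNhd ℂ (complexMGF X μ) (Complex.re ⁻¹' Ioo (-δ) δ) :=
    analyticOnNhd_complexMGF.mono fun z hz => h1 hz
  have ha2 : AnalyticOnNhd ℂ (complexMGF Y ν) (Complex.re ⁻¹' Ioo (-δ) δ) :=
    analyticOnNhd_complexMGF.mono fun z hz => h2 hz
  have hU : IsPreconnected (Complex.re ⁻¹' Ioo (-δ) δ) :=
    ((convex_Ioo (-δ) δ).linear_preimage Complex.reLm).isPreconnected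
  have hz : (0 : ℂ) ∈ Complex.re ⁻¹' Ioo (-δ) δ := by simpa using h0
  refine ha1.eqOn_of_preconnected_of_eventuallyEq ha2 hU hz ?_
  have e1 := (ha1 0 hz).hasFPowerSeriesAt
  have e2 := (ha2 0 hz).hasFPowerSeriesAt
  have hser : (fun n : ℕ => iteratedDeriv n (complexMGF X μ) 0 / (n.factorial : ℂ)) =
      fun n : ℕ => iteratedDeriv n (complexMGF Y ν) 0 / (n.factorial : ℂ) := by
    funext n
    rw [iteratedDeriv_complexMGF (by simpa using h1 h0), iteratedDeriv_complexMGF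
      (by simpa using h2 h0)]
    simp only [zero_mul, Complex.exp_zero, mul_one]
    have := congrArg (fun x : ℝ => (x : ℂ)) (h n)
    simp only [← integral_complex_ofReal, Complex.ofReal_pow] at this
    rw [this]
  rw [hser] at e1
  have e3 := e1.sub e2
  rw [sub_self] at e3
  exact e3.eventually_eq_zero.mono fun z hz => sub_eq_zero.1 hz

/-- The strip contains the imaginary axis, where the complex moment generating function is the
characteristic function. -/
theorem map_eq_of_moments {α β : Type*} {_ : MeasurableSpace α} {_ : MeasurableSpace β}
    {μ : Measure α} {ν : Measure β} [IsFiniteMeasure μ] [IsFiniteMeasure ν] {X : α → ℝ} {Y : β → ℝ}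
    (hX : AEMeasurable X μ) (hY : AEMeasurable Y ν) {δ : ℝ} (hδ : 0 < δ)
    (hμ : ∀ x ∈ Ioo (-δ) δ, Integrable (fun a => Real.exp (x * X a)) μ)
    (hν : ∀ x ∈ Ioo (-δ) δ, Integrable (fun a => Real.exp (x * Y a)) ν)
    (h : ∀ k : ℕ, ∫ a, X a ^ k ∂μ = ∫ a, Y a ^ k ∂ν) : μ.map X = ν.map Y := by
  have := Measure.isFiniteMeasure_map μ X
  have := Measure.isFiniteMeasure_map ν Y
  refine Measure.ext_of_charFun (funext fun t => ?_)
  rw [← complexMGF_mul_I hX, ← complexMGF_mul_I hY]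
  exact complexMGF_eqOn_of_moments hδ hμ hν h (by simpa using hδ)

/-- A nonnegative density with exponential moments is determined by its moments. -/
theorem ae_eq_of_moments {γ : Measure ℝ} [SigmaFinite γ] {f g : ℝ → ℝ} {c δ : ℝ} (hδ : 0 < δ)
    (hf : Measurable f) (hg : Measurable g) (hf0 : 0 ≤ᵐ[γ] f) (hg0 : 0 ≤ᵐ[γ] g)
    (hfi : ∀ x ∈ Ioo (-δ) δ, Integrable (fun v => f v * Real.exp (x * (v - c))) γ)
    (hgi : ∀ x ∈ Ioo (-δ) δ, Integrable (fun v => g v * Real.exp (x * (v - c))) γ)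
    (h : ∀ k : ℕ, ∫ v, (v - c) ^ k * f v ∂γ = ∫ v, (v - c) ^ k * g v ∂γ) : f =ᵐ[γ] g := by
  have h0 : (0 : ℝ) ∈ Ioo (-δ) δ := ⟨by linarith, hδ⟩
  have key : ∀ f : ℝ → ℝ, Measurable f → 0 ≤ᵐ[γ] f →
      (∀ x ∈ Ioo (-δ) δ, Integrable (fun v => f v * Real.exp (x * (v - c))) γ) →
      IsFiniteMeasure (γ.withDensity fun v => ENNReal.ofReal (f v)) ∧
      (∀ x ∈ Ioo (-δ) δ, Integrable (fun v => Real.exp (x * (v - c)))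
        (γ.withDensity fun v => ENNReal.ofReal (f v))) ∧
      ∀ k : ℕ, ∫ v, (v - c) ^ k ∂(γ.withDensity fun v => ENNReal.ofReal (f v)) =
        ∫ v, (v - c) ^ k * f v ∂γ := by
    intro f hf hf0 hfi
    have hm : Measurable fun v => ENNReal.ofReal (f v) := hf.ennreal_ofReal
    refine ⟨?_, fun x hx => ?_, fun k => ?_⟩
    · exact isFiniteMeasure_withDensity_ofReal (by simpa using (hfi 0 h0).2)
    · rw [integrable_withDensity_iff_integrable_smul' hm (ae_of_all _ fun _ => ENNReal.ofReal_lt_top)]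
      refine (hfi x hx).congr ?_
      filter_upwards [hf0] with v hv
      simp [ENNReal.toReal_ofReal hv]
    · rw [integral_withDensity_eq_integral_toReal_smul hm (ae_of_all _ fun _ => ENNReal.ofReal_lt_top)]
      refine integral_congr_ae ?_
      filter_upwards [hf0] with v hv
      simp [ENNReal.toReal_ofReal hv, mul_comm]
  obtain ⟨i1, f2, f3⟩ := key f hf hf0 hfi
  obtain ⟨i2, g2, g3⟩ := key g hg hg0 hgi
  have hX : Measurable fun v : ℝ => v - c := by fun_prop
  have hmap := map_eq_of_moments hX.aemeasurable hX.aemeasurable hδ f2 g2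
    fun k => by rw [f3, g3, h]
  have hmeas : (γ.withDensity fun v => ENNReal.ofReal (f v)) =
      γ.withDensity fun v => ENNReal.ofReal (g v) :=
    (MeasurableEquiv.subRight c).map_measurableEquiv_injective hmap
  have := (withDensity_eq_iff_of_sigmaFinite hf.ennreal_ofReal.aemeasurable
    hg.ennreal_ofReal.aemeasurable).1 hmeas
  filter_upwards [this, hf0, hg0] with v hv h1 h2
  exact (ENNReal.ofReal_eq_ofReal_iff h1 h2).1 hv

end Moments

/-! ### The statistics determine the conditional law of the post-disorder rate. -/

section Determinacy

variable {Ω : Type*} [mΩ : MeasurableSpace Ω] {d : ℕ} (D : DisorderData Ω d)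

variable {D}

/-- The jump data of a path with all its arrivals strictly before `s`. -/
def regular (s : ℝ≥0) : Set JumpData := {e | ∀ k < e.1, e.2.1 k < s ∧ 0 ≤ e.2.2 k}

theorem measurableSet_regular (s : ℝ≥0) : MeasurableSet (regular s) := by
  have : regular s = ⋂ k : ℕ, ({e : JumpData | k < e.1}ᶜ ∪
      ({e : JumpData | e.2.1 k < s} ∩ {e : JumpData | 0 ≤ e.2.2 k})) := by
    ext e
    simp only [regular, mem_ofPred_eq, mem_iInter, mem_union, mem_compl_iff, mem_inter_iff]
    exact forall_congr' fun k => imp_iff_not_or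
  rw [this]
  refine MeasurableSet.iInter fun k => MeasurableSet.union (MeasurableSet.compl ?_)
    (MeasurableSet.inter ?_ ?_)
  · exact measurableSet_lt measurable_const measurable_fst
  · exact measurableSet_lt (by fun_prop) measurable_const
  · exact measurableSet_le measurable_const (by fun_prop)

theorem exists_lt_of_regular {s : ℝ≥0} (hs : 0 < s) {e : JumpData} (he : e ∈ regular s) :
    ∃ u < s, ∀ k < e.1, e.2.1 k ≤ u :=
  ⟨(Finset.range e.1).sup e.2.1, (Finset.sup_lt_iff (by simpa using hs)).2 fun k hk =>
    (he k (Finset.mem_range.1 hk)).1, fun k hk => Finset.le_sup (Finset.mem_range.2 hk)⟩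

theorem IsModel.weight_nonneg (hD : D.IsModel) {s : ℝ≥0} {e : JumpData} (he : e ∈ regular s)
    (t : ℝ≥0) {v : ℝ} (hv : 0 < v) : 0 ≤ D.weight e t v :=
  integral_nonneg fun u => hD.lik_nonneg (fun k hk => (he k hk).2) u t hv

theorem IsModel.weight_eq_add (hD : D.IsModel) {u s : ℝ≥0} (hus : u ≤ s) {e : JumpData}
    (he : ∀ k < e.1, e.2.1 k ≤ u) (v : ℝ) :
    D.weight e s v = Real.exp (-(v - D.mu) * ((s : ℝ) - u)) * D.weight e u v +
      ∫ x in Ioc u s, Real.exp (-(v - D.mu) * ((s : ℝ) - x)) ∂D.θlaw := by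
  have hi := hD.integrableOn_lik e s v
  rw [weight, ← Iic_union_Ioc_eq_Iic hus, setIntegral_union (Iic_disjoint_Ioc le_rfl)
    measurableSet_Ioc (hi.mono_set (Iic_subset_Iic.2 hus)) (hi.mono_set Ioc_subset_Iic_self),
    weight, ← integral_const_mul]
  congr 1
  · exact setIntegral_congr_fun measurableSet_Iic fun x _ => lik_of_le v
  · exact setIntegral_congr_fun measurableSet_Ioc fun x hx =>
      lik_of_forall_le (fun k hk => (he k hk).trans hx.1.le) v

/-- For `x < δ` and `v > 0` the exponentials combine to `e^{-(δ-x)(v-μ)} ≤ e^{(δ-x)μ}`, and the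
weight grows only polynomially in `v`. -/
theorem IsModel.integrable_exp_mul_weight (hD : D.IsModel) (e : JumpData) (u : ℝ≥0) {δ x : ℝ}
    (hx : x < δ) : Integrable (fun v => Real.exp (-(v - D.mu) * δ) * D.weight e u v *
      Real.exp (x * (v - D.mu))) D.γ := by
  have hw := hD.measurable_weight_right e u
  have h := hD.integrable_of_abs_le (f := fun v => Real.exp (-(v - D.mu) * δ) * D.weight e u v *
    Real.exp (x * (v - D.mu))) (C := Real.exp ((δ - x) * D.mu) * (Real.exp (D.mu * u) *
      D.markBound e)) (n := e.1) (by fun_prop) (fun v hv => ?_) 0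
  · simpa using h
  rw [mul_right_comm, ← Real.exp_add, abs_mul, Real.abs_exp, mul_assoc]
  refine mul_le_mul (Real.exp_le_exp.2 ?_) (hD.abs_weight_le e le_rfl hv) (abs_nonneg _)
    (Real.exp_pos _).le
  nlinarith

/-- The odds-ratio statistics determine the conditional law of the post-disorder rate. -/
theorem IsModel.weight_ae_eq_of_stat_eq (hD : D.IsModel) {s : ℝ≥0} {e e' : JumpData}
    (he : e ∈ regular s) (he' : e' ∈ regular s) (h : D.stat e s = D.stat e' s) :
    D.weight e s =ᵐ[D.γ] D.weight e' s := by
  have := hD.prob_γ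
  rcases eq_zero_or_pos s with rfl | hs
  -- At time zero there is no room for an arrival-free interval, but regular data contain no arrival
  -- at all and the weights coincide.
  · have h0 : ∀ {e : JumpData}, e ∈ regular 0 → e.1 = 0 := fun {e} he => by
      by_contra h0
      exact not_lt_zero (he 0 (Nat.pos_of_ne_zero h0)).1
    refine ae_of_all _ fun v => ?_
    simp only [weight, lik, h0 he, h0 he']
    simp
  obtain ⟨u₁, hu₁, h₁⟩ := exists_lt_of_regular hs he
  obtain ⟨u₂, hu₂, h₂⟩ := exists_lt_of_regular hs he'
  -- Neither data set has an arrival in `(u, s]`, so the same exponential smoothing acts on both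
  -- weights.
  set u := max u₁ u₂ with hu
  have hus : u < s := max_lt hu₁ hu₂
  have hδ : (0 : ℝ) < (s : ℝ) - u := sub_pos.2 (by exact_mod_cast hus)
  have e1 := hD.weight_eq_add hus.le fun k hk => (h₁ k hk).trans (le_max_left u₁ u₂)
  have e2 := hD.weight_eq_add hus.le fun k hk => (h₂ k hk).trans (le_max_right u₁ u₂)
  have hR : (fun v => Real.exp (-(v - D.mu) * ((s : ℝ) - u)) * D.weight e u v) =ᵐ[D.γ]
      fun v => Real.exp (-(v - D.mu) * ((s : ℝ) - u)) * D.weight e' u v := by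
    have hm : ∀ e, Measurable fun v => Real.exp (-(v - D.mu) * ((s : ℝ) - u)) * D.weight e u v :=
      fun e => by
        have := hD.measurable_weight_right e u
        fun_prop
    refine ae_eq_of_moments (c := D.mu) hδ (hm e) (hm e') ?_ ?_
      (fun x hx => hD.integrable_exp_mul_weight e u hx.2)
      (fun x hx => hD.integrable_exp_mul_weight e' u hx.2) fun k => ?_
    · filter_upwards [hD.ae_γ_pos] with v hv
      exact mul_nonneg (Real.exp_pos _).le (hD.weight_nonneg he u hv)
    · filter_upwards [hD.ae_γ_pos] with v hv
      exact mul_nonneg (Real.exp_pos _).le (hD.weight_nonneg he' u hv)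
    · have hi : ∀ e, Integrable (fun v => (v - D.mu) ^ k *
          (Real.exp (-(v - D.mu) * ((s : ℝ) - u)) * D.weight e u v)) D.γ := by
        intro e
        refine hD.integrable_of_abs_le (hm e) (C := Real.exp (((s : ℝ) - u) * D.mu) *
          (Real.exp (D.mu * u) * D.markBound e)) (n := e.1) (fun v hv => ?_) k
        rw [abs_mul, Real.abs_exp, mul_assoc]
        refine mul_le_mul (Real.exp_le_exp.2 ?_) (hD.abs_weight_le e le_rfl hv) (abs_nonneg _)
          (Real.exp_pos _).le
        nlinarith
      have hk := congrFun h k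
      have hpos := hD.one_sub_prior_pos
      have hc : Real.exp (D.lam * s) / (1 - D.prior) ≠ 0 := by positivity
      have hk' := mul_left_cancel₀ hc hk
      -- Disorders in `(u, s]` contribute the same term for both data sets. Subtracting its moments
      -- leaves equal moments for the smoothed weights at `u`.
      have hsub : ∀ e, (∀ v, D.weight e s v = Real.exp (-(v - D.mu) * ((s : ℝ) - u)) *
          D.weight e u v + ∫ x in Ioc u s, Real.exp (-(v - D.mu) * ((s : ℝ) - x)) ∂D.θlaw) →
          Integrable (fun v => (v - D.mu) ^ k *
            ∫ x in Ioc u s, Real.exp (-(v - D.mu) * ((s : ℝ) - x)) ∂D.θlaw) D.γ ∧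
          ∫ v, (v - D.mu) ^ k * (Real.exp (-(v - D.mu) * ((s : ℝ) - u)) * D.weight e u v) ∂D.γ =
          (∫ v, (v - D.mu) ^ k * D.weight e s v ∂D.γ) - ∫ v, (v - D.mu) ^ k *
            (∫ x in Ioc u s, Real.exp (-(v - D.mu) * ((s : ℝ) - x)) ∂D.θlaw) ∂D.γ := by
        intro e he
        have hK : Integrable (fun v => (v - D.mu) ^ k *
            ∫ x in Ioc u s, Real.exp (-(v - D.mu) * ((s : ℝ) - x)) ∂D.θlaw) D.γ := by
          refine ((hD.integrable_weight e s k).sub (hi e)).congr (ae_of_all _ fun v => ?_)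
          simp only [Pi.sub_apply, he v]
          ring
        refine ⟨hK, ?_⟩
        rw [← integral_sub (hD.integrable_weight e s k) hK]
        refine integral_congr_ae (ae_of_all _ fun v => ?_)
        simp only [he v]
        ring
      rw [(hsub e e1).2, (hsub e' e2).2, hk']
  filter_upwards [hR] with v hv
  rw [e1, e2, hv]

/-- An arrival at `s` is an arrival in `(u, s]` for every `u < s`, and the Poisson probability `1 -
e^{-μ(s-u)}` of the latter tends to zero. -/
theorem IsModel.ae_arrival_ne (hD : D.IsModel) (s : ℝ≥0) : ∀ᵐ ω ∂D.P₀, ∀ k, D.σ k ω ≠ s := by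
  have := hD.prob_P₀
  rcases eq_zero_or_pos s with rfl | hs
  · exact ae_of_all _ fun ω k => (D.σ_pos k ω).ne'
  have hle : ∀ u < s, D.P₀ {ω | ¬ ∀ k, D.σ k ω ≠ s} ≤
      ENNReal.ofReal (1 - Real.exp (-(D.mu * ((s : ℝ) - u)))) := by
    intro u hu
    have hm : Measurable fun ω => D.N s ω - D.N u ω := (D.measurable_N s).sub (D.measurable_N u)
    have hset : {ω | ¬ ∀ k, D.σ k ω ≠ s} ⊆ ((fun ω => D.N s ω - D.N u ω) ⁻¹' {0})ᶜ := by
      intro ω hω h0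
      simp only [mem_ofPred_eq, not_forall, not_not] at hω
      obtain ⟨k, hk⟩ := hω
      have h1 : k < D.N s ω := (D.lt_N_iff k s ω).2 hk.le
      have h2 : ¬ k < D.N u ω := fun h => absurd ((D.lt_N_iff k u ω).1 h) (by rw [hk]; exact not_le.2 hu)
      have h3 : D.N s ω - D.N u ω = 0 := h0
      omega
    refine (measure_mono hset).trans ?_
    have hsing := hm (measurableSet_singleton 0)
    rw [prob_compl_eq_one_sub hsing, ← Measure.map_apply hm (measurableSet_singleton 0),
      hD.N_law u s hu.le, poissonMeasure_singleton, ENNReal.ofReal_sub _ (Real.exp_pos _).le,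
      ENNReal.ofReal_one]
    simp [NNReal.coe_sub hu.le, Real.coe_toNNReal _ hD.mu_pos.le]
  have hlim : Tendsto (fun u : ℝ≥0 => ENNReal.ofReal (1 - Real.exp (-(D.mu * ((s : ℝ) - u)))))
      (𝓝[<] s) (𝓝 0) := by
    have hc : Continuous fun u : ℝ≥0 => ENNReal.ofReal (1 - Real.exp (-(D.mu * ((s : ℝ) - u)))) :=
      ENNReal.continuous_ofReal.comp (by fun_prop)
    have := (hc.tendsto s).mono_left (nhdsWithin_le_nhds (s := Iio s))
    simpa using this
  have := nhdsLT_neBot hs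
  exact le_antisymm (ge_of_tendsto hlim (eventually_mem_nhdsWithin.mono hle)) bot_le

theorem IsModel.ae_history_regular (hD : D.IsModel) (s : ℝ≥0) :
    ∀ᵐ ω ∂D.P₀, D.history s ω ∈ regular s := by
  filter_upwards [hD.ae_arrival_ne s] with ω hω k hk
  exact ⟨(D.history_σ hk).symm ▸ lt_of_le_of_ne ((D.lt_N_iff k s ω).1 hk) (hω k),
    (D.history_r hk).symm ▸ D.r_nonneg _⟩

end Determinacy

/-! ### The Markov property under both measures. -/

section MarkovProperty

variable {Ω : Type*} [mΩ : MeasurableSpace Ω] {d : ℕ} (D : DisorderData Ω d)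

/-- A function on a standard Borel space that factors through a measurable map on a measurable set
does so measurably (Blackwell). -/
theorem exists_measurable_factor {X Z : Type*} [MeasurableSpace X] [StandardBorelSpace X]
    [mZ : MeasurableSpace Z] [MeasurableSpace.CountablySeparated Z] {S : Set X}
    (hS : MeasurableSet S)
    {f : X → Z} (hf : Measurable f) {h : X → ℝ} (hh : Measurable h)
    (heq : ∀ x ∈ S, ∀ y ∈ S, f x = f y → h x = h y) :
    ∃ H : Z → ℝ, Measurable H ∧ ∀ x ∈ S, h x = H (f x) := by
  have := hS.standardBorel
  have hf' : Measurable fun x : S => f x := hf.comp measurable_subtype_coe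
  have hh' : Measurable fun x : S => h x := hh.comp measurable_subtype_coe
  have hfac : Function.FactorsThrough (fun x : S => h x) fun x : S => f x := fun x y hxy =>
    heq x x.2 y y.2 hxy
  obtain ⟨g, hg⟩ : ∃ g : Z → ℝ, (fun x : S => h x) = g ∘ fun x : S => f x :=
    ⟨Function.extend (fun x : S => f x) (fun x : S => h x) 0, funext fun x =>
      (hfac.extend_apply 0 x).symm⟩
  have : MeasurableSpace.CountablySeparated (range fun x : S => f x) :=
    MeasurableSpace.CountablySeparated.subtype_iff.2
      (MeasurableSpace.CountablySeparated.countably_separated.mono (fun _ h => h)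
        (subset_univ _))
  -- Blackwell's step: on a standard Borel domain, measurability of the composite gives
  -- measurability of `g` on the range of `f`. Consequently `h` is measurable for the σ-algebra
  -- generated by `f`.
  have hr : Measurable ((range fun x : S => f x).domRestrict g) :=
    (hf'.measurable_comp_iff_restrict).1 (hg ▸ hh')
  have hc : Measurable[mZ.comap fun x : S => f x] fun x : S => h x := by
    intro B hB
    obtain ⟨E, hE, hE'⟩ := hr hB
    refine ⟨E, hE, ?_⟩
    ext x
    have := Set.ext_iff.1 hE' ⟨f x, mem_range_self x⟩
    have hx := congrFun hg x
    simp only [Function.comp_apply] at hx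
    simpa [hx] using this
  obtain ⟨H, hH, hHf⟩ := hc.exists_eq_measurable_comp
  exact ⟨H, hH, fun x hx => congrFun hHf ⟨x, hx⟩⟩

variable {D}

/-- The odds-ratio statistics at time `t` in terms of the history up to time `s` and the jump data
between `s` and `t`. -/
def transition (D : DisorderData Ω d) (s t : ℝ≥0) (e e' : JumpData) (k : ℕ) : ℝ :=
  Real.exp (D.lam * t) / (1 - D.prior) * ∫ v, (v - D.mu) ^ k *
    (D.lik e' s t v * D.weight e s v + ∫ u in Ioc s t, D.lik e' u t v ∂D.θlaw) ∂D.γ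

theorem IsModel.stat_history_eq_transition (hD : D.IsModel) {s t : ℝ≥0} (hst : s ≤ t) (ω : Ω) :
    D.stat (D.history t ω) t = D.transition s t (D.history s ω) (D.future s t ω) := by
  funext k
  simp only [stat, transition, hD.weight_history hst]

theorem IsModel.measurable_transition (hD : D.IsModel) (s t : ℝ≥0) :
    Measurable fun q : JumpData × JumpData => D.transition s t q.1 q.2 := by
  have := hD.isProbabilityMeasure_θlaw
  have := hD.prob_γ
  refine measurable_of_eval fun k => Measurable.mul (by fun_prop) ?_
  have h : Measurable fun q : (JumpData × JumpData) × ℝ => (q.2 - D.mu) ^ k *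
      (D.lik q.1.2 s t q.2 * D.weight q.1.1 s q.2 +
        ∫ u in Ioc s t, D.lik q.1.2 u t q.2 ∂D.θlaw) := by
    refine Measurable.mul (by fun_prop) (Measurable.add (Measurable.mul
      (Measurable.lik D (by fun_prop) (by fun_prop) (by fun_prop) (by fun_prop))
      (measurable_weight.comp (f := fun q : (JumpData × JumpData) × ℝ => (q.1.1, s, q.2))
        (by fun_prop))) ?_)
    have h' : Measurable fun q : ((JumpData × JumpData) × ℝ) × ℝ≥0 => D.lik q.1.1.2 q.2 t q.1.2 :=
      Measurable.lik D (by fun_prop) (by fun_prop) (by fun_prop) (by fun_prop)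
    exact (h'.stronglyMeasurable.integral_prod_right' (ν := D.θlaw.restrict (Ioc s t))).measurable
  exact (h.stronglyMeasurable.integral_prod_right' (ν := D.γ)).measurable

/-- Integrating out the independent future leaves a function of the history at `s` that sees it only
through its weight up to `γ`-null sets, hence only through the statistic. Integrability of `g` along
the path is the condition imposed, rather than boundedness, because the argument under `P` inserts
an unbounded density. -/
theorem IsModel.exists_condExp_P₀ (hD : D.IsModel) {s t : ℝ≥0} (hst : s ≤ t) {g : (ℕ → ℝ) → ℝ}
    (hg : Measurable g) (hint : Integrable (fun ω => g (D.stat (D.history t ω) t)) D.P₀) :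
    ∃ H : (ℕ → ℝ) → ℝ, Measurable H ∧
      D.P₀[fun ω => g (D.stat (D.history t ω) t) | D.F s] =ᵐ[D.P₀]
        fun ω => H (D.stat (D.history s ω) s) := by
  have := hD.prob_P₀
  have hf : Measurable (Function.uncurry fun e e' => g (D.transition s t e e')) :=
    hg.comp (hD.measurable_transition s t)
  have hfun : (fun ω => g (D.stat (D.history t ω) t)) =
      fun ω => g (D.transition s t (D.history s ω) (D.future s t ω)) :=
    funext fun ω => by rw [hD.stat_history_eq_transition hst]
  rw [hfun] at hint ⊢
  have hce := condExp_comp_of_indep (D.F.le s) (D.measurable_F_history s) (measurable_future hst)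
    (hD.indep_F_future hst) hf hint
  have := Measure.isProbabilityMeasure_map (measurable_future (D := D) hst).aemeasurable (μ := D.P₀)
  have hh : Measurable fun e => ∫ x, g (D.transition s t e x) ∂(D.P₀.map (D.future s t)) :=
    hf.stronglyMeasurable.integral_prod_right.measurable
  obtain ⟨H, hH, hHe⟩ := exists_measurable_factor (measurableSet_regular s)
    (hD.measurable_stat_left s) hh fun e he e' he' hee => by
      refine integral_congr_ae (ae_of_all _ fun x => congrArg g (funext fun k => ?_))
      refine congrArg _ (integral_congr_ae ?_)
      filter_upwards [hD.weight_ae_eq_of_stat_eq he he' hee] with v hv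
      rw [hv]
  refine ⟨H, hH, hce.trans ?_⟩
  filter_upwards [hD.ae_history_regular s] with ω hω
  exact hHe _ hω

/-- Bayes' rule for conditional expectations: multiply by the density at `t`, condition under `P₀`,
divide by the density at `s`. Both densities are functions of the statistic at their own time. -/
theorem IsModel.exists_condExp_P (hD : D.IsModel) {s t : ℝ≥0} (hst : s ≤ t) {g : (ℕ → ℝ) → ℝ}
    (hg : Measurable g) {C : ℝ} (hC : ∀ x, |g x| ≤ C) :
    ∃ H : (ℕ → ℝ) → ℝ, Measurable H ∧
      D.P[fun ω => g (D.stat (D.history t ω) t) | D.F s] =ᵐ[D.P]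
        fun ω => H (D.stat (D.history s ω) s) := by
  have := hD.prob_P₀
  have := hD.prob_P
  have hF : ∀ t, Measurable[D.F t] fun ω => D.stat (D.history t ω) t := fun t =>
    (hD.measurable_stat_left t).comp (D.measurable_F_history t)
  have hgt : Measurable[D.F t] fun ω => g (D.stat (D.history t ω) t) := hg.comp (hF t)
  have hiP : Integrable (fun ω => g (D.stat (D.history t ω) t)) D.P :=
    Integrable.of_bound (hgt.mono (D.F.le t) le_rfl).aestronglyMeasurable C
      (ae_of_all _ fun ω => hC _)
  have hiP₀ : Integrable (fun ω => g (D.stat (D.history t ω) t) *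
      (D.surv t * (1 + D.stat (D.history t ω) t 0))) D.P₀ :=
    (hD.integrable_obsDensity t).bdd_mul (hgt.mono (D.F.le t) le_rfl).aestronglyMeasurable
      (ae_of_all _ fun ω => hC _)
  have hev : Measurable fun x : ℕ → ℝ => D.surv t * (1 + x 0) := by fun_prop
  have hev' : Measurable fun x : ℕ → ℝ => D.surv s * (1 + x 0) := by fun_prop
  obtain ⟨H, hH, hHe⟩ := hD.exists_condExp_P₀ hst (g := fun x => g x * (D.surv t * (1 + x 0)))
    (hg.mul hev) hiP₀
  refine ⟨fun x => H x / (D.surv s * (1 + x 0)), hH.div hev', ?_⟩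
  have hHs : Measurable[D.F s] fun ω => H (D.stat (D.history s ω) s) /
      (D.surv s * (1 + D.stat (D.history s ω) s 0)) := (hH.div hev').comp (hF s)
  have hHi : Integrable (fun ω => H (D.stat (D.history s ω) s)) D.P₀ :=
    integrable_condExp.congr hHe
  have hmul : ∀ (A : Set Ω) ω, D.obsDensity s ω * A.indicator (fun ω => H (D.stat (D.history s ω) s) /
      (D.surv s * (1 + D.stat (D.history s ω) s 0))) ω =
      A.indicator (fun ω => H (D.stat (D.history s ω) s)) ω := by
    intro A ω
    have := (hD.obsDensity_pos s ω).ne'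
    by_cases hω : ω ∈ A
    · simp only [hω, indicator_of_mem]
      exact mul_div_cancel₀ _ this
    · simp [hω]
  have key : ∀ A, MeasurableSet[D.F s] A →
      Integrable (A.indicator fun ω => H (D.stat (D.history s ω) s) /
        (D.surv s * (1 + D.stat (D.history s ω) s 0))) D.P ∧
      ∫ ω in A, H (D.stat (D.history s ω) s) / (D.surv s * (1 + D.stat (D.history s ω) s 0)) ∂D.P =
        ∫ ω in A, g (D.stat (D.history t ω) t) ∂D.P := by
    intro A hA
    have hA0 : MeasurableSet A := D.F.le s A hA
    have hAt : MeasurableSet[D.F t] A := D.F.mono hst A hA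
    obtain ⟨h1, h2⟩ := hD.integral_P_eq (hHs.indicator hA)
    obtain ⟨h3, h4⟩ := hD.integral_P_eq (hgt.indicator hAt)
    constructor
    · refine h1.2 ?_
      refine (hHi.indicator hA0).congr (ae_of_all _ fun ω => ?_)
      exact (hmul A ω).symm
    · rw [← integral_indicator hA0, ← integral_indicator hA0, h2, h4,
        integral_congr_ae (ae_of_all _ (hmul A)), integral_indicator hA0,
        ← setIntegral_congr_ae hA0 (hHe.mono fun ω h _ => h), setIntegral_condExp (D.F.le s) hiP₀ hA,
        ← integral_indicator hA0]
      refine integral_congr_ae (ae_of_all _ fun ω => ?_)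
      by_cases hω : ω ∈ A
      · simp only [hω, indicator_of_mem, obsDensity]
        ring
      · simp [hω]
  symm
  refine ae_eq_condExp_of_forall_setIntegral_eq (D.F.le s) hiP (fun A hA _ => ?_)
    (fun A hA _ => (key A hA).2) hHs.aestronglyMeasurable
  exact (integrable_indicator_iff (D.F.le s A hA)).1 (key A hA).1

/-- A version that is a function of `φ` is already measurable for the smaller σ-algebra; the tower
property identifies the two conditional expectations. -/
theorem condExp_eq_condExp_comap {α E : Type*} [mE : MeasurableSpace E] {m m0 : MeasurableSpace α}
    (hm : m ≤ m0) {Q : Measure α} [IsFiniteMeasure Q] {f : α → ℝ} {φ : α → E}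
    (hφ : Measurable[m] φ) {H : E → ℝ} (hH : Measurable H)
    (h : Q[f | m] =ᵐ[Q] fun ω => H (φ ω)) : Q[f | m] =ᵐ[Q] Q[f | mE.comap φ] := by
  have hle : mE.comap φ ≤ m := hφ.comap_le
  have hsm : StronglyMeasurable[mE.comap φ] fun ω => H (φ ω) :=
    (hH.comp (comap_measurable φ)).stronglyMeasurable
  have h1 : Q[Q[f | m] | mE.comap φ] =ᵐ[Q] Q[fun ω => H (φ ω) | mE.comap φ] := condExp_congr_ae h
  have hi : Integrable (fun ω => H (φ ω)) Q := (integrable_condExp (m := m)).congr h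
  have h2 : Q[fun ω => H (φ ω) | mE.comap φ] = fun ω => H (φ ω) :=
    condExp_of_stronglyMeasurable (μ := Q) (hle.trans hm) hsm hi
  rw [h2] at h1
  exact h.trans (h1.symm.trans (condExp_condExp_of_le hle hm))

theorem IsModel.markov (hD : D.IsModel) {Q : Measure Ω} (hQ : Q ∈ ({D.P₀, D.P} : Set (Measure Ω)))
    {Φ : ℕ → ℝ≥0 → Ω → ℝ} (hadapt : ∀ k, StronglyAdapted D.F (Φ k))
    (hΦ : ∀ t, ∀ᵐ ω ∂Q, ∀ k, Φ k t ω = D.stat (D.history t ω) t k) {s t : ℝ≥0} (hst : s ≤ t)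
    {g : (ℕ → ℝ) → ℝ} (hg : Measurable g) {C : ℝ} (hC : ∀ x, |g x| ≤ C) :
    Q[fun ω => g (fun k => Φ k t ω) | D.F s] =ᵐ[Q]
      Q[fun ω => g (fun k => Φ k t ω) |
        MeasurableSpace.comap (fun ω k => Φ k s ω) inferInstance] := by
  have := hD.prob_P₀
  have := hD.prob_P
  have hfin : IsFiniteMeasure Q := by
    rcases hQ with rfl | rfl <;> infer_instance
  have hH : ∃ H : (ℕ → ℝ) → ℝ, Measurable H ∧
      Q[fun ω => g (D.stat (D.history t ω) t) | D.F s] =ᵐ[Q]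
        fun ω => H (D.stat (D.history s ω) s) := by
    rcases hQ with rfl | rfl
    · refine hD.exists_condExp_P₀ hst hg (Integrable.of_bound (μ := D.P₀) (hg.comp
        ((hD.measurable_stat_left t).comp (D.measurable_history t))).aestronglyMeasurable C
        (ae_of_all _ fun ω => hC _))
    · exact hD.exists_condExp_P hst hg hC
  obtain ⟨H, hH, hHe⟩ := hH
  have hφ : Measurable[D.F s] fun ω k => Φ k s ω :=
    measurable_of_eval fun k => (hadapt k s).measurable
  refine condExp_eq_condExp_comap (Q := Q) (D.F.le s) hφ hH ?_
  refine ((condExp_congr_ae ?_).trans hHe).trans ?_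
  · filter_upwards [hΦ t] with ω hω
    exact congrArg g (funext hω)
  · filter_upwards [hΦ s] with ω hω
    exact congrArg H (funext hω).symm

end MarkovProperty

/-! ### Running costs up to a random time, in `[0, ∞]`. -/

section RunningCosts

variable {Ω : Type*} [mΩ : MeasurableSpace Ω] {d : ℕ} (D : DisorderData Ω d)

section RunningCost

variable {α : Type*} {m0 : MeasurableSpace α}

/-- The set of times before `x`. -/
def timesBefore (x : ℝ≥0∞) : Set ℝ := {t : ℝ | 0 ≤ t ∧ ENNReal.ofReal t < x}

/-- The expected running cost up to the time `τ`. -/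
def runningCost (Q : Measure α) (τ : α → ℝ≥0∞) (f : ℝ → α → ℝ≥0∞) : ℝ≥0∞ :=
  ∫⁻ ω, ∫⁻ t in timesBefore (τ ω), f t ω ∂volume ∂Q

theorem measurableSet_timesBefore (x : ℝ≥0∞) : MeasurableSet (timesBefore x) :=
  (measurableSet_le measurable_const measurable_id).inter
    (measurableSet_lt ENNReal.measurable_ofReal measurable_const)

theorem setLIntegral_timesBefore (x : ℝ≥0∞) (f : ℝ → ℝ≥0∞) :
    ∫⁻ t in timesBefore x, f t = ∫⁻ t in Ici (0 : ℝ), {t | ENNReal.ofReal t < x}.indicator f t := by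
  rw [lintegral_indicator (measurableSet_lt ENNReal.measurable_ofReal measurable_const),
    Measure.restrict_restrict (measurableSet_lt ENNReal.measurable_ofReal measurable_const)]
  congr 2
  ext t
  exact and_comm

theorem measurable_indicator_timesBefore {τ : α → ℝ≥0∞} (hτ : Measurable τ) {f : ℝ → α → ℝ≥0∞}
    (hf : Measurable (Function.uncurry f)) :
    Measurable fun q : α × ℝ => {t | ENNReal.ofReal t < τ q.1}.indicator (fun t => f t q.1) q.2 := by
  have hs : MeasurableSet {q : α × ℝ | ENNReal.ofReal q.2 < τ q.1} :=
    measurableSet_lt (by fun_prop) (by fun_prop)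
  have h : Measurable ({q : α × ℝ | ENNReal.ofReal q.2 < τ q.1}.indicator fun q => f q.2 q.1) :=
    (hf.comp measurable_swap).indicator hs
  exact h

theorem measurable_setLIntegral_timesBefore {τ : α → ℝ≥0∞} (hτ : Measurable τ) {f : ℝ → α → ℝ≥0∞}
    (hf : Measurable (Function.uncurry f)) :
    Measurable fun ω => ∫⁻ t in timesBefore (τ ω), f t ω := by
  simp_rw [setLIntegral_timesBefore]
  exact (measurable_indicator_timesBefore hτ hf).lintegral_prod_right'

theorem runningCost_eq_swap {Q : Measure α} [SFinite Q] {τ : α → ℝ≥0∞} (hτ : Measurable τ)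
    {f : ℝ → α → ℝ≥0∞} (hf : Measurable (Function.uncurry f)) :
    runningCost Q τ f = ∫⁻ t in Ici (0 : ℝ), ∫⁻ ω in {ω | ENNReal.ofReal t < τ ω}, f t ω ∂Q := by
  simp_rw [runningCost, setLIntegral_timesBefore]
  rw [lintegral_lintegral_swap (measurable_indicator_timesBefore hτ hf).aemeasurable]
  refine lintegral_congr fun t => ?_
  rw [← lintegral_indicator (measurableSet_lt measurable_const hτ)]
  rfl

theorem runningCost_add (Q : Measure α) {τ : α → ℝ≥0∞} (hτ : Measurable τ) {f : ℝ → α → ℝ≥0∞}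
    (hf : Measurable (Function.uncurry f)) (g : ℝ → α → ℝ≥0∞) :
    runningCost Q τ (fun t ω => f t ω + g t ω) = runningCost Q τ f + runningCost Q τ g := by
  rw [runningCost, runningCost, runningCost,
    ← lintegral_add_left (measurable_setLIntegral_timesBefore hτ hf)]
  exact lintegral_congr fun ω => lintegral_add_left hf.of_uncurry_right _

theorem runningCost_const_mul (Q : Measure α) (τ : α → ℝ≥0∞) {c : ℝ≥0∞} (hc : c ≠ ⊤)
    (f : ℝ → α → ℝ≥0∞) :
    runningCost Q τ (fun t ω => c * f t ω) = c * runningCost Q τ f := by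
  simp_rw [runningCost, lintegral_const_mul' c _ hc]

theorem runningCost_mono {Q : Measure α} {τ : α → ℝ≥0∞} {f g : ℝ → α → ℝ≥0∞}
    (h : ∀ t ω, 0 ≤ t → f t ω ≤ g t ω) : runningCost Q τ f ≤ runningCost Q τ g :=
  lintegral_mono fun _ => setLIntegral_mono' (measurableSet_timesBefore _) fun t ht => h t _ ht.1

theorem runningCost_congr_ae {Q : Measure α} {τ : α → ℝ≥0∞} {f g : ℝ → α → ℝ≥0∞}
    (h : ∀ᵐ ω ∂Q, ∀ t, 0 ≤ t → f t ω = g t ω) : runningCost Q τ f = runningCost Q τ g :=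
  lintegral_congr_ae <| h.mono fun _ hω =>
    setLIntegral_congr_fun (measurableSet_timesBefore _) fun t ht => hω t ht.1

/-- The truncated difference is the length of `[u, x)`, also for `x = ∞`. -/
theorem tsub_eq_setLIntegral (x : ℝ≥0∞) (u : ℝ≥0) :
    x - u = ∫⁻ t in timesBefore x, if (u : ℝ) ≤ t then 1 else 0 := by
  have hs : ∀ t : ℝ, (if (u : ℝ) ≤ t then 1 else 0 : ℝ≥0∞) = (Ici (u : ℝ)).indicator 1 t :=
    fun t => by simp [indicator_apply]
  simp_rw [hs]
  rw [lintegral_indicator_one measurableSet_Ici, Measure.restrict_apply measurableSet_Ici]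
  induction x with
  | top =>
    have : Ici (u : ℝ) ∩ timesBefore ⊤ = Ici (u : ℝ) := by
      ext t
      simp only [timesBefore, mem_inter_iff, mem_Ici, mem_ofPred_eq, ENNReal.ofReal_lt_top,
        and_true, and_iff_left_iff_imp]
      exact u.2.trans
    simp [this]
  | coe x =>
    have : Ici (u : ℝ) ∩ timesBefore x = Ico (u : ℝ) x := by
      ext t
      simp only [timesBefore, mem_inter_iff, mem_Ici, mem_ofPred_eq, mem_Ico]
      constructor
      · rintro ⟨h1, h2, h3⟩
        refine ⟨h1, ?_⟩
        rwa [ENNReal.ofReal_lt_coe_iff h2] at h3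
      · rintro ⟨h1, h2⟩
        have h0 : 0 ≤ t := u.2.trans h1
        exact ⟨h1, h0, (ENNReal.ofReal_lt_coe_iff h0).2 h2⟩
    rw [this, Real.volume_Ico, ENNReal.ofReal_sub (x : ℝ) (NNReal.coe_nonneg u)]
    simp

/-- Bookkeeping for the penalty: `p` is the false-alarm probability, `a` the expected delay, `x` and
`y` the costs from the positive and negative parts, and `b` the integrated disorder density. Only
`y` is sure to be finite, so the balance is kept without subtraction; if `x = ∞`, then `a = ∞` and
both sides are infinite. -/
theorem ereal_eq_of_split {p a b x y : ℝ≥0∞} {q c e : ℝ} (hq : 0 ≤ q) (hc : 0 < c) (he : 0 < e)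
    (hp : p + b = ENNReal.ofReal q)
    (h : ENNReal.ofReal e * x + b = ENNReal.ofReal c * a + ENNReal.ofReal e * y)
    (hy : ENNReal.ofReal e * y ≤ b) :
    ((p + ENNReal.ofReal c * a : ℝ≥0∞) : EReal) =
      (q : EReal) + (e : EReal) * ((x : EReal) - (y : EReal)) := by
  have he' : ENNReal.ofReal e ≠ 0 := by simpa using he
  have hc' : ENNReal.ofReal c ≠ 0 := by simpa using hc
  have hpb : p + b ≠ ⊤ := hp ▸ ENNReal.ofReal_ne_top
  obtain ⟨hp0, hb0⟩ := ENNReal.add_ne_top.1 hpb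
  have hey : ENNReal.ofReal e * y ≠ ⊤ := ne_top_of_le_ne_top hb0 hy
  have hy0 : y ≠ ⊤ := fun h => hey (h ▸ ENNReal.mul_top he')
  by_cases hx : x = ⊤
  · subst hx
    rw [ENNReal.mul_top he', top_add] at h
    have hca : ENNReal.ofReal c * a = ⊤ := by
      by_contra hne
      exact ENNReal.add_ne_top.2 ⟨hne, hey⟩ h.symm
    lift y to ℝ≥0 using hy0
    rw [hca, add_top, EReal.coe_ennreal_top, EReal.coe_nnreal_eq_coe_real, EReal.top_sub_coe,
      EReal.coe_mul_top_of_pos he, EReal.coe_add_top]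
  · have ha : a ≠ ⊤ := by
      rintro rfl
      rw [ENNReal.mul_top hc', top_add] at h
      exact ENNReal.add_ne_top.2 ⟨ENNReal.mul_ne_top ENNReal.ofReal_ne_top hx, hb0⟩ h
    lift p to ℝ≥0 using hp0
    lift b to ℝ≥0 using hb0
    lift x to ℝ≥0 using hx
    lift y to ℝ≥0 using hy0
    lift a to ℝ≥0 using ha
    lift e to ℝ≥0 using he.le
    lift c to ℝ≥0 using hc.le
    lift q to ℝ≥0 using hq
    simp only [ENNReal.ofReal_coe_nnreal] at *
    norm_cast at h hp
    have h1 : (e : ℝ) * x + b = c * a + e * y := by exact_mod_cast h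
    have h2 : (p : ℝ) + b = q := by exact_mod_cast hp
    rw [show ((p : ℝ≥0∞) + c * a : ℝ≥0∞) = ((p + c * a : ℝ≥0) : ℝ≥0∞) by push_cast; rfl]
    simp only [EReal.coe_nnreal_eq_coe_real]
    rw [← EReal.coe_sub, ← EReal.coe_mul, ← EReal.coe_add]
    congr 1
    push_cast
    linarith

end RunningCost

end RunningCosts

/-! ### The penalty as an expected running cost. -/

section Penalty

variable {Ω : Type*} [mΩ : MeasurableSpace Ω] {d : ℕ} (D : DisorderData Ω d)

variable {D}

theorem measurable_of_forall_le {α : Type*} {_ : MeasurableSpace α} {τ : α → ℝ≥0∞}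
    (h : ∀ t : ℝ≥0, MeasurableSet {a | τ a ≤ t}) : Measurable τ := by
  refine measurable_of_Iic fun x => ?_
  induction x with
  | top => rw [Iic_top, preimage_univ]; exact MeasurableSet.univ
  | coe x => exact h x

theorem measurable_stoppingTime {τ : Ω → ℝ≥0∞} (hτ : IsStoppingTime D.F τ) : Measurable τ :=
  measurable_of_forall_le fun t => D.F.le t _ (hτ t)

theorem comap_stoppingTime_le {τ : Ω → ℝ≥0∞} (hτ : IsStoppingTime D.F τ) :
    MeasurableSpace.comap τ inferInstance ≤
      MeasurableSpace.comap (fun ω k => D.σ k ω) inferInstance ⊔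
        MeasurableSpace.comap (fun ω k => D.Y k ω) inferInstance :=
  (measurable_of_forall_le fun t => D.F_le_comap t _ (hτ t)).comap_le

theorem measurableSet_lt_stoppingTime {τ : Ω → ℝ≥0∞} (hτ : IsStoppingTime D.F τ) (t : ℝ≥0) :
    MeasurableSet[D.F t] {ω | (t : ℝ≥0∞) < τ ω} := by
  have h : {ω | (t : ℝ≥0∞) < τ ω} = {ω | τ ω ≤ (t : ℝ≥0∞)}ᶜ := by
    ext ω
    simp
  rw [h]
  exact MeasurableSet.compl (hτ t)

/-- Changing to the physical measure has no effect before the disorder. -/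
theorem IsModel.measure_stoppingTime_lt_θ (hD : D.IsModel) {τ : Ω → ℝ≥0∞}
    (hτ : IsStoppingTime D.F τ) : D.P {ω | τ ω < D.θ ω} = D.P₀ {ω | τ ω < D.θ ω} := by
  have := hD.prob_P₀
  have := hD.prob_P
  -- The density is available only at fixed finite times, while `τ` may be unbounded. The measures
  -- agree on this π-system of events visible at `u` before the disorder, and `{τ < θ}` is a
  -- countable union of them over rational `u`. Restricting to `{0 < θ}` makes the total masses
  -- agree as well.
  let C : Set (Set Ω) := {E | ∃ (u : ℝ≥0) (A : Set Ω), MeasurableSet[D.F u] A ∧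
    E = A ∩ {ω | u < D.θ ω}}
  have hm : ∀ u : ℝ≥0, MeasurableSet {ω | u < D.θ ω} := fun u =>
    measurableSet_lt measurable_const D.measurable_θ
  have hle : MeasurableSpace.generateFrom C ≤ mΩ := by
    refine MeasurableSpace.generateFrom_le ?_
    rintro _ ⟨u, A, hA, rfl⟩
    exact (D.F.le u A hA).inter (hm u)
  have hpi : IsPiSystem C := by
    rintro _ ⟨u, A, hA, rfl⟩ _ ⟨w, B, hB, rfl⟩ -
    refine ⟨max u w, A ∩ B, MeasurableSet.inter (D.F.mono (le_max_left u w) A hA)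
      (D.F.mono (le_max_right u w) B hB), ?_⟩
    ext ω
    simp only [mem_inter_iff, mem_ofPred_eq, max_lt_iff]
    tauto
  have hsub : ∀ {u : ℝ≥0} {A : Set Ω}, A ∩ {ω | u < D.θ ω} ∩ {ω | 0 < D.θ ω} =
      A ∩ {ω | u < D.θ ω} := fun {u A} =>
    inter_eq_left.2 fun ω hω => pos_of_gt (show u < D.θ ω from hω.2)
  have hbasic : ∀ s, MeasurableSet[MeasurableSpace.generateFrom C] s → ∀ Q : Measure Ω,
      ((Q.restrict {ω | 0 < D.θ ω}).trim hle) s = Q (s ∩ {ω | 0 < D.θ ω}) := fun s hs Q => by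
    rw [trim_measurableSet_eq hle hs, Measure.restrict_apply (hle s hs)]
  have hext : (D.P.restrict {ω | 0 < D.θ ω}).trim hle =
      (D.P₀.restrict {ω | 0 < D.θ ω}).trim hle := by
    refine @ext_of_generate_finite Ω (MeasurableSpace.generateFrom C) _ _ C rfl hpi
      (isFiniteMeasure_trim hle) (fun s hs => ?_) ?_
    · rw [hbasic s (MeasurableSpace.measurableSet_generateFrom hs),
        hbasic s (MeasurableSpace.measurableSet_generateFrom hs)]
      obtain ⟨u, A, hA, rfl⟩ := hs
      rw [hsub, hD.measure_inter_lt_θ hA]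
    · rw [hbasic _ MeasurableSet.univ, hbasic _ MeasurableSet.univ]
      exact hD.measure_inter_lt_θ (t := 0) MeasurableSet.univ
  have hset : {ω | τ ω < D.θ ω} = ⋃ q : ℚ, {ω | τ ω ≤ (Real.toNNReal q : ℝ≥0∞)} ∩
      {ω | Real.toNNReal q < D.θ ω} := by
    ext ω
    simp only [mem_ofPred_eq, mem_iUnion, mem_inter_iff]
    rw [ENNReal.lt_iff_exists_rat_btwn]
    constructor
    · rintro ⟨q, -, h1, h2⟩
      exact ⟨q, h1.le, by exact_mod_cast h2⟩
    · rintro ⟨q, h1, h2⟩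
      rw [← ENNReal.lt_iff_exists_rat_btwn]
      exact h1.trans_lt (by exact_mod_cast h2)
  have hmeas : MeasurableSet[MeasurableSpace.generateFrom C] {ω | τ ω < D.θ ω} := by
    rw [hset]
    exact MeasurableSet.iUnion fun q =>
      MeasurableSpace.measurableSet_generateFrom ⟨_, _, hτ (Real.toNNReal q), rfl⟩
  have hinter : {ω | τ ω < D.θ ω} ∩ {ω | 0 < D.θ ω} = {ω | τ ω < D.θ ω} :=
    inter_eq_left.2 fun ω hω => by
      have : (0 : ℝ≥0∞) < D.θ ω := pos_of_gt (show τ ω < D.θ ω from hω)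
      exact_mod_cast this
  rw [← hinter, ← hbasic _ hmeas, ← hbasic _ hmeas, hext]

theorem IsModel.θlaw_le (hD : D.IsModel) (x : ℝ≥0∞) :
    D.θlaw {u | 0 < u ∧ (u : ℝ≥0∞) ≤ x} = ∫⁻ t in timesBefore x,
      ENNReal.ofReal ((1 - D.prior) * D.lam * Real.exp (-D.lam * t)) := by
  have hms : MeasurableSet {y : ℝ | ENNReal.ofReal y ≤ x} :=
    measurableSet_le ENNReal.measurable_ofReal measurable_const
  have h := congrArg (fun Q => Q {y : ℝ | ENNReal.ofReal y ≤ x}) hD.map_coe_θlaw_restrict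
  rw [Measure.restrict_apply hms, Measure.map_apply NNReal.continuous_coe.measurable
    (hms.inter measurableSet_Ioi), withDensity_apply _ hms, Measure.restrict_restrict hms] at h
  have hset : {u : ℝ≥0 | 0 < u ∧ (u : ℝ≥0∞) ≤ x} =
      ((↑) : ℝ≥0 → ℝ) ⁻¹' ({y : ℝ | ENNReal.ofReal y ≤ x} ∩ Ioi 0) := by
    ext u
    simp [and_comm]
  rw [hset, h]
  refine setLIntegral_congr ?_
  have h0 : ∀ a : ℝ, ∀ᵐ y : ℝ, y ≠ a := fun a => by simp [ae_iff]
  filter_upwards [h0 0, h0 x.toReal] with y hy hyx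
  refine propext ⟨fun ⟨h1, h2⟩ => ⟨le_of_lt h2, lt_of_le_of_ne h1 fun h3 => hyx ?_⟩,
    fun ⟨h1, h2⟩ => ⟨h2.le, lt_of_le_of_ne h1 hy.symm⟩⟩
  rw [← h3, ENNReal.toReal_ofReal (le_of_lt h2)]

/-- A stopping time of the observations is independent of `θ` under `P₀`, so the law of `θ` may be
integrated with `τ` frozen. -/
theorem IsModel.P₀_θ_le_stoppingTime (hD : D.IsModel) {τ : Ω → ℝ≥0∞}
    (hτ : IsStoppingTime D.F τ) : D.P₀ {ω | 0 < D.θ ω ∧ D.θ ω ≤ τ ω} =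
      runningCost D.P₀ τ fun t _ =>
        ENNReal.ofReal ((1 - D.prior) * D.lam * Real.exp (-D.lam * t)) := by
  have := hD.prob_P₀
  have := hD.isProbabilityMeasure_θlaw
  have hτm : Measurable τ := measurable_stoppingTime hτ
  have hind : IndepFun τ D.θ D.P₀ := by
    rw [IndepFun_iff_Indep]
    refine indep_of_indep_of_le_left (indep_of_indep_of_le_right hD.indep_observations ?_)
      (comap_stoppingTime_le hτ)
    exact le_sup_right.trans (MeasurableSpace.comap_prodMk D.Λ D.θ).ge
  have hS : MeasurableSet {q : ℝ≥0∞ × ℝ≥0 | 0 < q.2 ∧ (q.2 : ℝ≥0∞) ≤ q.1} :=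
    (measurableSet_lt measurable_const measurable_snd).inter
      (measurableSet_le measurable_snd.coe_nnreal_ennreal measurable_fst)
  have hmap := hind.map_prod_eq_prod_map_map hτm.aemeasurable D.measurable_θ.aemeasurable
  have h := Measure.map_apply (μ := D.P₀) (hτm.prodMk D.measurable_θ) hS
  rw [hmap] at h
  have : IsProbabilityMeasure (D.P₀.map D.θ) := hD.isProbabilityMeasure_θlaw
  rw [Measure.prod_apply hS, lintegral_map (measurable_measure_prodMk_left hS) hτm] at h
  refine h.symm.trans (lintegral_congr fun ω => ?_)
  exact hD.θlaw_le (τ ω)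

/-- The events `{τ < θ}` and `{0 < θ ≤ τ}` partition `{0 < θ}`, which has probability `1 - π`. -/
theorem IsModel.measure_lt_θ_add (hD : D.IsModel) {τ : Ω → ℝ≥0∞} (hτ : IsStoppingTime D.F τ) :
    D.P {ω | τ ω < D.θ ω} + runningCost D.P₀ τ (fun t _ =>
      ENNReal.ofReal ((1 - D.prior) * D.lam * Real.exp (-D.lam * t))) =
      ENNReal.ofReal (1 - D.prior) := by
  have hτm : Measurable τ := measurable_stoppingTime hτ
  have hθ : Measurable fun ω => (D.θ ω : ℝ≥0∞) := D.measurable_θ.coe_nnreal_ennreal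
  have hms : MeasurableSet {ω | 0 < D.θ ω ∧ (D.θ ω : ℝ≥0∞) ≤ τ ω} :=
    (measurableSet_lt measurable_const D.measurable_θ).inter (measurableSet_le hθ hτm)
  rw [hD.measure_stoppingTime_lt_θ hτ, ← hD.P₀_θ_le_stoppingTime hτ, ← measure_union _ hms]
  · have h := hD.measure_lt_θ 0
    rw [show D.surv 0 = 1 - D.prior by simp [surv]] at h
    rw [← h]
    congr 1
    ext ω
    simp only [mem_union, mem_ofPred_eq]
    constructor
    · rintro (h | h)
      · have : (0 : ℝ≥0∞) < D.θ ω := pos_of_gt h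
        exact_mod_cast this
      · exact h.1
    · intro h
      exact (lt_or_ge _ _).imp_right fun h' => ⟨h, h'⟩
  · exact Set.disjoint_left.2 fun ω h1 h2 => not_le.2 h1 h2.2

theorem measurable_history_uncurry : Measurable fun q : ℝ≥0 × Ω => D.history q.1 q.2 := by
  have hs : ∀ k, MeasurableSet {q : ℝ≥0 × Ω | k < D.N q.1 q.2} := fun k => by
    simp_rw [D.lt_N_iff]
    exact measurableSet_le ((D.measurable_σ k).comp measurable_snd) measurable_fst
  exact measurable_jumpData (measurable_of_Ioi hs)
    (fun k => Measurable.ite (hs k) ((D.measurable_σ k).comp measurable_snd) measurable_const)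
    fun k => Measurable.ite (hs k)
      (D.measurable_r.comp ((D.measurable_Y k).comp measurable_snd)) measurable_const

theorem IsModel.measurable_stat_uncurry (hD : D.IsModel) (k : ℕ) :
    Measurable fun q : ℝ≥0 × Ω => D.stat (D.history q.1 q.2) q.1 k := by
  have := hD.prob_γ
  have := hD.isProbabilityMeasure_θlaw
  exact (measurable_pi_iff.1 measurable_stat k).comp
    (f := fun q : ℝ≥0 × Ω => (D.history q.1 q.2, q.1))
    (measurable_history_uncurry.prodMk measurable_fst)

/-- The delay is the time before `τ` during which `θ ≤ t`. After exchanging integrals, `{t < τ}` is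
an event of `F t`, on which the change of measure with `k = 0` applies. -/
theorem IsModel.lintegral_delay (hD : D.IsModel) {τ : Ω → ℝ≥0∞} (hτ : IsStoppingTime D.F τ) :
    ∫⁻ ω, (τ ω - D.θ ω) ∂D.P = runningCost D.P₀ τ fun t ω =>
      ENNReal.ofReal (D.surv t.toNNReal * D.stat (D.history t.toNNReal ω) t.toNNReal 0) := by
  have := hD.prob_P₀
  have := hD.prob_P
  have hτm : Measurable τ := measurable_stoppingTime hτ
  have hm1 : Measurable (Function.uncurry fun (t : ℝ) (ω : Ω) =>
      if (D.θ ω : ℝ) ≤ t then (1 : ℝ≥0∞) else 0) :=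
    Measurable.ite (measurableSet_le (D.measurable_θ.comp measurable_snd).coe_nnreal_real
      measurable_fst) measurable_const measurable_const
  have hsurv : Measurable D.surv := by unfold surv; fun_prop
  have hm2 : Measurable (Function.uncurry fun (t : ℝ) (ω : Ω) =>
      ENNReal.ofReal (D.surv t.toNNReal * D.stat (D.history t.toNNReal ω) t.toNNReal 0)) := by
    refine ENNReal.measurable_ofReal.comp (Measurable.mul (hsurv.comp (by fun_prop)) ?_)
    exact (hD.measurable_stat_uncurry 0).comp (f := fun q : ℝ × Ω => (q.1.toNNReal, q.2))
      (by fun_prop)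
  have h0 : ∫⁻ ω, (τ ω - D.θ ω) ∂D.P =
      runningCost D.P τ fun t ω => if (D.θ ω : ℝ) ≤ t then 1 else 0 :=
    lintegral_congr fun ω => tsub_eq_setLIntegral (τ ω) (D.θ ω)
  rw [h0, runningCost_eq_swap hτm hm1, runningCost_eq_swap hτm hm2]
  refine setLIntegral_congr_fun measurableSet_Ici fun t ht => ?_
  lift t to ℝ≥0 using ht
  simp only [Real.toNNReal_coe, ENNReal.ofReal_coe_nnreal, NNReal.coe_le_coe]
  have hA := measurableSet_lt_stoppingTime hτ t
  have hle : MeasurableSet {ω | D.θ ω ≤ t} := D.measurable_θ measurableSet_Iic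
  have h := hD.setIntegral_Z_mul t 0 hA
  rw [← ofReal_integral_eq_lintegral_ofReal (hD.integrable_surv_mul_stat t 0).integrableOn
    (ae_of_all _ fun ω => mul_nonneg (hD.surv_pos t).le (hD.stat_history_nonneg t ω)), ← h,
    ofReal_integral_eq_lintegral_ofReal]
  · refine lintegral_congr fun ω => ?_
    by_cases hω : D.θ ω ≤ t <;> simp [hω]
  · simp only [pow_zero]
    exact ((integrable_const (1 : ℝ)).indicator hle).integrableOn
  · refine ae_of_all _ fun ω => ?_
    by_cases hω : D.θ ω ≤ t <;> simp [hω]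

theorem IsModel.penalty_eq (hD : D.IsModel) {c : ℝ} (hc : 0 < c) {τ : Ω → ℝ≥0∞}
    (hτ : IsStoppingTime D.F τ) : (D.penalty c τ : EReal) = ((1 - D.prior : ℝ) : EReal) +
      ((c * (1 - D.prior) : ℝ) : EReal) * D.expectedCost τ fun t ω =>
        Real.exp (-D.lam * t) * (D.stat (D.history t ω) t 0 - D.lam / c) := by
  have := hD.prob_P₀
  have hτm : Measurable τ := measurable_stoppingTime hτ
  have hq := hD.one_sub_prior_pos
  have hlam := hD.lam_pos
  have he : 0 < c * (1 - D.prior) := mul_pos hc hq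
  let h : ℝ → Ω → ℝ := fun t ω => Real.exp (-D.lam * (t.toNNReal : ℝ)) *
    (D.stat (D.history t.toNNReal ω) t.toNNReal 0 - D.lam / c)
  have hm : Measurable (Function.uncurry h) :=
    Measurable.mul (by fun_prop) (((hD.measurable_stat_uncurry 0).comp
      (f := fun q : ℝ × Ω => (q.1.toNNReal, q.2)) (by fun_prop)).sub_const _)
  -- The term `-λ/c` in the running cost cancels the density of `θ` and leaves the delay integrand.
  have hid : ∀ t ω, 0 ≤ t → c * (1 - D.prior) * h t ω +
      (1 - D.prior) * D.lam * Real.exp (-D.lam * t) =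
      c * (D.surv t.toNNReal * D.stat (D.history t.toNNReal ω) t.toNNReal 0) := fun t ω ht => by
    simp only [h, surv, Real.coe_toNNReal t ht]
    field_simp
    ring
  refine ereal_eq_of_split hq.le hc he (b := runningCost D.P₀ τ fun t _ =>
      ENNReal.ofReal ((1 - D.prior) * D.lam * Real.exp (-D.lam * t)))
    (x := runningCost D.P₀ τ fun t ω => ENNReal.ofReal (h t ω))
    (y := runningCost D.P₀ τ fun t ω => ENNReal.ofReal (-h t ω)) (hD.measure_lt_θ_add hτ) ?_ ?_
  · rw [hD.lintegral_delay hτ, ← runningCost_const_mul _ _ ENNReal.ofReal_ne_top,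
      ← runningCost_const_mul _ _ ENNReal.ofReal_ne_top,
      ← runningCost_const_mul _ _ ENNReal.ofReal_ne_top, ← runningCost_add _ hτm,
      add_comm (runningCost _ _ _), ← runningCost_add _ hτm]
    · refine runningCost_congr_ae (ae_of_all _ fun ω t ht => ?_)
      have hz : 0 ≤ D.surv t.toNNReal * D.stat (D.history t.toNNReal ω) t.toNNReal 0 :=
        mul_nonneg (hD.surv_pos _).le (hD.stat_history_nonneg _ ω)
      have hw : 0 ≤ (1 - D.prior) * D.lam * Real.exp (-D.lam * t) := by positivity
      rw [← ENNReal.ofReal_mul he.le, ← ENNReal.ofReal_mul he.le, ← ENNReal.ofReal_mul hc.le,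
        ← hid t ω ht]
      rcases le_total 0 (h t ω) with hs | hs
      · rw [ENNReal.ofReal_of_nonpos (p := c * (1 - D.prior) * -h t ω)
          (mul_nonpos_of_nonneg_of_nonpos he.le (neg_nonpos.2 hs)), zero_add,
          ENNReal.ofReal_add (mul_nonneg he.le hs) hw]
      · have hz' := mul_nonneg hc.le hz
        rw [← hid t ω ht] at hz'
        rw [ENNReal.ofReal_of_nonpos (p := c * (1 - D.prior) * h t ω)
          (mul_nonpos_of_nonneg_of_nonpos he.le hs), zero_add,
          ← ENNReal.ofReal_add (mul_nonneg he.le (neg_nonneg.2 hs)) hz']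
        congr 1
        ring
    · exact (ENNReal.measurable_ofReal.comp hm.neg).const_mul _
    · exact (ENNReal.measurable_ofReal.comp hm).const_mul _
  -- The delay integrand is nonnegative, so the scaled negative part of the cost is at most the
  -- density of `θ`; this bounds the negative cost by a probability.
  · rw [← runningCost_const_mul _ _ ENNReal.ofReal_ne_top]
    refine runningCost_mono fun t ω ht => ?_
    have hz : 0 ≤ D.surv t.toNNReal * D.stat (D.history t.toNNReal ω) t.toNNReal 0 :=
      mul_nonneg (hD.surv_pos _).le (hD.stat_history_nonneg _ ω)
    rw [← ENNReal.ofReal_mul he.le]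
    refine ENNReal.ofReal_le_ofReal ?_
    have := hid t ω ht
    nlinarith [mul_nonneg hc.le hz]

end Penalty

/-! ### Every odds-ratio family is indistinguishable from the explicit one. -/

section OddsRatio

variable {Ω : Type*} [mΩ : MeasurableSpace Ω] {d : ℕ} (D : DisorderData Ω d)

/-- Each time is approached from the right through the dense set. -/
theorem eqOn_of_isCadlag {f g : ℝ≥0 → ℝ} (hf : IsCadlag f) (hg : IsCadlag g) {T : Set ℝ≥0}
    (hT : Dense T) (h : EqOn f g T) (t : ℝ≥0) : f t = g t := by
  have hcl : t ∈ closure (Ioi t ∩ T) := by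
    refine closure_minimal (hT.open_subset_closure_inter isOpen_Ioi) isClosed_closure ?_
    rw [closure_Ioi]
    exact self_mem_Ici
  have hne : (𝓝[Ioi t ∩ T] t).NeBot := mem_closure_iff_nhdsWithin_neBot.1 hcl
  have hle : 𝓝[Ioi t ∩ T] t ≤ 𝓝[Ici t] t :=
    nhdsWithin_mono t (inter_subset_left.trans Ioi_subset_Ici_self)
  refine tendsto_nhds_unique_of_eventuallyEq ((hf t).1.mono_left hle) ((hg t).1.mono_left hle) ?_
  filter_upwards [self_mem_nhdsWithin] with x hx
  exact h hx.2

variable {D}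

theorem IsModel.isOddsRatioFamily_stat (hD : D.IsModel) :
    D.IsOddsRatioFamily fun k t ω => D.stat (D.history t ω) t k where
  adapted k t := (hD.measurable_F_stat t k).stronglyMeasurable
  cadlag _ _ := ae_of_all _ fun ω k => hD.isCadlag_stat ω k
  eq_oddsRatio k t := (hD.oddsRatio_eq t k).symm

/-- At a fixed time both sides are `F t`-measurable, so the `P`-almost sure equality holds under
`P₀` too. A countable dense set of times and the càdlàg paths under the measure in question remove
the dependence of the null set on `t`. -/
theorem IsModel.ae_eq_stat (hD : D.IsModel) {Φ : ℕ → ℝ≥0 → Ω → ℝ} (hΦ : D.IsOddsRatioFamily Φ)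
    {Q : Measure Ω} (hQ : Q ∈ ({D.P₀, D.P} : Set (Measure Ω))) :
    ∀ᵐ ω ∂Q, ∀ k t, Φ k t ω = D.stat (D.history t ω) t k := by
  have hP : ∀ k t, ∀ᵐ ω ∂D.P, Φ k t ω = D.stat (D.history t ω) t k := fun k t =>
    (hΦ.eq_oddsRatio k t).trans (hD.oddsRatio_eq t k)
  have hfix : ∀ k t, ∀ᵐ ω ∂Q, Φ k t ω = D.stat (D.history t ω) t k := by
    intro k t
    rcases hQ with rfl | rfl
    · exact (hD.ae_P_iff (t := t) (measurableSet_eq_fun (hΦ.adapted k t).measurable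
        (hD.measurable_F_stat t k))).1 (hP k t)
    · exact hP k t
  obtain ⟨T, hTc, hTd⟩ := TopologicalSpace.exists_countable_dense ℝ≥0
  have hT : ∀ᵐ ω ∂Q, ∀ k, ∀ t ∈ T, Φ k t ω = D.stat (D.history t ω) t k :=
    ae_all_iff.2 fun k => (ae_ball_iff hTc).2 fun t _ => hfix k t
  filter_upwards [hT, hΦ.cadlag Q hQ] with ω h1 h2 k t
  exact eqOn_of_isCadlag (h2 k) (hD.isCadlag_stat ω k) hTd (fun t ht => h1 k t ht) t

theorem IsModel.isMarkovianSufficientStatistic (hD : D.IsModel) {Φ : ℕ → ℝ≥0 → Ω → ℝ}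
    (hΦ : D.IsOddsRatioFamily Φ) : D.IsMarkovianSufficientStatistic Φ where
  adapted := hΦ.adapted
  markov Q hQ s t hst g hg hC := by
    obtain ⟨C, hC⟩ := hC
    exact hD.markov hQ hΦ.adapted (fun t => (hD.ae_eq_stat hΦ hQ).mono fun ω h k => h k t)
      hst hg hC
  penalty_eq c hc τ hτ := by
    have h : ∀ᵐ ω ∂D.P₀, ∀ t, Φ 0 t ω = D.stat (D.history t ω) t 0 :=
      (hD.ae_eq_stat hΦ (mem_insert _ _)).mono fun ω h t => h 0 t
    rw [hD.penalty_eq hc hτ]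
    congr 2
    refine congrArg₂ (fun x y : ℝ≥0∞ => (x : EReal) - (y : EReal)) ?_ ?_ <;>
    · refine runningCost_congr_ae (h.mono fun ω hω t _ => ?_)
      simp only [hω]

end OddsRatio

end DisorderData

end

theorem mainTheorem2 {Ω : Type*} [MeasurableSpace Ω] {d : ℕ} (D : DisorderData Ω d)
    (hD : D.IsModel) :
    (∃ Φ : ℕ → ℝ≥0 → Ω → ℝ, D.IsOddsRatioFamily Φ) ∧
    ∀ Φ : ℕ → ℝ≥0 → Ω → ℝ, D.IsOddsRatioFamily Φ →
      (∀ Q ∈ ({D.P₀, D.P} : Set (Measure Ω)), ∀ᵐ ω ∂Q,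
        D.SolvesJumpEquation ω (fun k t => Φ k t ω)) ∧
      D.IsMarkovianSufficientStatistic Φ :=
  ⟨⟨_, hD.isOddsRatioFamily_stat⟩, fun Φ hΦ =>
    ⟨fun _ hQ => (hD.ae_eq_stat hΦ hQ).mono fun ω h => by
      rw [show (fun k t => Φ k t ω) = fun k t => D.stat (D.history t ω) t k from
        funext fun k => funext fun t => h k t]
      exact hD.solvesJumpEquation ω, hD.isMarkovianSufficientStatistic hΦ⟩⟩
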